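/- Let $\nabla:\mathbb Z\to\mathbb C$ be the kernel of a local difference operator $(\nabla f)_m=\sum_n\nabla(m-n)f_n$: $\nabla\neq 0$, $|\nabla(k)|\le L e^{-M|k|}$ for all $k$ with some $L$ and some $M>0$, and $\sum_k\nabla(k)=0$. Consider the lattice fields $\phi_{\pm n},F_{\pm n}$ (commuting) and $\chi_{\pm n},\bar\chi_{\pm n}$ (anticommuting), $n\in\mathbb Z$, and site-independent constant fields $\rho^i_\pm$ (commuting) and $\zeta^i_\pm$ (anticommuting), $i=1,\dots,N$, of fermion numbers $N_F=0$ for $\phi,F,\rho$, $N_F=1$ for $\chi$ and $N_F=-1$ for $\bar\chi,\zeta$. Let $Q'_\pm$ be the odd (left) derivations acting on these variables by $$Q'_+:\ \phi_{+n}\mapsto\bar\chi_{+n},\quad \chi_{+n}\mapsto F_{+n},\quad \chi_{-n}\mapsto -i(\nabla\phi_-)_n,\quad F_{-n}\mapsto -i(\nabla\bar\chi_-)_n,\quad \rho^i_+\mapsto\zeta^i_+,$$ $$Q'_-:\ \phi_{-n}\mapsto-\bar\chi_{-n},\quad \chi_{-n}\mapsto F_{-n},\quad \chi_{+n}\mapsto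 i(\nabla\phi_+)_n,\quad F_{+n}\mapsto -i(\nabla\bar\chi_+)_n,\quad \rho^i_-\mapsto-\zeta^i_-,$$ and by $0$ on all other variables. A local functional is a formal sum of monomials in all these variables whose coefficients are invariant under simultaneous translation of all sites and, in each degree, bounded by $L e^{-M|m-n|}$ for any two sites $m,n$ in the monomial (with some $L$ and some $M>0$ depending on the degree). An extended CLR term of type $\pm$ with $N_F=1$ is a local functional that is a sum, over $k\ge 0$, of terms $$\sum_{m,n_1,\dots,n_k}C'_{mn_1\cdots n_k}\,\chi_{\pm m}\phi_{\pm n_1}\cdots\phi_{\pm n_k},$$ where $C'$ is totally symmetric in $n_1,\dots,n_k$, may depend on the constant fields $\rho_\pm$ of the same type, and satisfies the cyclic Leibniz rule $$\sum_{p}\sum_m\nabla(m-n_{p(0)})\,C'_{mn_{p(1)}\cdots n_{p(k)}}=0\qquad\text{for all }n_0,\dots,n_k,$$ $p$ running over the cyclic permutations of $\{0,\dots,k\}$. Let $S'$ be a local functional with $N_F=0$ and without a field-independent constant term such that $Q'_+S'=Q'_-S'=0$. Then $$S'=Q'_+Q'_-T'+Q'_+P'_++Q'_-P'_-$$ for some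 local functional $T'$ with $N_F=2$ and some extended CLR terms $P'_\pm$ of type $\pm$ with $N_F=1$. If $S'$ is a polynomial of degree at most $D$, then $T',P'_+,P'_-$ can be chosen to be so too (for one choice and all such $D$). -/

import Mathlib

/-- The two types of fields, carrying the index `+` or `-`. -/
inductive Pol : Type
  | plus : Pol
  | minus : Pol

/-- The elementary variables: the lattice fields `φ_{± n}`, `χ_{± n}`, `χ̄_{± n}`, `F_{± n}` with
site `n ∈ ℤ`, and the site-independent constant fields `ρ^i_±` with super-partners `ζ^i_±`,
`i = 1, …, N`. -/
inductive Letter (N : ℕ) : Type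
  | phi (s : Pol) (n : ℤ) : Letter N
  | chi (s : Pol) (n : ℤ) : Letter N
  | chiBar (s : Pol) (n : ℤ) : Letter N
  | aux (s : Pol) (n : ℤ) : Letter N
  | rho (s : Pol) (i : Fin N) : Letter N
  | zeta (s : Pol) (i : Fin N) : Letter N

namespace Letter

/-- The fermion number `N_F` of a variable. -/
def fermionNumber {N : ℕ} : Letter N → ℤ
  | phi _ _ => 0
  | chi _ _ => 1
  | chiBar _ _ => -1
  | aux _ _ => 0
  | rho _ _ => 0
  | zeta _ _ => -1

/-- Grassmann parity: `0` for the commuting and `1` for the anticommuting variables. -/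
def parity {N : ℕ} (a : Letter N) : ℕ := a.fermionNumber.natAbs

/-- The site of a lattice field; constant fields have none. -/
def site {N : ℕ} : Letter N → Option ℤ
  | phi _ n => some n
  | chi _ n => some n
  | chiBar _ n => some n
  | aux _ n => some n
  | rho _ _ => none
  | zeta _ _ => none

/-- Translation by one lattice site. -/
def shift {N : ℕ} : Letter N → Letter N
  | phi s n => phi s (n + 1)
  | chi s n => chi s (n + 1)
  | chiBar s n => chiBar s (n + 1)
  | aux s n => aux s (n + 1)
  | rho s i => rho s i
  | zeta s i => zeta s i

end Letter

/-- A (formal) functional `O = ∑_w O(w) w₁ w₂ ⋯ w_d`, summed over all finite words in the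
variables, is recorded by its coefficients. The coefficients are made unique by graded symmetry
(see `IsLocalFunctional.symm`). -/
abbrev Functional (N : ℕ) : Type := List (Letter N) → ℂ

/-- Local functionals: the coefficients are graded symmetric (symmetric in commuting and
antisymmetric in anticommuting variables), invariant under lattice translations, and, in each
degree `d`, exponentially decaying in all differences of sites. -/
structure IsLocalFunctional {N : ℕ} (O : Functional N) : Prop where
  symm : ∀ (u v : List (Letter N)) (a b : Letter N),
    O (u ++ b :: a :: v) = (-1) ^ (a.parity * b.parity) * O (u ++ a :: b :: v)
  translation : ∀ w : List (Letter N), O (w.map Letter.shift) = O w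
  locality : ∀ d : ℕ, ∃ L M : ℝ, 0 < M ∧ ∀ w : List (Letter N), w.length = d →
    ∀ m ∈ w.filterMap Letter.site, ∀ n ∈ w.filterMap Letter.site,
      ‖O w‖ ≤ L * Real.exp (-M * |(m : ℝ) - n|)

/-- `O` lies in the sector of fermion number `q`. -/
def HasFermionNumber {N : ℕ} (O : Functional N) (q : ℤ) : Prop :=
  ∀ w : List (Letter N), O w ≠ 0 → (w.map Letter.fermionNumber).sum = q

/-- `O` is a polynomial of degree at most `D` in the variables (constant fields included). -/
def DegreeLE {N : ℕ} (O : Functional N) (D : ℕ) : Prop :=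
  ∀ w : List (Letter N), D < w.length → O w = 0

/-- A local difference operator `(∇f)_m = ∑_n ∇(m - n) f_n`: exponentially decaying kernel, not
zero, annihilating constants. -/
structure IsDifferenceOperator (nabla : ℤ → ℂ) : Prop where
  locality : ∃ L M : ℝ, 0 < M ∧ ∀ k : ℤ, ‖nabla k‖ ≤ L * Real.exp (-M * |(k : ℝ)|)
  ne_zero : nabla ≠ 0
  sum_eq_zero : ∑' k : ℤ, nabla k = 0

open Classical in
/-- The supercharges on the variables: `superchargeCoeff nabla s a b` is the coefficient of the
variable `b` in `Q'_s a`. -/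
noncomputable def superchargeCoeff {N : ℕ} (nabla : ℤ → ℂ) : Pol → Letter N → Letter N → ℂ
  -- `Q'_+`
  | .plus, .phi .plus n, .chiBar .plus m => if m = n then 1 else 0
  | .plus, .chi .plus n, .aux .plus m => if m = n then 1 else 0
  | .plus, .chi .minus n, .phi .minus m => -Complex.I * nabla (n - m)
  | .plus, .aux .minus n, .chiBar .minus m => -Complex.I * nabla (n - m)
  | .plus, .rho .plus i, .zeta .plus j => if j = i then 1 else 0
  -- `Q'_-`
  | .minus, .phi .minus n, .chiBar .minus m => if m = n then -1 else 0
  | .minus, .chi .minus n, .aux .minus m => if m = n then 1 else 0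
  | .minus, .chi .plus n, .phi .plus m => Complex.I * nabla (n - m)
  | .minus, .aux .plus n, .chiBar .plus m => -Complex.I * nabla (n - m)
  | .minus, .rho .minus i, .zeta .minus j => if j = i then -1 else 0
  | _, _, _ => 0

/-- The supercharge `Q'_s` as an odd left derivation,
`Q (w₁ ⋯ w_d) = ∑_i (-1)^(|w₁| + ⋯ + |w_{i-1}|) w₁ ⋯ (Q w_i) ⋯ w_d`, on functionals: the
coefficient of a word `w` in `Q O` collects, for each position `i`, all variables `a` at this
position whose image under `Q` contains `w_i`. (On local functionals the series over `a`
converges absolutely: it is a convolution of bounded coefficients with the kernel `∇`.) -/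
noncomputable def supercharge {N : ℕ} (nabla : ℤ → ℂ) (s : Pol) (O : Functional N) :
    Functional N :=
  fun w => ∑ i : Fin w.length, (-1) ^ ((w.take i).map Letter.parity).sum *
    ∑' a : Letter N, superchargeCoeff nabla s a (w.get i) * O (w.set i a)

/-- Sums of extended CLR terms of type `s` with `N_F = 1`: local functionals
`∑ C'_{m n₁ ⋯ n_k}(ρ_s) χ_{s m} φ_{s n₁} ⋯ φ_{s n_k}`, `k ≥ 0`, whose coefficients satisfy the
cyclic Leibniz rule, for every monomial in the constant fields `ρ_s`. (Total symmetry in the last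
`k` indices is part of graded symmetry; the combinatorial factor between `C'` and the coefficient
of a word depends only on `k` and on the monomial in `ρ_s`.) -/
structure IsExtendedCLRTerm {N : ℕ} (nabla : ℤ → ℂ) (s : Pol) (P : Functional N) : Prop where
  isLocal : IsLocalFunctional P
  support : ∀ w : List (Letter N), P w ≠ 0 → ∃ (m : ℤ) (n : List ℤ) (r : List (Fin N)),
    w.Perm (Letter.chi s m :: (n.map (Letter.phi s) ++ r.map (Letter.rho s)))
  cyclic : ∀ (k : ℕ) (n : Fin (k + 1) → ℤ) (r : List (Fin N)),
    ∑ j : Fin (k + 1), ∑' m : ℤ, nabla (m - n j) *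
      P (Letter.chi s m ::
        ((List.ofFn fun l : Fin k => Letter.phi s (n (j + l.succ))) ++ r.map (Letter.rho s))) = 0

/-!
The supercharges are odd derivations `Q_s`, `s = ±`, and everything follows from their action on the
variables. Each `Q_s` is the sum of a part that acts on the variables of type `s` by `φ ↦ ± χ̄`, `χ
↦ F`, `ρ ↦ ± ζ`, without involving the lattice, and of a part that acts on the variables of the
opposite type by `χ ↦ ± i ∇φ`, `F ↦ -i ∇χ̄`. The first part has the one-site homotopy `K_s`
(`homotopy`), and `{Q_s, K_s}` counts the variables of type `s`, while `{Q_s, K_t} = 0` for `s ≠ t`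
and `{Q_+, Q_-} = 0`. Let `N_+` and `N_-` be the numbers of variables of the two types in a
monomial.

On monomials with variables of both types, `K_- K_+ / (N_+ N_-)` therefore gives `T`
(`exists_mixed_part`). On monomials with variables of type `s` only, `P_s = K_s S / N_s` satisfies
`Q_s P_s = S` and is annihilated by the other supercharge, which on such functionals is a Koszul
differential `δ` for the convolution operator `∇`. Grade by the number of variables `χ_s` and `F_s`.
As `P_s` has fermion number one, this degree is at least one. The part of degree one contains
exactly one `χ`, besides `φ` and `ρ` only, and its closedness is the cyclic Leibniz rule
(`isExtendedCLRTerm_of_closed`). The part of degree at least two is exact, `δ R`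
(`exists_local_koszul_primitive`), and contributes `± R` to `T`.

The exactness in degree at least two is the analytic core. Convolution with `∇` has no local inverse
when its symbol vanishes on the imaginary axis, as it does at `0` for a difference operator. On
functionals whose coefficients decay away from the origin, however, it has a left inverse `H` that
preserves decay (`exists_left_inverse`): divide by the symbol and integrate along a line that avoids
the zeros, on either side of them according to the sign of the site. Contraction `η` with `H` yields
`{δ, η} = h + M`, with `h` the Koszul degree and `M` the even derivation given by the idempotent `∇
H`. The eigenvalues of `M` on words of length `d` lie in `{0, …, d}`, because its falling factorial
of order `d + 1` vanishes (`fallingPow_eq_zero`), so closed decaying functionals of degree at least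
one are exact (`koszul_exact`). A translation invariant closed functional is then cut at the origin
into two halves, which are corrected to be closed; the difference of the right half with its
translate decays, hence is exact, and the sum of all translates of a primitive is a local primitive
of the original functional. The cut costs one degree.

All identities are proved on coefficients, for functions on words, where `leibniz` describes a
derivation by its matrix on the variables. Interchanging the infinite sums is justified by the
classes `Decays` and `Admissible`, which differ in the weight `σ` attached to the variables.
-/

/-! ### Derivations given by matrices on the variables -/

/-- The derivation of the algebra of words that sends the variable `a` to `∑_b A a b • b`, acting on
coefficients. The grading `p` fixes the sign picked up when the derivation passes a variable: `p` is
the Grassmann parity for odd derivations and `0` for even ones. -/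
noncomputable def leibniz {N : ℕ} (p : Letter N → ℕ) (A : Letter N → Letter N → ℂ)
    (O : Functional N) : Functional N :=
  fun w => ∑ i : Fin w.length, (-1) ^ ((w.take i).map p).sum *
    ∑' a : Letter N, A a (w.get i) * O (w.set i a)

theorem supercharge_eq_leibniz {N : ℕ} (nabla : ℤ → ℂ) (s : Pol) (O : Functional N) :
    supercharge nabla s O = leibniz Letter.parity (superchargeCoeff nabla s) O := rfl

section Calculus

variable {N : ℕ} {p : Letter N → ℕ} {A B : Letter N → Letter N → ℂ} {O O' : Functional N}
  {σ : Letter N → ℝ}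

theorem leibniz_nil : leibniz p A O [] = 0 := by
  simp [leibniz]

/-- The Leibniz rule for splitting off the first variable of a word. -/
theorem leibniz_cons (x : Letter N) (w : List (Letter N)) :
    leibniz p A O (x :: w) = (∑' a, A a x * O (a :: w)) +
      (-1) ^ p x * leibniz p A (fun v => O (x :: v)) w := by
  unfold leibniz
  rw [Finset.mul_sum]
  refine (Fin.sum_univ_succ (n := w.length) _).trans ?_
  congr 1
  · simp
  · refine Finset.sum_congr rfl fun i _ => ?_
    simp [pow_add, mul_assoc]

theorem leibniz_smul (c : ℂ) (w : List (Letter N)) :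
    leibniz p A (fun v => c * O v) w = c * leibniz p A O w := by
  unfold leibniz
  rw [Finset.mul_sum]
  refine Finset.sum_congr rfl fun i _ => ?_
  rw [mul_left_comm]
  congr 1
  rw [← tsum_mul_left]
  exact tsum_congr fun a => mul_left_comm _ _ _

theorem leibniz_zero (w : List (Letter N)) : leibniz p A (fun _ => 0) w = 0 := by
  simpa using leibniz_smul (p := p) (A := A) (O := fun _ => 0) 0 w

/-- The value of a derivation at a word only involves words of the same length, and of fixed
shifted grading if the derivation is homogeneous. -/
theorem leibniz_congr {G : Type*} [AddCommMonoid G] {γ : Letter N → G} {c : G}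
    (hA : ∀ a x, A a x ≠ 0 → γ a = γ x + c) (w : List (Letter N))
    (h : ∀ v : List (Letter N), v.length = w.length → (v.map γ).sum = (w.map γ).sum + c →
      O v = O' v) : leibniz p A O w = leibniz p A O' w := by
  induction w generalizing O O' with
  | nil => simp [leibniz_nil]
  | cons x w ih =>
    rw [leibniz_cons, leibniz_cons]
    congr 1
    · refine tsum_congr fun a => ?_
      by_cases ha : A a x = 0
      · simp [ha]
      · rw [h (a :: w) (by simp) (by simp [hA a x ha, add_right_comm])]
    · congr 1
      refine ih fun v hv hv' => h (x :: v) (by simp [hv]) ?_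
      simp [hv', add_assoc]

theorem leibniz_congr_length (w : List (Letter N))
    (h : ∀ v : List (Letter N), v.length = w.length → O v = O' v) :
    leibniz p A O w = leibniz p A O' w :=
  leibniz_congr (γ := fun _ => (0 : ℕ)) (c := 0) (by simp) w fun v hv _ => h v hv

/-! ### Decay classes -/

/-- Exponential decay, in each degree, in the total size `σ(w₁) + ⋯ + σ(w_d)` of a word. For
`σ = 0` this is boundedness in each degree. -/
def Decays (σ : Letter N → ℝ) (O : Functional N) : Prop :=
  ∀ d : ℕ, ∃ L M : ℝ, 0 < M ∧ ∀ w : List (Letter N), w.length = d →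
    ‖O w‖ ≤ L * Real.exp (-M * (w.map σ).sum)

/-- Matrices on the variables whose derivations act on the decay class of `σ`. -/
def Admissible (σ : Letter N → ℝ) (A : Letter N → Letter N → ℂ) : Prop :=
  ∀ M : ℝ, 0 < M → ∃ C M' : ℝ, 0 < M' ∧ ∀ x,
    Summable (fun a => ‖A a x‖ * Real.exp (-M * σ a)) ∧
      ∑' a, ‖A a x‖ * Real.exp (-M * σ a) ≤ C * Real.exp (-M' * σ x)

theorem Decays.exists_nonneg (h : Decays σ O) (d : ℕ) : ∃ L M : ℝ, 0 ≤ L ∧ 0 < M ∧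
    ∀ w : List (Letter N), w.length = d → ‖O w‖ ≤ L * Real.exp (-M * (w.map σ).sum) := by
  obtain ⟨L, M, hM, hL⟩ := h d
  refine ⟨max L 0, M, le_max_right _ _, hM, fun w hw => (hL w hw).trans ?_⟩
  gcongr
  exact le_max_left _ _

theorem Admissible.exists_nonneg (h : Admissible σ A) {M : ℝ} (hM : 0 < M) :
    ∃ C M' : ℝ, 0 ≤ C ∧ 0 < M' ∧ ∀ x,
    Summable (fun a => ‖A a x‖ * Real.exp (-M * σ a)) ∧
      ∑' a, ‖A a x‖ * Real.exp (-M * σ a) ≤ C * Real.exp (-M' * σ x) := by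
  obtain ⟨L, M', hM, hL⟩ := h M hM
  refine ⟨max L 0, M', le_max_right _ _, hM, fun x => ⟨(hL x).1, (hL x).2.trans ?_⟩⟩
  gcongr
  exact le_max_left _ _

theorem sum_size_nonneg (hσ : ∀ a, 0 ≤ σ a) (w : List (Letter N)) : 0 ≤ (w.map σ).sum :=
  List.sum_nonneg (by simpa using fun a _ => hσ a)

theorem Decays.add (hσ : ∀ a, 0 ≤ σ a) (h : Decays σ O) (h' : Decays σ O') :
    Decays σ (fun w => O w + O' w) := by
  intro d
  obtain ⟨L, M, hL, hM, hb⟩ := h.exists_nonneg d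
  obtain ⟨L', M', hL', hM', hb'⟩ := h'.exists_nonneg d
  refine ⟨L + L', min M M', lt_min hM hM', fun w hw => (norm_add_le _ _).trans ?_⟩
  rw [add_mul]
  have := sum_size_nonneg hσ w
  refine add_le_add ((hb w hw).trans ?_) ((hb' w hw).trans ?_)
  · gcongr
    exact min_le_left _ _
  · gcongr
    exact min_le_right _ _

theorem Decays.mono (h : Decays σ O) (c : ℕ → ℝ)
    (hc : ∀ w : List (Letter N), ‖O' w‖ ≤ c w.length * ‖O w‖) : Decays σ O' := by
  intro d
  obtain ⟨L, M, hL, hM, hb⟩ := h.exists_nonneg d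
  refine ⟨|c d| * L, M, hM, fun w hw => (hc w).trans ?_⟩
  rw [mul_assoc]
  rw [hw]
  exact mul_le_mul (le_abs_self _) (hb w hw) (norm_nonneg _) (abs_nonneg _)

theorem Decays.smul (h : Decays σ O) (c : ℂ) : Decays σ (fun w => c * O w) :=
  h.mono (fun _ => ‖c‖) fun w => by simp

theorem Decays.sub (hσ : ∀ a, 0 ≤ σ a) (h : Decays σ O) (h' : Decays σ O') :
    Decays σ (fun w => O w - O' w) := by
  simpa [sub_eq_add_neg] using h.add hσ (h'.smul (-1))

theorem Decays.sum (hσ : ∀ a, 0 ≤ σ a) {ι : Type*} (s : Finset ι) {F : ι → Functional N}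
    (h : ∀ i ∈ s, Decays σ (F i)) : Decays σ (fun w => ∑ i ∈ s, F i w) := by
  classical
  induction s using Finset.induction_on with
  | empty => exact fun d => ⟨0, 1, one_pos, by simp⟩
  | insert i s hi ih =>
    simp only [Finset.sum_insert hi]
    exact (h i (by simp)).add hσ (ih fun j hj => h j (by simp [hj]))

theorem Decays.cons (h : Decays σ O) (x : Letter N) : Decays σ (fun w => O (x :: w)) := by
  intro d
  obtain ⟨L, M, hM, hb⟩ := h (d + 1)
  refine ⟨L * Real.exp (-M * σ x), M, hM, fun w hw => (hb (x :: w) (by simp [hw])).trans_eq ?_⟩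
  rw [mul_assoc, ← Real.exp_add]
  simp [mul_add]

/-- Decay of a family of functionals that is absolutely summable, uniformly. -/
def FamilyDecays {ι : Type*} (σ : Letter N → ℝ) (F : ι → Functional N) : Prop :=
  ∀ d : ℕ, ∃ L M : ℝ, 0 ≤ L ∧ 0 < M ∧ ∀ w : List (Letter N), w.length = d →
    Summable (fun i => ‖F i w‖) ∧ ∑' i, ‖F i w‖ ≤ L * Real.exp (-M * (w.map σ).sum)

theorem FamilyDecays.cons {ι : Type*} {F : ι → Functional N} (h : FamilyDecays σ F)
    (x : Letter N) : FamilyDecays σ (fun i w => F i (x :: w)) := by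
  intro d
  obtain ⟨L, M, hL, hM, hb⟩ := h (d + 1)
  refine ⟨L * Real.exp (-M * σ x), M, by positivity, hM, fun w hw =>
    ⟨(hb (x :: w) (by simp [hw])).1, (hb (x :: w) (by simp [hw])).2.trans_eq ?_⟩⟩
  rw [mul_assoc, ← Real.exp_add]
  simp [mul_add]

/-- A row of an admissible matrix may be summed against a summable family of functionals in any
order. -/
theorem summable_row_family (hA : Admissible σ A) {ι : Type*} {F : ι → Functional N}
    (hF : FamilyDecays σ F) (x : Letter N) (w : List (Letter N)) :
    Summable (fun q : Letter N × ι => A q.1 x * F q.2 (q.1 :: w)) := by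
  obtain ⟨L, M, hL, hM, hb⟩ := hF (w.length + 1)
  obtain ⟨C, M', -, hC⟩ := hA M hM
  refine Summable.of_norm ((summable_prod_of_nonneg fun _ => norm_nonneg _).2 ⟨fun a => ?_, ?_⟩)
  · simp only [norm_mul]
    exact (hb (a :: w) rfl).1.mul_left _
  simp only [norm_mul, tsum_mul_left]
  refine Summable.of_nonneg_of_le (fun a => mul_nonneg (norm_nonneg _)
    (tsum_nonneg fun _ => norm_nonneg _)) (fun a => ?_)
    ((hC x).1.mul_right (L * Real.exp (-M * (w.map σ).sum)))
  refine (mul_le_mul_of_nonneg_left (hb (a :: w) rfl).2 (norm_nonneg _)).trans_eq ?_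
  rw [List.map_cons, List.sum_cons, mul_add, Real.exp_add]
  ring

theorem Decays.family (h : Decays σ O) : FamilyDecays σ (fun _ : Unit => O) := by
  intro d
  obtain ⟨L, M, hL, hM, hb⟩ := h.exists_nonneg d
  exact ⟨L, M, hL, hM, fun w hw => ⟨Summable.of_finite, by simpa using hb w hw⟩⟩

theorem summable_row (hA : Admissible σ A) (hO : Decays σ O) (x : Letter N)
    (w : List (Letter N)) : Summable (fun a => A a x * O (a :: w)) := by
  have := (Equiv.prodPUnit (Letter N)).symm.summable_iff.2
    (summable_row_family hA hO.family x w)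
  exact this

theorem leibniz_tsum (hA : Admissible σ A) {ι : Type*} {F : ι → Functional N}
    (hF : FamilyDecays σ F) (w : List (Letter N)) :
    HasSum (fun i => leibniz p A (F i) w) (leibniz p A (fun v => ∑' i, F i v) w) := by
  induction w generalizing F with
  | nil => simp only [leibniz_nil]; exact hasSum_zero
  | cons x w ih =>
    simp only [leibniz_cons]
    have hs := summable_row_family hA hF x w
    refine HasSum.add ?_ ((ih (hF.cons x)).mul_left _)
    have e : ∑' a, A a x * ∑' i, F i (a :: w) = ∑' i, ∑' a, A a x * F i (a :: w) := by
      simp only [← tsum_mul_left]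
      exact hs.tsum_comm.symm
    rw [e]
    exact (hs.prod_symm.prod).hasSum

theorem leibniz_add (hA : Admissible σ A) (h : Decays σ O) (h' : Decays σ O')
    (w : List (Letter N)) :
    leibniz p A (fun v => O v + O' v) w = leibniz p A O w + leibniz p A O' w := by
  induction w generalizing O O' with
  | nil => simp [leibniz_nil]
  | cons x w ih =>
    simp only [leibniz_cons, mul_add]
    rw [(summable_row hA h x w).tsum_add (summable_row hA h' x w), ih (h.cons x) (h'.cons x)]
    ring

theorem leibniz_sub (hA : Admissible σ A) (h : Decays σ O) (h' : Decays σ O')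
    (w : List (Letter N)) :
    leibniz p A (fun v => O v - O' v) w = leibniz p A O w - leibniz p A O' w := by
  have := leibniz_add (p := p) hA h (h'.smul (-1)) w
  rw [leibniz_smul] at this
  simpa [sub_eq_add_neg] using this

theorem leibniz_sum (hσ : ∀ a, 0 ≤ σ a) (hA : Admissible σ A) {ι : Type*} (s : Finset ι)
    {F : ι → Functional N} (h : ∀ i ∈ s, Decays σ (F i)) (w : List (Letter N)) :
    leibniz p A (fun v => ∑ i ∈ s, F i v) w = ∑ i ∈ s, leibniz p A (F i) w := by
  classical
  induction s using Finset.induction_on with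
  | empty => simpa using leibniz_zero w
  | insert i s hi ih =>
    simp only [Finset.sum_insert hi]
    rw [leibniz_add hA (h i (by simp)) (Decays.sum hσ s fun j hj => h j (by simp [hj])),
      ih fun j hj => h j (by simp [hj])]

theorem norm_row_le {L M C M' : ℝ} (x : Letter N) (w : List (Letter N))
    (hC : Summable (fun a => ‖A a x‖ * Real.exp (-M * σ a)) ∧
      ∑' a, ‖A a x‖ * Real.exp (-M * σ a) ≤ C * Real.exp (-M' * σ x)) (hL : 0 ≤ L)
    (hO : ∀ a, ‖O (a :: w)‖ ≤ L * Real.exp (-M * (((a :: w).map σ).sum))) :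
    ‖∑' a, A a x * O (a :: w)‖ ≤
      L * C * Real.exp (-M' * σ x) * Real.exp (-M * (w.map σ).sum) := by
  have hb : ∀ a, ‖A a x * O (a :: w)‖ ≤
      ‖A a x‖ * Real.exp (-M * σ a) * (L * Real.exp (-M * (w.map σ).sum)) := by
    intro a
    rw [norm_mul]
    refine (mul_le_mul_of_nonneg_left (hO a) (norm_nonneg _)).trans_eq ?_
    rw [List.map_cons, List.sum_cons, mul_add, Real.exp_add]
    ring
  refine (tsum_of_norm_bounded ((hC.1.mul_right _).hasSum) hb).trans ?_
  rw [tsum_mul_right]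
  refine (mul_le_mul_of_nonneg_right hC.2 (by positivity)).trans_eq ?_
  ring

theorem norm_leibniz_le (hσ : ∀ a, 0 ≤ σ a) {L M C M' : ℝ} (hC0 : 0 ≤ C)
    (hC : ∀ x, Summable (fun a => ‖A a x‖ * Real.exp (-M * σ a)) ∧
      ∑' a, ‖A a x‖ * Real.exp (-M * σ a) ≤ C * Real.exp (-M' * σ x)) (hL : 0 ≤ L)
    (w : List (Letter N)) (hO : ∀ v : List (Letter N), v.length = w.length →
      ‖O v‖ ≤ L * Real.exp (-M * (v.map σ).sum)) :
    ‖leibniz p A O w‖ ≤ w.length * (L * C) * Real.exp (-min M M' * (w.map σ).sum) := by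
  induction w generalizing O L with
  | nil => simp [leibniz_nil]
  | cons x w ih =>
    rw [leibniz_cons]
    refine (norm_add_le _ _).trans ?_
    have h1 := norm_row_le x w (hC x) hL fun a => hO (a :: w) (by simp)
    have h2 := ih (O := fun v => O (x :: v)) (L := L * Real.exp (-M * σ x)) (by positivity)
      fun v hv => (hO (x :: v) (by simp [hv])).trans_eq (by
        rw [mul_assoc, ← Real.exp_add]; simp [mul_add])
    have hx := hσ x
    have hw := sum_size_nonneg hσ w
    have e1 : Real.exp (-M' * σ x) ≤ Real.exp (-min M M' * σ x) := by
      gcongr; exact min_le_right _ _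
    have e2 : Real.exp (-M * (w.map σ).sum) ≤ Real.exp (-min M M' * (w.map σ).sum) := by
      gcongr; exact min_le_left _ _
    have e3 : Real.exp (-M * σ x) ≤ Real.exp (-min M M' * σ x) := by
      gcongr; exact min_le_left _ _
    have e4 : Real.exp (-min M M' * ((x :: w).map σ).sum) =
        Real.exp (-min M M' * σ x) * Real.exp (-min M M' * (w.map σ).sum) := by
      rw [← Real.exp_add]; simp [mul_add]
    have h3 : ‖(-1 : ℂ) ^ p x * leibniz p A (fun v => O (x :: v)) w‖ =
        ‖leibniz p A (fun v => O (x :: v)) w‖ := by simp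
    rw [e4, h3]
    calc _ ≤ L * C * Real.exp (-min M M' * σ x) * Real.exp (-min M M' * (w.map σ).sum) +
          w.length * (L * Real.exp (-min M M' * σ x) * C) *
            Real.exp (-min M M' * (w.map σ).sum) := by
          refine add_le_add (h1.trans ?_) (h2.trans ?_) <;> gcongr
      _ = _ := by push_cast [List.length_cons]; ring

theorem Decays.leibniz (hσ : ∀ a, 0 ≤ σ a) (hA : Admissible σ A) (hO : Decays σ O) :
    Decays σ (leibniz p A O) := by
  intro d
  obtain ⟨L, M, hL, hM, hb⟩ := hO.exists_nonneg d
  obtain ⟨C, M', hC0, hM', hC⟩ := hA.exists_nonneg hM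
  refine ⟨d * (L * C), min M M', lt_min hM hM', fun w hw => ?_⟩
  subst hw
  exact norm_leibniz_le hσ hC0 hC hL w hb

end Calculus

/-! ### Graded symmetry and other structure preserved by derivations -/

section Structure

variable {N : ℕ} {p : Letter N → ℕ} {A B G : Letter N → Letter N → ℂ} {O O' : Functional N}
  {σ : Letter N → ℝ}

/-- Symmetry in commuting and antisymmetry in anticommuting variables. -/
def GradedSymmetric (O : Functional N) : Prop :=
  ∀ (u v : List (Letter N)) (a b : Letter N),
    O (u ++ b :: a :: v) = (-1) ^ (a.parity * b.parity) * O (u ++ a :: b :: v)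

theorem GradedSymmetric.cons (h : GradedSymmetric O) (x : Letter N) :
    GradedSymmetric (fun w => O (x :: w)) :=
  fun u v a b => h (x :: u) v a b

theorem GradedSymmetric.smul (h : GradedSymmetric O) (c : ℂ) :
    GradedSymmetric (fun w => c * O w) := fun u v a b => by
  simp only [h u v a b]; ring

theorem GradedSymmetric.add (h : GradedSymmetric O) (h' : GradedSymmetric O') :
    GradedSymmetric (fun w => O w + O' w) := fun u v a b => by
  simp only [h u v a b, h' u v a b]; ring

theorem GradedSymmetric.sub (h : GradedSymmetric O) (h' : GradedSymmetric O') :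
    GradedSymmetric (fun w => O w - O' w) := fun u v a b => by
  simp only [h u v a b, h' u v a b]; ring

theorem GradedSymmetric.sum {ι : Type*} (s : Finset ι) {F : ι → Functional N}
    (h : ∀ i ∈ s, GradedSymmetric (F i)) : GradedSymmetric (fun w => ∑ i ∈ s, F i w) :=
  fun u v a b => by
    rw [Finset.mul_sum]
    exact Finset.sum_congr rfl fun i hi => h i hi u v a b

theorem GradedSymmetric.tsum {ι : Type*} {F : ι → Functional N}
    (h : ∀ i, GradedSymmetric (F i)) : GradedSymmetric (fun w => ∑' i, F i w) :=
  fun u v a b => by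
    rw [← tsum_mul_left]
    exact tsum_congr fun i => h i u v a b

/-- Multiplication with a symmetric function of the variables of a word. -/
theorem GradedSymmetric.mul (h : GradedSymmetric O) {g : List (Letter N) → ℂ}
    (hg : ∀ u v : List (Letter N), u.Perm v → g u = g v) :
    GradedSymmetric (fun w => g w * O w) := fun u v a b => by
  simp only [h u v a b, hg (u ++ b :: a :: v) (u ++ a :: b :: v)
    (List.Perm.append_left u (List.Perm.swap a b v))]
  ring

/-- The matrix connects commuting with anticommuting variables. -/
def OddMatrix (A : Letter N → Letter N → ℂ) : Prop :=
  ∀ a b, A a b ≠ 0 → Odd (a.parity + b.parity)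

theorem OddMatrix.sign (hA : OddMatrix A) {c b : Letter N} (h : A c b ≠ 0) :
    (-1 : ℂ) ^ c.parity = -(-1) ^ b.parity := by
  have := hA c b h
  have e : (-1 : ℂ) ^ c.parity * (-1) ^ b.parity = -1 := by rw [← pow_add, this.neg_one_pow]
  have e' : (-1 : ℂ) ^ b.parity * (-1) ^ b.parity = 1 := by
    rw [← pow_add, Even.neg_one_pow ⟨_, rfl⟩]
  linear_combination (-1 : ℂ) ^ b.parity * e - (-1) ^ c.parity * e'

theorem OddMatrix.sign_mul (hA : OddMatrix A) {c b : Letter N} (h : A c b ≠ 0) (a : Letter N) :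
    (-1 : ℂ) ^ (a.parity * c.parity) = (-1) ^ (a.parity * b.parity) * (-1) ^ a.parity := by
  rw [mul_comm, pow_mul, hA.sign h, neg_pow, ← pow_mul, mul_comm b.parity, mul_comm]

theorem GradedSymmetric.leibniz (hA : OddMatrix A) (h : GradedSymmetric O) :
    GradedSymmetric (leibniz Letter.parity A O) := by
  intro u v a b
  induction u generalizing O with
  | nil =>
    simp only [List.nil_append, leibniz_cons]
    have e1 : ∑' c, A c b * O (c :: a :: v) =
        (-1) ^ (a.parity * b.parity) * ((-1) ^ a.parity * ∑' c, A c b * O (a :: c :: v)) := by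
      rw [← mul_assoc, ← tsum_mul_left]
      refine tsum_congr fun c => ?_
      by_cases hc : A c b = 0
      · simp [hc]
      · have := h [] v a c
        simp only [List.nil_append] at this
        rw [this, hA.sign_mul hc]
        ring
    have e2 : (-1) ^ b.parity * ∑' c, A c a * O (b :: c :: v) =
        (-1) ^ (a.parity * b.parity) * ∑' c, A c a * O (c :: b :: v) := by
      rw [← tsum_mul_left, ← tsum_mul_left]
      refine tsum_congr fun c => ?_
      by_cases hc : A c a = 0
      · simp [hc]
      · have := h [] v c b
        simp only [List.nil_append] at this
        rw [this, mul_comm c.parity, hA.sign_mul hc, mul_comm a.parity]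
        have e' : (-1 : ℂ) ^ b.parity * (-1) ^ b.parity = 1 := by
          rw [← pow_add, Even.neg_one_pow ⟨_, rfl⟩]
        linear_combination (-1) ^ (b.parity * a.parity) * A c a * O (c :: b :: v) * e'
    have e3 : (fun w => O (b :: a :: w)) =
        fun w => (-1) ^ (a.parity * b.parity) * O (a :: b :: w) := funext fun w => h [] w a b
    rw [e1, mul_add, e2, e3, leibniz_smul]
    ring
  | cons x u ih =>
    simp only [List.cons_append, leibniz_cons]
    rw [ih (h.cons x), mul_add]
    congr 1
    · rw [← tsum_mul_left]
      refine tsum_congr fun c => ?_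
      have := h (c :: u) v a b
      simp only [List.cons_append] at this
      rw [this]; ring
    · ring

/-- Transport of functionals along a map of the variables that intertwines the matrix. -/
theorem leibniz_map (τ : Letter N ≃ Letter N) (hp : ∀ a, p (τ a) = p a)
    (hA : ∀ a b, A (τ a) (τ b) = A a b) (w : List (Letter N)) :
    leibniz p A (fun v => O (v.map τ)) w = leibniz p A O (w.map τ) := by
  induction w generalizing O with
  | nil => simp [leibniz_nil]
  | cons x w ih =>
    simp only [List.map_cons, leibniz_cons, hp]
    rw [ih (O := fun v => O (τ x :: v)), ← τ.tsum_eq fun a => A a (τ x) * O (a :: w.map τ)]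
    simp [hA]

theorem leibniz_zero_of_row {w : List (Letter N)} (h : ∀ x ∈ w, ∀ a, A a x = 0) :
    leibniz p A O w = 0 := by
  induction w generalizing O with
  | nil => exact leibniz_nil
  | cons x w ih =>
    rw [leibniz_cons, ih fun y hy => h y (by simp [hy])]
    simp [h x (by simp)]

/-- Two matrices with the same rows at the variables of a word give the same derivation there. -/
theorem leibniz_congr_row {w : List (Letter N)} (h : ∀ x ∈ w, ∀ a, A a x = B a x) :
    leibniz p A O w = leibniz p B O w := by
  induction w generalizing O with
  | nil => rw [leibniz_nil, leibniz_nil]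
  | cons x w ih =>
    rw [leibniz_cons, leibniz_cons, ih fun y hy => h y (by simp [hy])]
    simp [h x (by simp)]

/-- The part of a functional of given grading. -/
noncomputable def component {M : Type*} [AddMonoid M] (γ : Letter N → M) (q : M)
    (O : Functional N) : Functional N :=
  open Classical in fun w => if (w.map γ).sum = q then O w else 0

theorem component_of_eq {M : Type*} [AddMonoid M] {γ : Letter N → M} {q : M}
    {w : List (Letter N)} (h : (w.map γ).sum = q) : component γ q O w = O w := by
  simp [component, h]

theorem component_of_ne {M : Type*} [AddMonoid M] {γ : Letter N → M} {q : M}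
    {w : List (Letter N)} (h : (w.map γ).sum ≠ q) : component γ q O w = 0 := by
  simp [component, h]

theorem norm_component_le {M : Type*} [AddMonoid M] (γ : Letter N → M) (q : M)
    (w : List (Letter N)) : ‖component γ q O w‖ ≤ ‖O w‖ := by
  unfold component
  split_ifs <;> simp

theorem Decays.component {M : Type*} [AddMonoid M] (h : Decays σ O) (γ : Letter N → M) (q : M) :
    Decays σ (component γ q O) :=
  h.mono (fun _ => 1) fun w => by simpa using norm_component_le γ q w

theorem GradedSymmetric.component {M : Type*} [AddCommMonoid M] (h : GradedSymmetric O)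
    (γ : Letter N → M) (q : M) : GradedSymmetric (component γ q O) := by
  classical
  have := h.mul (g := fun w => if (w.map γ).sum = q then 1 else 0) fun u v huv => by
    rw [(huv.map γ).sum_eq]
  have e : _root_.component γ q O = fun w => (if (w.map γ).sum = q then 1 else 0) * O w := by
    funext w
    unfold _root_.component
    split_ifs <;> simp
  rw [e]
  exact this

/-- A homogeneous derivation shifts the grading. -/
theorem leibniz_component {M : Type*} [AddCommGroup M] {γ : Letter N → M} {c q : M}
    (hA : ∀ a x, A a x ≠ 0 → γ a = γ x + c) :
    leibniz p A (component γ (q + c) O) = component γ q (leibniz p A O) := by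
  funext w
  by_cases h : (w.map γ).sum = q
  · rw [component_of_eq h]
    exact leibniz_congr hA w fun v _ hv => component_of_eq (by rw [hv, h])
  · rw [component_of_ne h]
    rw [← leibniz_zero (p := p) (A := A) w]
    exact leibniz_congr hA w fun v _ hv => component_of_ne (by rw [hv]; simpa using h)

theorem leibniz_eq_zero_of_grading {M : Type*} [AddCommGroup M] {γ : Letter N → M} {c : M}
    (hA : ∀ a x, A a x ≠ 0 → γ a = γ x + c) {w : List (Letter N)}
    (h : ∀ v : List (Letter N), v.length = w.length → (v.map γ).sum = (w.map γ).sum + c →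
      O v = 0) : leibniz p A O w = 0 := by
  rw [leibniz_congr (O' := fun _ => 0) hA w h, leibniz_zero]

/-! ### Anticommutators of derivations -/

/-- The matrix of the composition of two derivations on a single variable. -/
noncomputable def rowComp (A B : Letter N → Letter N → ℂ) (b x : Letter N) : ℂ :=
  ∑' a, A a x * B b a

theorem summable_comp (hA : Admissible σ A) (hB : Admissible σ B) (hO : Decays σ O)
    (x : Letter N) (w : List (Letter N)) :
    Summable (fun q : Letter N × Letter N => A q.1 x * (B q.2 q.1 * O (q.2 :: w))) := by
  obtain ⟨L, M, hL, hM, hb⟩ := hO.exists_nonneg (w.length + 1)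
  obtain ⟨C, M', hC0, hM', hC⟩ := hB.exists_nonneg hM
  obtain ⟨C', M'', -, hC'⟩ := hA M' hM'
  have hle : ∀ a b, ‖B b a * O (b :: w)‖ ≤
      ‖B b a‖ * Real.exp (-M * σ b) * (L * Real.exp (-M * (w.map σ).sum)) := by
    intro a b
    rw [norm_mul]
    refine (mul_le_mul_of_nonneg_left (hb (b :: w) rfl) (norm_nonneg _)).trans_eq ?_
    rw [List.map_cons, List.sum_cons, mul_add, Real.exp_add]
    ring
  have hs : ∀ a, Summable fun b => ‖B b a * O (b :: w)‖ := fun a =>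
    Summable.of_nonneg_of_le (fun _ => norm_nonneg _) (hle a) ((hC a).1.mul_right _)
  refine Summable.of_norm ((summable_prod_of_nonneg fun _ => norm_nonneg _).2 ⟨fun a => ?_, ?_⟩)
  · simp only [norm_mul (A a x)]
    exact (hs a).mul_left _
  simp only [norm_mul (A _ x), tsum_mul_left]
  refine Summable.of_nonneg_of_le (fun a => mul_nonneg (norm_nonneg _)
    (tsum_nonneg fun _ => norm_nonneg _)) (fun a => ?_)
    ((hC' x).1.mul_right (C * (L * Real.exp (-M * (w.map σ).sum))))
  have h2 := ((hs a).tsum_le_tsum (hle a) ((hC a).1.mul_right _)).trans_eq tsum_mul_right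
  refine (mul_le_mul_of_nonneg_left (h2.trans (mul_le_mul_of_nonneg_right (hC a).2
    (by positivity))) (norm_nonneg _)).trans_eq ?_
  ring

theorem tsum_comp (hA : Admissible σ A) (hB : Admissible σ B) (hO : Decays σ O)
    (x : Letter N) (w : List (Letter N)) :
    Summable (fun b => rowComp A B b x * O (b :: w)) ∧
    ∑' a, A a x * ∑' b, B b a * O (b :: w) = ∑' b, rowComp A B b x * O (b :: w) := by
  have hs := summable_comp hA hB hO x w
  have e : ∀ b, rowComp A B b x * O (b :: w) = ∑' a, A a x * (B b a * O (b :: w)) := by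
    intro b
    rw [rowComp, ← tsum_mul_right]
    exact tsum_congr fun a => mul_assoc _ _ _
  simp only [e, ← tsum_mul_left]
  exact ⟨hs.prod_symm.prod, hs.tsum_comm.symm⟩

theorem Decays.rowFamily (hA : Admissible σ A) (hO : Decays σ O)
    (x : Letter N) : FamilyDecays σ (fun a w => A a x * O (a :: w)) := by
  intro d
  obtain ⟨L, M, hL, hM, hb⟩ := hO.exists_nonneg (d + 1)
  obtain ⟨C, M', hC0, hM', hC⟩ := hA.exists_nonneg hM
  have hle : ∀ (w : List (Letter N)), w.length = d → ∀ a, ‖A a x * O (a :: w)‖ ≤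
      ‖A a x‖ * Real.exp (-M * σ a) * (L * Real.exp (-M * (w.map σ).sum)) := by
    intro w hw a
    rw [norm_mul]
    refine (mul_le_mul_of_nonneg_left (hb (a :: w) (by simp [hw])) (norm_nonneg _)).trans_eq ?_
    rw [List.map_cons, List.sum_cons, mul_add, Real.exp_add]
    ring
  refine ⟨C * Real.exp (-M' * σ x) * L, M, by positivity, hM, fun w hw => ?_⟩
  have hs := Summable.of_nonneg_of_le (fun _ => norm_nonneg _) (hle w hw) ((hC x).1.mul_right _)
  refine ⟨hs, ((hs.tsum_le_tsum (hle w hw) ((hC x).1.mul_right _)).trans_eq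
    tsum_mul_right).trans ?_⟩
  refine (mul_le_mul_of_nonneg_right (hC x).2 (by positivity)).trans_eq ?_
  ring

/-- A derivation at the other variables commutes with a substitution of the first one. -/
theorem leibniz_row (hA : Admissible σ A) (hB : Admissible σ B)
    (hO : Decays σ O) (x : Letter N) (w : List (Letter N)) :
    Summable (fun a => A a x * leibniz p B (fun v => O (a :: v)) w) ∧
    leibniz p B (fun v => ∑' a, A a x * O (a :: v)) w =
      ∑' a, A a x * leibniz p B (fun v => O (a :: v)) w := by
  have h := leibniz_tsum (p := p) hB (hO.rowFamily hA x) w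
  simp only [leibniz_smul] at h
  exact ⟨h.summable, h.tsum_eq.symm⟩

theorem leibniz_leibniz_cons (hσ : ∀ a, 0 ≤ σ a) (hA : Admissible σ A) (hB : Admissible σ B)
    (hAo : OddMatrix A) (hO : Decays σ O) (x : Letter N) (w : List (Letter N)) :
    leibniz Letter.parity A (leibniz Letter.parity B O) (x :: w) =
      ∑' b, rowComp A B b x * O (b :: w) -
      (-1) ^ x.parity * ∑' a, A a x * leibniz Letter.parity B (fun v => O (a :: v)) w +
      (-1) ^ x.parity * ∑' a, B a x * leibniz Letter.parity A (fun v => O (a :: v)) w +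
      leibniz Letter.parity A (leibniz Letter.parity B (fun v => O (x :: v))) w := by
  have hs : (-1 : ℂ) ^ x.parity * (-1) ^ x.parity = 1 := by
    rw [← pow_add, Even.neg_one_pow ⟨_, rfl⟩]
  rw [leibniz_cons]
  simp only [leibniz_cons (O := O)]
  have hd : Decays σ (fun v => ∑' a, B a x * O (a :: v)) := by
    intro d
    obtain ⟨L, M, hL, hM, hb⟩ := hO.rowFamily hB x d
    exact ⟨L, M, hM, fun w hw => (norm_tsum_le_tsum_norm (hb w hw).1).trans (hb w hw).2⟩
  rw [leibniz_add hA hd (((hO.cons x).leibniz hσ hB).smul _), leibniz_smul,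
    (leibniz_row hB hA hO x w).2, ← (tsum_comp hA hB hO x w).2]
  have e : ∀ a, A a x * ((∑' b, B b a * O (b :: w)) +
      (-1) ^ a.parity * leibniz Letter.parity B (fun v => O (a :: v)) w) =
      A a x * (∑' b, B b a * O (b :: w)) -
      (-1) ^ x.parity * (A a x * leibniz Letter.parity B (fun v => O (a :: v)) w) := by
    intro a
    by_cases ha : A a x = 0
    · simp [ha]
    · rw [hAo.sign ha]; ring
  have s1 : Summable fun a => A a x * ∑' b, B b a * O (b :: w) := by
    simpa only [tsum_mul_left] using (summable_comp hA hB hO x w).prod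
  simp only [e]
  rw [s1.tsum_sub ((leibniz_row hA hB hO x w).1.mul_left _), tsum_mul_left]
  linear_combination leibniz Letter.parity A (leibniz Letter.parity B (fun v => O (x :: v))) w * hs

/-- The anticommutator of two odd derivations is the even derivation given by the anticommutator of
the matrices. -/
theorem leibniz_anticomm (hσ : ∀ a, 0 ≤ σ a) (hA : Admissible σ A) (hB : Admissible σ B)
    (hAo : OddMatrix A) (hBo : OddMatrix B)
    (hG : ∀ b x, rowComp A B b x + rowComp B A b x = G b x) (hO : Decays σ O) (w : List (Letter N)) :
    leibniz Letter.parity A (leibniz Letter.parity B O) w +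
      leibniz Letter.parity B (leibniz Letter.parity A O) w = leibniz (fun _ => 0) G O w := by
  induction w generalizing O with
  | nil => simp [leibniz_nil]
  | cons x w ih =>
    rw [leibniz_leibniz_cons hσ hA hB hAo hO, leibniz_leibniz_cons hσ hB hA hBo hO, leibniz_cons,
      ← ih (hO.cons x)]
    simp only [← hG, add_mul]
    rw [(tsum_comp hA hB hO x w).1.tsum_add (tsum_comp hB hA hO x w).1]
    ring

theorem leibniz_zero_matrix (w : List (Letter N)) : leibniz p (fun _ _ => 0) O w = 0 :=
  leibniz_zero_of_row (by simp)

/-- The derivation of a diagonal matrix counts variables. -/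
theorem leibniz_diagonal [DecidableEq (Letter N)] (g : Letter N → ℂ) (w : List (Letter N)) :
    leibniz (fun _ => 0) (fun a x => if a = x then g x else 0) O w = (w.map g).sum * O w := by
  induction w generalizing O with
  | nil => simp [leibniz_nil]
  | cons x w ih =>
    rw [leibniz_cons, ih]
    simp [add_mul]

theorem Admissible.comp (hA : Admissible σ A) (hB : Admissible σ B) :
    Admissible σ (rowComp A B) := by
  intro M hM
  obtain ⟨C, M', hC0, hM', hC⟩ := hB.exists_nonneg hM
  obtain ⟨C', M'', hC0', hM'', hC'⟩ := hA.exists_nonneg hM'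
  refine ⟨C' * C, M'', hM'', fun x => ?_⟩
  have hprod : Summable fun q : Letter N × Letter N =>
      ‖A q.1 x‖ * (‖B q.2 q.1‖ * Real.exp (-M * σ q.2)) := by
    refine (summable_prod_of_nonneg fun q => mul_nonneg (norm_nonneg _)
      (mul_nonneg (norm_nonneg _) (Real.exp_nonneg _))).2 ⟨fun a => ?_, ?_⟩
    · exact (hC a).1.mul_left ‖A a x‖
    simp only [tsum_mul_left]
    refine Summable.of_nonneg_of_le (fun a => mul_nonneg (norm_nonneg _)
      (tsum_nonneg fun _ => by positivity)) (fun a => ?_) ((hC' x).1.mul_right C)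
    refine (mul_le_mul_of_nonneg_left (hC a).2 (norm_nonneg _)).trans_eq (by ring)
  have hpt : ∀ b, ‖rowComp A B b x‖ * Real.exp (-M * σ b) ≤
      ∑' a, ‖A a x‖ * (‖B b a‖ * Real.exp (-M * σ b)) := by
    intro b
    have hsb := hprod.prod_symm.prod_factor b
    have hsb' : Summable fun a => ‖A a x * B b a‖ := by
      have := hsb.mul_right (Real.exp (-M * σ b))⁻¹
      refine this.congr fun a => ?_
      rw [norm_mul]
      simp only [Prod.swap]
      field_simp
    refine (mul_le_mul_of_nonneg_right (norm_tsum_le_tsum_norm hsb') (by positivity)).trans_eq ?_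
    rw [← tsum_mul_right]
    exact tsum_congr fun a => by rw [norm_mul, mul_assoc]
  have hs := Summable.of_nonneg_of_le (fun _ => by positivity) hpt hprod.prod_symm.prod
  refine ⟨hs, (hs.tsum_le_tsum hpt hprod.prod_symm.prod).trans ?_⟩
  rw [show (∑' b, ∑' a, ‖A a x‖ * (‖B b a‖ * Real.exp (-M * σ b))) =
    ∑' a, ∑' b, ‖A a x‖ * (‖B b a‖ * Real.exp (-M * σ b)) from hprod.tsum_comm]
  simp only [tsum_mul_left]
  have hle : ∀ a, ‖A a x‖ * ∑' b, ‖B b a‖ * Real.exp (-M * σ b) ≤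
      ‖A a x‖ * Real.exp (-M' * σ a) * C := fun a =>
    (mul_le_mul_of_nonneg_left (hC a).2 (norm_nonneg _)).trans_eq (by ring)
  refine ((Summable.of_nonneg_of_le (fun a => mul_nonneg (norm_nonneg _)
      (tsum_nonneg fun _ => by positivity)) hle ((hC' x).1.mul_right C)).tsum_le_tsum hle
      ((hC' x).1.mul_right C)).trans ?_
  rw [tsum_mul_right]
  exact (mul_le_mul_of_nonneg_right (hC' x).2 hC0).trans_eq (by ring)

theorem leibniz_add_matrix (hA : Admissible σ A) (hB : Admissible σ B) (hO : Decays σ O)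
    (w : List (Letter N)) :
    leibniz p (fun a x => A a x + B a x) O w = leibniz p A O w + leibniz p B O w := by
  induction w generalizing O with
  | nil => simp [leibniz_nil]
  | cons x w ih =>
    simp only [leibniz_cons, ih (hO.cons x), add_mul]
    rw [(summable_row hA hO x w).tsum_add (summable_row hB hO x w)]
    ring

end Structure

/-! ### Falling factorials of an idempotent derivation -/

section Falling

variable {N : ℕ} {A : Letter N → Letter N → ℂ} {O O' : Functional N} {σ : Letter N → ℝ}

/-- The falling factorial `Φ (Φ - 1) ⋯ (Φ - n + 1)` of an operator on functionals. -/
def fallingPow (Φ : Functional N → Functional N) : ℕ → Functional N → Functional N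
  | 0, O => O
  | n + 1, O => fun w => Φ (fallingPow Φ n O) w - n * fallingPow Φ n O w

theorem fallingPow_succ (Φ : Functional N → Functional N) (n : ℕ) (O : Functional N)
    (w : List (Letter N)) :
    fallingPow Φ (n + 1) O w = Φ (fallingPow Φ n O) w - n * fallingPow Φ n O w := rfl

/-- Substitution of the first variable of a word. -/
noncomputable def headMap (A : Letter N → Letter N → ℂ) (O : Functional N) : Functional N
  | [] => 0
  | x :: w => ∑' a, A a x * O (a :: w)

/-- The even derivation restricted to all variables of a word but the first. -/
noncomputable def tailMap (A : Letter N → Letter N → ℂ) (O : Functional N) : Functional N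
  | [] => 0
  | x :: w => leibniz (fun _ => 0) A (fun v => O (x :: v)) w

theorem leibniz_eq_head_add_tail (w : List (Letter N)) :
    leibniz (fun _ => 0) A O w = headMap A O w + tailMap A O w := by
  cases w with
  | nil => simp [leibniz_nil, headMap, tailMap]
  | cons x w => simp [leibniz_cons, headMap, tailMap]

theorem Decays.headMap (hσ : ∀ a, 0 ≤ σ a) (hA : Admissible σ A) (hO : Decays σ O) :
    Decays σ (headMap A O) := by
  intro d
  obtain ⟨L, M, hL, hM, hb⟩ := hO.exists_nonneg d
  obtain ⟨C, M', hC0, hM', hC⟩ := hA.exists_nonneg hM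
  refine ⟨L * C, min M M', lt_min hM hM', fun w hw => ?_⟩
  cases w with
  | nil => simpa [_root_.headMap] using mul_nonneg hL hC0
  | cons x w =>
    refine (norm_row_le x w (hC x) hL fun a => hb (a :: w) (by simpa using hw)).trans ?_
    rw [List.map_cons, List.sum_cons, mul_add, Real.exp_add, mul_assoc]
    have hx := hσ x
    have hw := sum_size_nonneg hσ w
    gcongr
    · exact min_le_right _ _
    · exact min_le_left _ _

theorem Decays.tailMap (hσ : ∀ a, 0 ≤ σ a) (hA : Admissible σ A) (hO : Decays σ O) :
    Decays σ (tailMap A O) := by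
  have := (hO.leibniz (p := fun _ => 0) hσ hA).sub hσ (hO.headMap hσ hA)
  simpa [leibniz_eq_head_add_tail] using this

theorem headMap_add (hA : Admissible σ A) (h : Decays σ O) (h' : Decays σ O')
    (w : List (Letter N)) :
    headMap A (fun v => O v + O' v) w = headMap A O w + headMap A O' w := by
  cases w with
  | nil => simp [headMap]
  | cons x w =>
    simp only [headMap, mul_add]
    exact (summable_row hA h x w).tsum_add (summable_row hA h' x w)

theorem headMap_smul (c : ℂ) (w : List (Letter N)) :
    headMap A (fun v => c * O v) w = c * headMap A O w := by
  cases w with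
  | nil => simp [headMap]
  | cons x w =>
    simp only [headMap, ← tsum_mul_left]
    exact tsum_congr fun a => mul_left_comm _ _ _

theorem tailMap_add (hA : Admissible σ A) (h : Decays σ O) (h' : Decays σ O')
    (w : List (Letter N)) :
    tailMap A (fun v => O v + O' v) w = tailMap A O w + tailMap A O' w := by
  cases w with
  | nil => simp [tailMap]
  | cons x w => exact leibniz_add hA (h.cons x) (h'.cons x) w

theorem tailMap_smul (c : ℂ) (w : List (Letter N)) :
    tailMap A (fun v => c * O v) w = c * tailMap A O w := by
  cases w with
  | nil => simp [tailMap]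
  | cons x w => exact leibniz_smul (O := fun v => O (x :: v)) c w

theorem headMap_tailMap (hA : Admissible σ A) (hO : Decays σ O) :
    headMap A (tailMap A O) = tailMap A (headMap A O) := by
  funext w
  cases w with
  | nil => rfl
  | cons x w =>
    exact (leibniz_row hA hA hO x w).2.symm

theorem decays_fallingPow_tailMap (hσ : ∀ a, 0 ≤ σ a) (hA : Admissible σ A) (n : ℕ)
    (hO : Decays σ O) : Decays σ (fallingPow (tailMap A) n O) := by
  induction n with
  | zero => exact hO
  | succ n ih => exact (ih.tailMap hσ hA).sub hσ (ih.smul _)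

theorem headMap_fallingPow (hσ : ∀ a, 0 ≤ σ a) (hA : Admissible σ A) (n : ℕ)
    (hO : Decays σ O) :
    headMap A (fallingPow (tailMap A) n O) = fallingPow (tailMap A) n (headMap A O) := by
  induction n with
  | zero => rfl
  | succ n ih =>
    have hd := decays_fallingPow_tailMap hσ hA n hO
    funext w
    have := headMap_add hA (hd.tailMap hσ hA) (hd.smul (-n)) w
    simp only [fallingPow, ← ih, ← headMap_tailMap hA hd]
    rw [headMap_smul] at this
    simpa [sub_eq_add_neg] using this

/-- The Vandermonde identity for falling factorials of a sum of commuting operators, one of which is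
idempotent. -/
theorem fallingPow_leibniz (hσ : ∀ a, 0 ≤ σ a) (hA : Admissible σ A) (hO : Decays σ O)
    (hid : headMap A (headMap A O) = headMap A O) (n : ℕ) (w : List (Letter N)) :
    fallingPow (leibniz (fun _ => 0) A) n O w =
      fallingPow (tailMap A) n O w + n * fallingPow (tailMap A) (n - 1) (headMap A O) w := by
  induction n generalizing w with
  | zero => simp [fallingPow]
  | succ n ih =>
    have ih' : fallingPow (leibniz (fun _ => 0) A) n O = fun w =>
      fallingPow (tailMap A) n O w + n * fallingPow (tailMap A) (n - 1) (headMap A O) w :=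
      funext ih
    have hH := hO.headMap hσ hA
    have d1 := decays_fallingPow_tailMap hσ hA n hO
    have d2 := decays_fallingPow_tailMap hσ hA (n - 1) hH
    rw [fallingPow_succ, ih', leibniz_eq_head_add_tail, headMap_add hA d1 (d2.smul _),
      tailMap_add hA d1 (d2.smul _), headMap_smul, tailMap_smul, headMap_fallingPow hσ hA n hO,
      headMap_fallingPow hσ hA (n - 1) hH, hid]
    rcases n with _ | n
    · simp [fallingPow]; ring
    · simp only [fallingPow, Nat.add_sub_cancel]
      push_cast
      ring

theorem fallingPow_tailMap_cons (n : ℕ) (x : Letter N) (w : List (Letter N)) :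
    fallingPow (tailMap A) n O (x :: w) =
      fallingPow (leibniz (fun _ => 0) A) n (fun v => O (x :: v)) w := by
  induction n generalizing w with
  | zero => rfl
  | succ n ih =>
    simp only [fallingPow, tailMap]
    rw [ih, show (fun v => fallingPow (tailMap A) n O (x :: v)) = _ from funext ih]

/-- On words of length `d` the derivation of an idempotent matrix has its eigenvalues in
`{0, …, d}`. -/
theorem fallingPow_eq_zero (hσ : ∀ a, 0 ≤ σ a) (hA : Admissible σ A)
    (hid : ∀ O : Functional N, Decays σ O → headMap A (headMap A O) = headMap A O)
    (hO : Decays σ O) {n : ℕ} {w : List (Letter N)} (hn : w.length < n) :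
    fallingPow (leibniz (fun _ => 0) A) n O w = 0 := by
  induction w generalizing O n with
  | nil =>
    induction n with
    | zero => simp at hn
    | succ n ih =>
      rcases n with _ | n
      · simp [fallingPow, leibniz_nil]
      · rw [fallingPow_succ, ih (by simp), leibniz_nil]; simp
  | cons x w ih =>
    rw [fallingPow_leibniz hσ hA hO (hid O hO), fallingPow_tailMap_cons, fallingPow_tailMap_cons,
      ih (hO.cons x) (by simp at hn; omega),
      ih ((hO.headMap hσ hA).cons x) (by simp at hn; omega)]
    simp

end Falling

/-! ### A left inverse of convolution with an exponentially decaying kernel -/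

section LeftInverse

open Complex MeasureTheory Topology Filter

theorem summable_exp_neg_mul_abs {c : ℝ} (hc : 0 < c) :
    Summable fun n : ℤ => Real.exp (-c * |(n : ℝ)|) := by
  have h : Summable fun n : ℕ => Real.exp (-c * (n : ℝ)) := by
    simpa [mul_comm] using Real.summable_exp_nat_mul_iff.2 (neg_lt_zero.2 hc)
  refine Summable.of_nat_of_neg ?_ ?_ <;> simpa using h

/-- The Fourier symbol `∑_l κ(l) e^{l z}` of convolution with `κ`. -/
noncomputable def symbol (κ : ℤ → ℂ) (z : ℂ) : ℂ := ∑' l : ℤ, κ l * cexp (l * z)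

variable {κ : ℤ → ℂ} {L M : ℝ}

theorem norm_symbol_term_le (hκ : ∀ l : ℤ, ‖κ l‖ ≤ L * Real.exp (-M * |(l : ℝ)|)) {z : ℂ}
    (hz : |z.re| ≤ M / 2) (l : ℤ) :
    ‖κ l * cexp (l * z)‖ ≤ L * Real.exp (-(M / 2) * |(l : ℝ)|) := by
  have hL : 0 ≤ L := by simpa using (norm_nonneg _).trans (hκ 0)
  rw [norm_mul, Complex.norm_exp]
  refine (mul_le_mul_of_nonneg_right (hκ l) (Real.exp_nonneg _)).trans ?_
  rw [mul_assoc, ← Real.exp_add]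
  gcongr
  have h1 : ((l : ℂ) * z).re = l * z.re := by simp
  rw [h1]
  have h2 : (l : ℝ) * z.re ≤ |(l : ℝ)| * (M / 2) :=
    (le_abs_self _).trans (by rw [abs_mul]; gcongr)
  linarith

theorem hasSum_symbol (hM : 0 < M) (hκ : ∀ l : ℤ, ‖κ l‖ ≤ L * Real.exp (-M * |(l : ℝ)|)) {z : ℂ}
    (hz : |z.re| ≤ M / 2) : HasSum (fun l : ℤ => κ l * cexp (l * z)) (symbol κ z) :=
  (Summable.of_norm_bounded ((summable_exp_neg_mul_abs (half_pos hM)).mul_left L)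
    (norm_symbol_term_le hκ hz)).hasSum

theorem isOpen_strip (r : ℝ) : IsOpen {z : ℂ | |z.re| < r} :=
  isOpen_lt (continuous_abs.comp continuous_re) continuous_const

theorem differentiableOn_symbol (hM : 0 < M)
    (hκ : ∀ l : ℤ, ‖κ l‖ ≤ L * Real.exp (-M * |(l : ℝ)|)) :
    DifferentiableOn ℂ (symbol κ) {z : ℂ | |z.re| < M / 2} :=
  differentiableOn_tsum_of_summable_norm
    ((summable_exp_neg_mul_abs (half_pos hM)).mul_left L) (fun l => by fun_prop)
    (isOpen_strip _) fun l _ hz => norm_symbol_term_le hκ (le_of_lt hz) l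

theorem symbol_add_period (z : ℂ) (n : ℤ) :
    symbol κ (z + n * (2 * Real.pi * I)) = symbol κ z := by
  unfold symbol
  refine tsum_congr fun l => ?_
  rw [mul_add, Complex.exp_add]
  have : (l : ℂ) * (n * (2 * Real.pi * I)) = ((l * n : ℤ) : ℂ) * (2 * Real.pi * I) := by
    push_cast; ring
  rw [this, Complex.exp_int_mul_two_pi_mul_I, mul_one]

theorem hasSum_integral_symbol (hM : 0 < M)
    (hκ : ∀ l : ℤ, ‖κ l‖ ≤ L * Real.exp (-M * |(l : ℝ)|)) {x : ℝ} (hx : |x| ≤ M / 2)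
    {g : ℝ → ℂ} (hg : Continuous g) :
    HasSum (fun l : ℤ => κ l * ∫ θ in (0 : ℝ)..2 * Real.pi, cexp (l * (x + θ * I)) * g θ)
      (∫ θ in (0 : ℝ)..2 * Real.pi, symbol κ (x + θ * I) * g θ) := by
  have hre : ∀ θ : ℝ, |((x : ℂ) + θ * I).re| ≤ M / 2 := fun θ => by simpa using hx
  have := intervalIntegral.hasSum_integral_of_dominated_convergence (μ := volume)
    (a := 0) (b := 2 * Real.pi)
    (F := fun (l : ℤ) (θ : ℝ) => κ l * (cexp (l * (x + θ * I)) * g θ))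
    (f := fun θ => symbol κ (x + θ * I) * g θ)
    (fun l θ => L * Real.exp (-(M / 2) * |(l : ℝ)|) * ‖g θ‖)
    (fun l => Continuous.aestronglyMeasurable (by fun_prop))
    (fun l => Eventually.of_forall fun θ _ => by
      rw [← mul_assoc, norm_mul]
      exact mul_le_mul_of_nonneg_right (norm_symbol_term_le hκ (hre θ) l) (norm_nonneg _))
    (Eventually.of_forall fun θ _ =>
      ((summable_exp_neg_mul_abs (half_pos hM)).mul_left L).mul_right _)
    (by
      simp only [tsum_mul_right]
      exact Continuous.intervalIntegrable (by fun_prop) _ _)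
    (Eventually.of_forall fun θ _ => by
      simpa only [mul_assoc] using (hasSum_symbol hM hκ (hre θ)).mul_right (g θ))
  simpa only [intervalIntegral.integral_const_mul] using this

theorem integral_exp_int_mul (n : ℤ) :
    ∫ θ in (0 : ℝ)..2 * Real.pi, cexp (n * (θ * I)) = if n = 0 then (2 * Real.pi : ℂ) else 0 := by
  split_ifs with h
  · simp [h]
  · have hn : (n : ℂ) * I ≠ 0 := mul_ne_zero (by exact_mod_cast h) I_ne_zero
    have e : ∀ θ : ℝ, cexp (n * (θ * I)) = cexp (n * I * θ) := fun θ => by ring_nf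
    simp only [e]
    rw [integral_exp_mul_complex hn]
    have : (n : ℂ) * I * ((2 * Real.pi : ℝ) : ℂ) = n * (2 * Real.pi * I) := by push_cast; ring
    rw [this, Complex.exp_int_mul_two_pi_mul_I]
    simp

theorem exists_symbol_ne_zero (hM : 0 < M)
    (hκ : ∀ l : ℤ, ‖κ l‖ ≤ L * Real.exp (-M * |(l : ℝ)|)) (hne : κ ≠ 0) :
    ∃ θ : ℝ, symbol κ (θ * I) ≠ 0 := by
  by_contra! h
  refine hne (funext fun r => ?_)
  have h1 := hasSum_integral_symbol (x := 0) (g := fun θ => cexp (-r * (θ * I))) hM hκ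
    (by simpa using (half_pos hM).le) (by fun_prop)
  have e : ∀ l : ℤ, (∫ θ in (0 : ℝ)..2 * Real.pi,
      cexp (l * (((0 : ℝ) : ℂ) + θ * I)) * cexp (-r * (θ * I))) =
      if l = r then (2 * Real.pi : ℂ) else 0 := by
    intro l
    rw [show (if l = r then (2 * Real.pi : ℂ) else 0) =
      if l - r = 0 then (2 * Real.pi : ℂ) else 0 by
      simp [sub_eq_zero], ← integral_exp_int_mul]
    refine intervalIntegral.integral_congr fun θ _ => ?_
    simp only [← Complex.exp_add]
    congr 1
    push_cast
    ring
  simp only [e] at h1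
  have h2 : HasSum (fun l : ℤ => κ l * if l = r then (2 * Real.pi : ℂ) else 0)
      (κ r * (2 * Real.pi)) := by
    convert hasSum_ite_eq r (κ r * (2 * Real.pi : ℂ)) using 2 with l
    split_ifs with hl
    · rw [hl]
    · simp
  have h3 := h2.unique h1
  simp only [Complex.ofReal_zero, zero_add, h, zero_mul, intervalIntegral.integral_zero] at h3
  have hpi : (2 * Real.pi : ℂ) ≠ 0 := by simp [Real.pi_ne_zero]
  simpa [hpi] using h3

/-- The zeros of the symbol in a thin strip all lie on the imaginary axis. -/
theorem exists_zero_free_strip (hM : 0 < M)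
    (hκ : ∀ l : ℤ, ‖κ l‖ ≤ L * Real.exp (-M * |(l : ℝ)|)) (hne : κ ≠ 0) :
    ∃ r : ℝ, 0 < r ∧ r < M / 2 ∧ ∀ z : ℂ, z.re ≠ 0 → |z.re| < r → symbol κ z ≠ 0 := by
  set U := {z : ℂ | |z.re| < M / 2} with hU
  set K : Set ℂ := Set.Icc (-(M / 4)) (M / 4) ×ℂ Set.Icc 0 (2 * Real.pi) with hK
  have hKU : K ⊆ U := by
    intro z hz
    rw [hK, Complex.mem_reProdIm, Set.mem_Icc] at hz
    rw [hU, Set.mem_ofPred_eq, abs_lt]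
    constructor <;> linarith [hz.1.1, hz.1.2]
  have hpre : IsPreconnected U := by
    have : U = re ⁻¹' Set.Ioo (-(M / 2)) (M / 2) := by
      ext z
      simp [hU, abs_lt]
    rw [this]
    exact ((convex_Ioo _ _).linear_preimage reLm).isPreconnected
  have han : AnalyticOnNhd ℂ (symbol κ) U :=
    (differentiableOn_symbol hM hκ).analyticOnNhd (isOpen_strip _)
  have hfin : {z ∈ K | symbol κ z = 0}.Finite := by
    by_contra hinf
    obtain ⟨z₀, hz₀, hacc⟩ := Set.Infinite.exists_accPt_of_subset_isCompact hinf
      (isCompact_Icc.reProdIm isCompact_Icc) (Set.sep_subset _ _)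
    obtain ⟨θ, hθ⟩ := exists_symbol_ne_zero hM hκ hne
    refine hθ (han.eqOn_zero_of_preconnected_of_frequently_eq_zero hpre (hKU hz₀) ?_
      (show (θ * I : ℂ) ∈ U by simpa [hU] using half_pos hM))
    exact (accPt_iff_frequently_nhdsNE.1 hacc).mono fun z hz => hz.2
  have hev : ∀ᶠ r : ℝ in 𝓝[>] 0, ∀ z ∈ {z ∈ K | symbol κ z = 0}, z.re ≠ 0 → r < |z.re| := by
    rw [hfin.eventually_all]
    intro z _
    by_cases hz : z.re = 0
    · simp [hz]
    · exact (eventually_nhdsWithin_of_eventually_nhds (eventually_lt_nhds (abs_pos.2 hz))).mono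
        fun r hr _ => hr
  obtain ⟨r, hr, hr0, hrM⟩ := (hev.and ((eventually_mem_nhdsWithin (s := Set.Ioi (0 : ℝ))).and
    (eventually_nhdsWithin_of_eventually_nhds
      (eventually_lt_nhds (show (0 : ℝ) < M / 4 by positivity))))).exists
  refine ⟨r, hr0, by linarith, fun z hz0 hzr hz => ?_⟩
  obtain ⟨n, hn, -⟩ := existsUnique_add_zsmul_mem_Ico Real.two_pi_pos z.im 0
  have hre : (z + n * (2 * Real.pi * I)).re = z.re := by simp
  have him : (z + n * (2 * Real.pi * I)).im = z.im + n * (2 * Real.pi) := by simp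
  have := hr (z + n * (2 * Real.pi * I)) ⟨by
    rw [hK, Complex.mem_reProdIm, hre, him]
    rw [abs_lt] at hzr
    rw [zsmul_eq_mul] at hn
    exact ⟨⟨by linarith, by linarith⟩, hn.1, by linarith [hn.2]⟩, by
    rw [symbol_add_period, hz]⟩ (by rwa [hre])
  rw [hre] at this
  linarith

/-- The Fourier coefficients of the inverse of the symbol on the line `Re z = x`. -/
noncomputable def green (κ : ℤ → ℂ) (x : ℝ) (j : ℤ) : ℂ :=
  (2 * Real.pi : ℂ)⁻¹ * ∫ θ in (0 : ℝ)..2 * Real.pi,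
    cexp (j * (x + θ * I)) * (symbol κ (x + θ * I))⁻¹

theorem continuous_inv_symbol (hM : 0 < M)
    (hκ : ∀ l : ℤ, ‖κ l‖ ≤ L * Real.exp (-M * |(l : ℝ)|)) {x : ℝ} (hx : |x| < M / 2)
    (h0 : ∀ θ : ℝ, symbol κ (x + θ * I) ≠ 0) :
    Continuous fun θ : ℝ => (symbol κ (x + θ * I))⁻¹ := by
  refine Continuous.inv₀ ?_ h0
  exact (differentiableOn_symbol hM hκ).continuousOn.comp_continuous (by fun_prop)
    fun θ => by simpa using hx

theorem exists_norm_green_le (hM : 0 < M)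
    (hκ : ∀ l : ℤ, ‖κ l‖ ≤ L * Real.exp (-M * |(l : ℝ)|)) {x : ℝ} (hx : |x| < M / 2)
    (h0 : ∀ θ : ℝ, symbol κ (x + θ * I) ≠ 0) :
    ∃ C : ℝ, 0 ≤ C ∧ ∀ j : ℤ, ‖green κ x j‖ ≤ C * Real.exp (j * x) := by
  obtain ⟨C, hC⟩ := (isCompact_uIcc (a := (0 : ℝ)) (b := 2 * Real.pi)).exists_bound_of_continuousOn
    (continuous_inv_symbol hM hκ hx h0).continuousOn
  have hC0 : 0 ≤ C := (norm_nonneg _).trans (hC 0 (by simp))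
  refine ⟨C, hC0, fun j => ?_⟩
  have h1 : ‖∫ θ in (0 : ℝ)..2 * Real.pi, cexp (j * (x + θ * I)) * (symbol κ (x + θ * I))⁻¹‖ ≤
      Real.exp (j * x) * C * |2 * Real.pi - 0| := by
    refine intervalIntegral.norm_integral_le_of_norm_le_const fun θ hθ => ?_
    rw [norm_mul, Complex.norm_exp]
    have : ((j : ℂ) * (x + θ * I)).re = j * x := by simp
    rw [this]
    exact mul_le_mul_of_nonneg_left (hC θ (Set.uIoc_subset_uIcc hθ)) (Real.exp_nonneg _)
  have hpi := Real.two_pi_pos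
  have h2 : ‖(2 * Real.pi : ℂ)⁻¹‖ = (2 * Real.pi)⁻¹ := by
    rw [norm_inv, ← Complex.ofReal_ofNat, ← Complex.ofReal_mul, Complex.norm_real,
      Real.norm_of_nonneg hpi.le]
  rw [green, norm_mul, h2]
  rw [sub_zero, abs_of_pos hpi] at h1
  refine (mul_le_mul_of_nonneg_left h1 (by positivity)).trans_eq ?_
  field_simp

/-- Cauchy's theorem: the line of integration may be moved within a zero-free strip. -/
theorem green_eq (hM : 0 < M) (hκ : ∀ l : ℤ, ‖κ l‖ ≤ L * Real.exp (-M * |(l : ℝ)|)) {x y : ℝ}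
    (hxy : ∀ t ∈ Set.uIcc x y, |t| < M / 2 ∧ ∀ θ : ℝ, symbol κ (t + θ * I) ≠ 0) (j : ℤ) :
    green κ x j = green κ y j := by
  set f : ℂ → ℂ := fun z => cexp (j * z) * (symbol κ z)⁻¹ with hf
  have hd : DifferentiableOn ℂ f (Set.uIcc x y ×ℂ Set.uIcc 0 (2 * Real.pi)) := by
    intro z hz
    obtain ⟨hz1, hz2⟩ := hxy z.re (Complex.mem_reProdIm.1 hz).1
    have h1 : DifferentiableAt ℂ (symbol κ) z :=
      (differentiableOn_symbol hM hκ).differentiableAt ((isOpen_strip _).mem_nhds hz1)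
    have h2 : symbol κ z ≠ 0 := by simpa using hz2 z.im
    exact (DifferentiableAt.mul (by fun_prop) (h1.inv h2)).differentiableWithinAt
  have h := integral_boundary_rect_eq_zero_of_differentiableOn f x
    (y + (2 * Real.pi : ℝ) * I) (by simpa using hd)
  have hper : ∀ t : ℝ, f (t + (2 * Real.pi : ℝ) * I) = f (t + (0 : ℝ) * I) := by
    intro t
    simp only [hf]
    have e1 : (t : ℂ) + (2 * Real.pi : ℝ) * I = t + (1 : ℤ) * (2 * Real.pi * I) := by
      push_cast; ring
    have e2 : cexp (j * (t + (2 * Real.pi : ℝ) * I)) = cexp (j * t) := by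
      have : (j : ℂ) * (t + (2 * Real.pi : ℝ) * I) = j * t + j * (2 * Real.pi * I) := by
        push_cast; ring
      rw [this, Complex.exp_add, Complex.exp_int_mul_two_pi_mul_I, mul_one]
    rw [e2, e1, symbol_add_period]
    simp
  have e1 : ((y : ℂ) + (2 * Real.pi : ℝ) * I).im = 2 * Real.pi := by simp
  have e2 : ((y : ℂ) + (2 * Real.pi : ℝ) * I).re = y := by simp
  rw [e1, e2, ofReal_im, ofReal_re] at h
  simp only [hper] at h
  rw [sub_self, zero_add, sub_eq_zero] at h
  have h' := smul_right_injective ℂ I_ne_zero h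
  unfold green
  exact congrArg _ h'.symm

theorem hasSum_green (hM : 0 < M) (hκ : ∀ l : ℤ, ‖κ l‖ ≤ L * Real.exp (-M * |(l : ℝ)|)) {x : ℝ}
    (hx : |x| < M / 2) (h0 : ∀ θ : ℝ, symbol κ (x + θ * I) ≠ 0) (n k : ℤ) :
    HasSum (fun m => green κ x (n - m) * κ (k - m)) (if k = n then 1 else 0) := by
  have hc := continuous_inv_symbol hM hκ hx h0
  have h1 := (hasSum_integral_symbol hM hκ hx.le
    (g := fun θ => cexp (-((k - n : ℤ) : ℂ) * (x + θ * I)) * (symbol κ (x + θ * I))⁻¹)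
    (by fun_prop)).mul_left (2 * Real.pi : ℂ)⁻¹
  have e1 : (2 * Real.pi : ℂ)⁻¹ * (∫ θ in (0 : ℝ)..2 * Real.pi, symbol κ (x + θ * I) *
      (cexp (-((k - n : ℤ) : ℂ) * (x + θ * I)) * (symbol κ (x + θ * I))⁻¹)) =
      if k = n then 1 else 0 := by
    have e : ∀ θ : ℝ, symbol κ (x + θ * I) *
        (cexp (-((k - n : ℤ) : ℂ) * (x + θ * I)) * (symbol κ (x + θ * I))⁻¹) =
        cexp (((n - k : ℤ) : ℂ) * x) * cexp (((n - k : ℤ) : ℂ) * (θ * I)) := by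
      intro θ
      rw [mul_left_comm, mul_inv_cancel₀ (h0 θ), mul_one, ← Complex.exp_add]
      congr 1
      push_cast
      ring
    simp only [e, intervalIntegral.integral_const_mul, integral_exp_int_mul]
    have hpi : (2 * Real.pi : ℂ) ≠ 0 := by simp [Real.pi_ne_zero]
    split_ifs with h2 h3 h3
    · rw [h2]; field_simp; simp
    · omega
    · omega
    · simp
  rw [e1] at h1
  have h2 := (Equiv.subLeft k).hasSum_iff.2 h1
  refine h2.congr_fun fun m => ?_
  simp only [Function.comp, Equiv.subLeft_apply, green]
  rw [mul_comm _ (κ (k - m)), mul_left_comm]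
  congr 2
  refine intervalIntegral.integral_congr fun θ _ => ?_
  rw [← mul_assoc, ← Complex.exp_add]
  congr 2
  push_cast
  ring

/-- Convolution with a non-zero exponentially decaying kernel has a left inverse that preserves
exponential decay. Its matrix comes from division by the symbol. Zeros of the symbol on the imaginary
axis are avoided by moving the line of integration: to the left for the sites `n ≥ 0`, to the right
for the sites `n < 0`. -/
theorem exists_left_inverse (hM : 0 < M)
    (hκ : ∀ l : ℤ, ‖κ l‖ ≤ L * Real.exp (-M * |(l : ℝ)|)) (hne : κ ≠ 0) :
    ∃ H : ℤ → ℤ → ℂ, (∃ r : ℝ, 0 < r ∧ ∀ ε, 0 < ε → ε < r → ∃ C : ℝ, 0 ≤ C ∧ ∀ n m : ℤ,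
      ‖H n m‖ ≤ C * Real.exp (ε * (|(m : ℝ)| - |(n : ℝ)|))) ∧
      ∀ n k : ℤ, HasSum (fun m => H n m * κ (k - m)) (if k = n then 1 else 0) := by
  obtain ⟨r, hr, hrM, h0⟩ := exists_zero_free_strip hM hκ hne
  have hz : ∀ t : ℝ, t ≠ 0 → |t| < r → |t| < M / 2 ∧ ∀ θ : ℝ, symbol κ (t + θ * I) ≠ 0 :=
    fun t ht htr => ⟨htr.trans hrM, fun θ => h0 _ (by simpa using ht) (by simpa using htr)⟩
  have hp := hz (r / 2) (by positivity) (by rw [abs_of_pos (by positivity)]; linarith)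
  have hm := hz (-(r / 2)) (by simpa using hr.ne') (by
    rw [abs_neg, abs_of_pos (by positivity)]; linarith)
  refine ⟨fun n m => if 0 ≤ n then green κ (-(r / 2)) (n - m) else green κ (r / 2) (n - m),
    ⟨r, hr, fun ε hε hεr => ?_⟩, fun n k => ?_⟩
  · have hp' := hz ε hε.ne' (by rwa [abs_of_pos hε])
    have hm' := hz (-ε) (by simpa using hε.ne') (by rwa [abs_neg, abs_of_pos hε])
    obtain ⟨C, hC0, hC⟩ := exists_norm_green_le hM hκ hp'.1 hp'.2
    obtain ⟨C', hC0', hC'⟩ := exists_norm_green_le hM hκ hm'.1 hm'.2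
    have ep : ∀ j, green κ (r / 2) j = green κ ε j := green_eq hM hκ fun t ht => by
      have : 0 < t := lt_of_lt_of_le (lt_min (by positivity) hε) ht.1
      exact hz t this.ne' (by
        rw [abs_of_pos this]; exact lt_of_le_of_lt ht.2 (max_lt (by linarith) hεr))
    have em : ∀ j, green κ (-(r / 2)) j = green κ (-ε) j := green_eq hM hκ fun t ht => by
      have : t < 0 := lt_of_le_of_lt ht.2 (max_lt (by linarith) (by linarith))
      exact hz t this.ne (by
        rw [abs_of_neg this]
        have := lt_of_lt_of_le (lt_min (show -r < -(r / 2) by linarith)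
          (show -r < -ε by linarith)) ht.1
        linarith)
    refine ⟨C + C', by positivity, fun n m => ?_⟩
    beta_reduce
    split_ifs with hn
    · rw [em]
      refine (hC' _).trans (mul_le_mul (by linarith) ?_ (Real.exp_nonneg _) (by positivity))
      have : |(n : ℝ)| = n := abs_of_nonneg (by exact_mod_cast hn)
      rw [this]
      push_cast
      refine Real.exp_le_exp.2 ?_
      linarith [mul_le_mul_of_nonneg_left (le_abs_self (m : ℝ)) hε.le]
    · rw [ep]
      refine (hC _).trans (mul_le_mul (by linarith) ?_ (Real.exp_nonneg _) (by positivity))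
      have : |(n : ℝ)| = -n := abs_of_neg (by exact_mod_cast not_le.1 hn)
      rw [this]
      push_cast
      refine Real.exp_le_exp.2 ?_
      linarith [mul_le_mul_of_nonneg_left (neg_abs_le (m : ℝ)) hε.le]
  · by_cases hn : 0 ≤ n
    · simpa only [hn, if_true] using hasSum_green hM hκ hm.1 hm.2 n k
    · simpa only [hn, if_false] using hasSum_green hM hκ hp.1 hp.2 n k

end LeftInverse

/-! ### The Koszul differential -/

section Koszul

variable {N : ℕ} {A : Letter N → Letter N → ℂ} {O O' : Functional N} {σ : Letter N → ℝ}

theorem Letter.chi_injective (s : Pol) : Function.Injective (Letter.chi (N := N) s) :=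
  fun _ _ h => by injection h

theorem Letter.phi_injective (s : Pol) : Function.Injective (Letter.phi (N := N) s) :=
  fun _ _ h => by injection h

theorem Letter.aux_injective (s : Pol) : Function.Injective (Letter.aux (N := N) s) :=
  fun _ _ h => by injection h

theorem Letter.chiBar_injective (s : Pol) : Function.Injective (Letter.chiBar (N := N) s) :=
  fun _ _ h => by injection h

/-- Sums over all variables of a function supported on a single species of lattice fields. -/
theorem tsum_species {f : ℤ → Letter N} (hf : Function.Injective f) {g : Letter N → ℂ}
    (h : ∀ a, a ∉ Set.range f → g a = 0) : ∑' a, g a = ∑' n, g (f n) :=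
  (hf.tsum_eq fun a ha => by_contra fun h' => ha (h a h')).symm

/-- Each row of the matrix vanishes, has a single entry, or is supported on one species of lattice
fields. -/
theorem admissible_of_rows (h : ∀ M : ℝ, 0 < M → ∃ C M' : ℝ, 0 ≤ C ∧ 0 < M' ∧ ∀ x,
    (∀ a, A a x = 0) ∨
    (∃ b, (∀ a, a ≠ b → A a x = 0) ∧
      ‖A b x‖ * Real.exp (-M * σ b) ≤ C * Real.exp (-M' * σ x)) ∨
    (∃ f : ℤ → Letter N, Function.Injective f ∧ (∀ a, a ∉ Set.range f → A a x = 0) ∧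
      Summable (fun n => ‖A (f n) x‖ * Real.exp (-M * σ (f n))) ∧
      ∑' n, ‖A (f n) x‖ * Real.exp (-M * σ (f n)) ≤ C * Real.exp (-M' * σ x))) :
    Admissible σ A := by
  intro M hM
  obtain ⟨C, M', hC, hM', hr⟩ := h M hM
  refine ⟨C, M', hM', fun x => ?_⟩
  rcases hr x with h0 | ⟨b, hb, hle⟩ | ⟨f, hf, h0, hs, hle⟩
  · simp only [h0, norm_zero, zero_mul, tsum_zero]
    exact ⟨summable_zero, by positivity⟩
  · have h1 : ∀ a, a ≠ b → ‖A a x‖ * Real.exp (-M * σ a) = 0 := fun a ha => by simp [hb a ha]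
    refine ⟨summable_of_ne_finset_zero (s := {b}) fun a ha => h1 a (by simpa using ha), ?_⟩
    rwa [tsum_eq_single b h1]
  · have h1 : Function.support (fun a => ‖A a x‖ * Real.exp (-M * σ a)) ⊆ Set.range f :=
      fun a ha => by_contra fun h' => ha (by simp [h0 a h'])
    rw [← hf.tsum_eq h1]
    exact ⟨(hf.summable_iff fun a ha => by_contra fun h' => ha (h1 h')).1 hs, hle⟩

/-- A function of the site as a size of variables; constant fields have size `0`. -/
def siteSize (g : ℤ → ℝ) (a : Letter N) : ℝ := a.site.elim 0 g

theorem siteSize_nonneg {g : ℤ → ℝ} (hg : ∀ n, 0 ≤ g n) (a : Letter N) : 0 ≤ siteSize g a := by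
  cases a <;> simp [siteSize, Letter.site, hg]

theorem summable_convolution_row {κ : ℤ → ℂ} {L M₀ : ℝ} (hM₀ : 0 < M₀)
    (hκ : ∀ l : ℤ, ‖κ l‖ ≤ L * Real.exp (-M₀ * |(l : ℝ)|)) {g : ℤ → ℝ} (hg : ∀ n, 0 ≤ g n)
    (hlip : ∀ m n : ℤ, g m ≤ g n + |(n : ℝ) - m|) {M : ℝ} (hM : 0 < M) :
    ∃ C M' : ℝ, 0 ≤ C ∧ 0 < M' ∧ ∀ m : ℤ,
      Summable (fun n => ‖κ (n - m)‖ * Real.exp (-M * g n)) ∧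
      ∑' n, ‖κ (n - m)‖ * Real.exp (-M * g n) ≤ C * Real.exp (-M' * g m) := by
  have hL : 0 ≤ L := by simpa using (norm_nonneg _).trans (hκ 0)
  set M' := min M (M₀ / 2) with hM'
  have hM'0 : 0 < M' := lt_min hM (half_pos hM₀)
  have hs := summable_exp_neg_mul_abs (half_pos hM₀)
  refine ⟨L * ∑' k : ℤ, Real.exp (-(M₀ / 2) * |(k : ℝ)|), M',
    mul_nonneg hL (tsum_nonneg fun _ => Real.exp_nonneg _), hM'0, fun m => ?_⟩
  have hs' := ((Equiv.subRight m).summable_iff.2 hs).mul_left (L * Real.exp (-M' * g m))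
  have hle : ∀ n : ℤ, ‖κ (n - m)‖ * Real.exp (-M * g n) ≤ L * Real.exp (-M' * g m) *
      ((fun k : ℤ => Real.exp (-(M₀ / 2) * |(k : ℝ)|)) ∘ Equiv.subRight m) n := by
    intro n
    refine (mul_le_mul_of_nonneg_right (hκ _) (Real.exp_nonneg _)).trans ?_
    simp only [Function.comp, Equiv.subRight_apply]
    rw [mul_assoc, mul_assoc, ← Real.exp_add, ← Real.exp_add]
    refine mul_le_mul_of_nonneg_left (Real.exp_le_exp.2 ?_) hL
    push_cast
    have h1 := mul_le_mul_of_nonneg_left (hlip m n) hM'0.le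
    have h2 := mul_le_mul_of_nonneg_right (min_le_left M (M₀ / 2)) (hg n)
    have h3 := mul_le_mul_of_nonneg_right (min_le_right M (M₀ / 2)) (abs_nonneg ((n : ℝ) - m))
    linarith
  refine ⟨Summable.of_nonneg_of_le (fun _ => by positivity) hle hs', ?_⟩
  refine ((Summable.of_nonneg_of_le (fun _ => by positivity) hle hs').tsum_le_tsum hle hs').trans ?_
  rw [tsum_mul_left, Function.comp_def,
    (Equiv.subRight m).tsum_eq fun k : ℤ => Real.exp (-(M₀ / 2) * |(k : ℝ)|)]
  exact le_of_eq (by ring)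

theorem summable_left_inverse_row {H : ℤ → ℤ → ℂ} {r : ℝ} (hr : 0 < r)
    (hH : ∀ ε, 0 < ε → ε < r → ∃ C : ℝ, 0 ≤ C ∧ ∀ n m : ℤ,
      ‖H n m‖ ≤ C * Real.exp (ε * (|(m : ℝ)| - |(n : ℝ)|))) {M : ℝ} (hM : 0 < M) :
    ∃ C M' : ℝ, 0 ≤ C ∧ 0 < M' ∧ ∀ n : ℤ,
      Summable (fun m : ℤ => ‖H n m‖ * Real.exp (-M * |(m : ℝ)|)) ∧
      ∑' m : ℤ, ‖H n m‖ * Real.exp (-M * |(m : ℝ)|) ≤ C * Real.exp (-M' * |(n : ℝ)|) := by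
  have hmin : 0 < min M r := lt_min hM hr
  set ε := min M r / 2 with hε
  have hε0 : 0 < ε := half_pos hmin
  have hεr : ε < r := (half_lt_self hmin).trans_le (min_le_right _ _)
  have hεM : ε ≤ M / 2 := by
    have := min_le_left M r
    linarith
  obtain ⟨C, hC0, hC⟩ := hH ε hε0 hεr
  have hs := summable_exp_neg_mul_abs (half_pos hM)
  refine ⟨C * ∑' k : ℤ, Real.exp (-(M / 2) * |(k : ℝ)|), ε,
    mul_nonneg hC0 (tsum_nonneg fun _ => Real.exp_nonneg _), hε0, fun n => ?_⟩
  have hle : ∀ m : ℤ, ‖H n m‖ * Real.exp (-M * |(m : ℝ)|) ≤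
      C * Real.exp (-ε * |(n : ℝ)|) * Real.exp (-(M / 2) * |(m : ℝ)|) := by
    intro m
    refine (mul_le_mul_of_nonneg_right (hC n m) (Real.exp_nonneg _)).trans ?_
    rw [mul_assoc, mul_assoc, ← Real.exp_add, ← Real.exp_add]
    refine mul_le_mul_of_nonneg_left (Real.exp_le_exp.2 ?_) hC0
    have := mul_le_mul_of_nonneg_right hεM (abs_nonneg (m : ℝ))
    linarith
  have hs' := Summable.of_nonneg_of_le (fun _ => by positivity) hle (hs.mul_left _)
  refine ⟨hs', (hs'.tsum_le_tsum hle (hs.mul_left _)).trans ?_⟩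
  rw [tsum_mul_left]
  exact le_of_eq (by ring)

open Classical in
/-- The Koszul differential `χ_n ↦ c₁ ∑_m κ(n - m) φ_m`, `F_n ↦ c₂ ∑_m κ(n - m) χ̄_m` on the
fields of type `s`. -/
noncomputable def koszul (κ : ℤ → ℂ) (c₁ c₂ : ℂ) (s : Pol) : Letter N → Letter N → ℂ
  | .chi t n, .phi t' m => if t = s ∧ t' = s then c₁ * κ (n - m) else 0
  | .aux t n, .chiBar t' m => if t = s ∧ t' = s then c₂ * κ (n - m) else 0
  | _, _ => 0

open Classical in
/-- The contraction `φ_m ↦ c₁⁻¹ ∑_n H(n, m) χ_n`, `χ̄_m ↦ c₂⁻¹ ∑_n H(n, m) F_n` on the fields of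
type `s`. -/
noncomputable def contraction (H : ℤ → ℤ → ℂ) (c₁ c₂ : ℂ) (s : Pol) : Letter N → Letter N → ℂ
  | .phi t m, .chi t' n => if t = s ∧ t' = s then c₁⁻¹ * H n m else 0
  | .chiBar t m, .aux t' n => if t = s ∧ t' = s then c₂⁻¹ * H n m else 0
  | _, _ => 0

open Classical in
/-- The Koszul degree: the number of variables `χ_s` and `F_s`. -/
noncomputable def koszulDegree (s : Pol) : Letter N → ℤ
  | .chi t _ => if t = s then 1 else 0
  | .aux t _ => if t = s then 1 else 0
  | _ => 0

variable {κ : ℤ → ℂ} {H : ℤ → ℤ → ℂ} {c₁ c₂ : ℂ} {s : Pol}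

theorem oddMatrix_koszul : OddMatrix (koszul (N := N) κ c₁ c₂ s) := by
  intro a b h
  cases a <;> cases b <;> simp_all [koszul, Letter.parity, Letter.fermionNumber]

theorem oddMatrix_contraction : OddMatrix (contraction (N := N) H c₁ c₂ s) := by
  intro a b h
  cases a <;> cases b <;> simp_all [contraction, Letter.parity, Letter.fermionNumber]

theorem koszulDegree_koszul (a x : Letter N) (h : koszul κ c₁ c₂ s a x ≠ 0) :
    koszulDegree s a = koszulDegree s x + 1 := by
  cases a <;> cases x <;> simp_all [koszul, koszulDegree]

theorem koszulDegree_contraction (a x : Letter N) (h : contraction H c₁ c₂ s a x ≠ 0) :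
    koszulDegree s a = koszulDegree s x + -1 := by
  cases a <;> cases x <;> simp_all [contraction, koszulDegree]

theorem admissible_koszul {L M₀ : ℝ} (hM₀ : 0 < M₀)
    (hκ : ∀ l : ℤ, ‖κ l‖ ≤ L * Real.exp (-M₀ * |(l : ℝ)|)) {g : ℤ → ℝ} (hg : ∀ n, 0 ≤ g n)
    (hlip : ∀ m n : ℤ, g m ≤ g n + |(n : ℝ) - m|) :
    Admissible (siteSize g) (koszul (N := N) κ c₁ c₂ s) := by
  refine admissible_of_rows fun M hM => ?_
  obtain ⟨C, M', hC0, hM', hC⟩ := summable_convolution_row hM₀ hκ hg hlip hM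
  refine ⟨(‖c₁‖ + ‖c₂‖) * C, M', by positivity, hM', fun x => ?_⟩
  have key : ∀ (c : ℂ) (m : ℤ), ‖c‖ ≤ ‖c₁‖ + ‖c₂‖ →
      Summable (fun n => ‖c * κ (n - m)‖ * Real.exp (-M * g n)) ∧
      ∑' n, ‖c * κ (n - m)‖ * Real.exp (-M * g n) ≤
        (‖c₁‖ + ‖c₂‖) * C * Real.exp (-M' * g m) := by
    intro c m hc
    simp only [norm_mul, mul_assoc]
    refine ⟨(hC m).1.mul_left _, ?_⟩
    rw [tsum_mul_left]
    exact mul_le_mul hc (hC m).2 (tsum_nonneg fun _ => by positivity) (by positivity)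
  cases x with
  | phi t m =>
    by_cases ht : t = s
    · subst ht
      refine Or.inr (Or.inr ⟨Letter.chi t, Letter.chi_injective t, fun a ha => ?_, ?_⟩)
      · cases a <;> simp_all [koszul]
        exact fun h => absurd h.symm ha
      · simpa [koszul, siteSize, Letter.site] using key c₁ m (by simp)
    · exact Or.inl fun a => by cases a <;> simp [koszul, ht]
  | chiBar t m =>
    by_cases ht : t = s
    · subst ht
      refine Or.inr (Or.inr ⟨Letter.aux t, Letter.aux_injective t, fun a ha => ?_, ?_⟩)
      · cases a <;> simp_all [koszul]
        exact fun h => absurd h.symm ha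
      · simpa [koszul, siteSize, Letter.site] using key c₂ m (by simp)
    · exact Or.inl fun a => by cases a <;> simp [koszul, ht]
  | _ => exact Or.inl fun a => by cases a <;> simp [koszul]

theorem admissible_contraction {r : ℝ} (hr : 0 < r)
    (hH : ∀ ε, 0 < ε → ε < r → ∃ C : ℝ, 0 ≤ C ∧ ∀ n m : ℤ,
      ‖H n m‖ ≤ C * Real.exp (ε * (|(m : ℝ)| - |(n : ℝ)|))) :
    Admissible (siteSize fun n => |(n : ℝ)|) (contraction (N := N) H c₁ c₂ s) := by
  refine admissible_of_rows fun M hM => ?_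
  obtain ⟨C, M', hC0, hM', hC⟩ := summable_left_inverse_row hr hH hM
  refine ⟨(‖c₁⁻¹‖ + ‖c₂⁻¹‖) * C, M', by positivity, hM', fun x => ?_⟩
  have key : ∀ (c : ℂ) (n : ℤ), ‖c‖ ≤ ‖c₁⁻¹‖ + ‖c₂⁻¹‖ →
      Summable (fun m : ℤ => ‖c * H n m‖ * Real.exp (-M * |(m : ℝ)|)) ∧
      ∑' m : ℤ, ‖c * H n m‖ * Real.exp (-M * |(m : ℝ)|) ≤
        (‖c₁⁻¹‖ + ‖c₂⁻¹‖) * C * Real.exp (-M' * |(n : ℝ)|) := by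
    intro c m hc
    simp only [norm_mul c, mul_assoc]
    refine ⟨(hC m).1.mul_left _, ?_⟩
    rw [tsum_mul_left]
    exact mul_le_mul hc (hC m).2 (tsum_nonneg fun _ => by positivity) (by positivity)
  cases x with
  | chi t m =>
    by_cases ht : t = s
    · subst ht
      refine Or.inr (Or.inr ⟨Letter.phi t, Letter.phi_injective t, fun a ha => ?_, ?_⟩)
      · cases a <;> simp_all [contraction]
        exact fun h => absurd h.symm ha
      · simpa [contraction, siteSize, Letter.site] using
          key c₁⁻¹ m (le_add_of_nonneg_right (norm_nonneg _))
    · exact Or.inl fun a => by cases a <;> simp [contraction, ht]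
  | aux t m =>
    by_cases ht : t = s
    · subst ht
      refine Or.inr (Or.inr ⟨Letter.chiBar t, Letter.chiBar_injective t, fun a ha => ?_, ?_⟩)
      · cases a <;> simp_all [contraction]
        exact fun h => absurd h.symm ha
      · simpa [contraction, siteSize, Letter.site] using
          key c₂⁻¹ m (le_add_of_nonneg_left (norm_nonneg _))
    · exact Or.inl fun a => by cases a <;> simp [contraction, ht]
  | _ => exact Or.inl fun a => by cases a <;> simp [contraction]

theorem rowComp_koszul_koszul (b x : Letter N) :
    rowComp (koszul κ c₁ c₂ s) (koszul κ c₁ c₂ s) b x = 0 := by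
  refine (tsum_congr fun a => ?_).trans tsum_zero
  cases a <;> cases x <;> cases b <;> simp [koszul]

theorem leibniz_koszul_koszul (hσ : ∀ a, 0 ≤ σ a) (hA : Admissible σ (koszul κ c₁ c₂ s))
    (hO : Decays σ O) :
    leibniz Letter.parity (koszul κ c₁ c₂ s)
      (leibniz Letter.parity (koszul κ c₁ c₂ s) O) = 0 := by
  funext w
  have := leibniz_anticomm hσ hA hA oddMatrix_koszul oddMatrix_koszul (G := fun _ _ => 0)
    (by simp [rowComp_koszul_koszul]) hO w
  rw [leibniz_zero_matrix, ← two_mul] at this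
  simpa using this

open Classical in
/-- On the variables `χ_s`, `F_s` the contraction is a left inverse of the differential. -/
theorem rowComp_contraction_koszul (hc₁ : c₁ ≠ 0) (hc₂ : c₂ ≠ 0)
    (hH : ∀ n k : ℤ, HasSum (fun m => H n m * κ (k - m)) (if k = n then 1 else 0))
    (b x : Letter N) :
    rowComp (contraction H c₁ c₂ s) (koszul κ c₁ c₂ s) b x =
      if b = x then (koszulDegree s x : ℂ) else 0 := by
  have key : ∀ (c : ℂ) (n k : ℤ), c ≠ 0 →
      ∑' m, c⁻¹ * H n m * (c * κ (k - m)) = if k = n then 1 else 0 := by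
    intro c n k hc
    rw [← (hH n k).tsum_eq]
    exact tsum_congr fun m => by field_simp
  have zero : (∀ a, contraction H c₁ c₂ s a x = 0) → (koszulDegree s x : ℂ) = 0 →
      rowComp (contraction H c₁ c₂ s) (koszul κ c₁ c₂ s) b x =
        if b = x then (koszulDegree s x : ℂ) else 0 := by
    intro h h'
    simp [rowComp, h, h']
  cases x with
  | chi t n =>
    by_cases ht : t = s
    · subst ht
      rw [rowComp, tsum_species (Letter.phi_injective t) (by
        intro a ha
        cases a <;> simp_all [contraction]
        exact fun h => absurd h.symm ha)]
      cases b with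
      | chi t' k =>
        by_cases ht' : t' = t
        · subst ht'
          simpa [contraction, koszul, koszulDegree] using key c₁ n k hc₁
        · simp [koszul, ht']
      | _ => simp [koszul]
    · exact zero (fun a => by cases a <;> simp [contraction, ht]) (by simp [koszulDegree, ht])
  | aux t n =>
    by_cases ht : t = s
    · subst ht
      rw [rowComp, tsum_species (Letter.chiBar_injective t) (by
        intro a ha
        cases a <;> simp_all [contraction]
        exact fun h => absurd h.symm ha)]
      cases b with
      | aux t' k =>
        by_cases ht' : t' = t
        · subst ht'
          simpa [contraction, koszul, koszulDegree] using key c₂ n k hc₂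
        · simp [koszul, ht']
      | _ => simp [koszul]
    · exact zero (fun a => by cases a <;> simp [contraction, ht]) (by simp [koszulDegree, ht])
  | _ => exact zero (fun a => by cases a <;> simp [contraction]) (by simp [koszulDegree])

theorem headMap_headMap {B : Letter N → Letter N → ℂ} (hA : Admissible σ A) (hB : Admissible σ B)
    (hO : Decays σ O) : headMap A (headMap B O) = headMap (rowComp A B) O := by
  funext w
  cases w with
  | nil => rfl
  | cons x w => exact (tsum_comp hA hB hO x w).2

/-- The matrix `∇ ∘ H` is idempotent, since `H ∘ ∇ = 1`. -/
theorem headMap_idempotent (hσ : ∀ a, 0 ≤ σ a) (hc₁ : c₁ ≠ 0) (hc₂ : c₂ ≠ 0)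
    (hH : ∀ n k : ℤ, HasSum (fun m => H n m * κ (k - m)) (if k = n then 1 else 0))
    (hq : Admissible σ (koszul κ c₁ c₂ s)) (hη : Admissible σ (contraction H c₁ c₂ s))
    (hO : Decays σ O) :
    headMap (rowComp (koszul κ c₁ c₂ s) (contraction H c₁ c₂ s))
        (headMap (rowComp (koszul κ c₁ c₂ s) (contraction H c₁ c₂ s)) O) =
      headMap (rowComp (koszul κ c₁ c₂ s) (contraction H c₁ c₂ s)) O := by
  classical
  have hd := hO.headMap hσ hη
  have hd' := hd.headMap hσ hq
  rw [← headMap_headMap hq hη hO, ← headMap_headMap hq hη hd', headMap_headMap hη hq hd]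
  congr 1
  funext w
  cases w with
  | nil => rfl
  | cons x w =>
    rw [headMap]
    simp only [rowComp_contraction_koszul hc₁ hc₂ hH, ite_mul, zero_mul, tsum_ite_eq]
    by_cases h : ∀ a, contraction H c₁ c₂ s a x = 0
    · simp [headMap, h]
    · push Not at h
      obtain ⟨a, ha⟩ := h
      have : koszulDegree s x = 1 := by
        cases a <;> cases x <;> simp_all [contraction, koszulDegree]
      rw [this]; simp

theorem koszulDegree_rowComp (a x : Letter N)
    (h : rowComp (koszul κ c₁ c₂ s) (contraction H c₁ c₂ s) a x ≠ 0) :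
    koszulDegree s a = koszulDegree s x + 0 := by
  by_contra hne
  refine h ((tsum_congr fun b => ?_).trans tsum_zero)
  by_contra hb
  have h1 := koszulDegree_koszul b x (left_ne_zero_of_mul hb)
  have h2 := koszulDegree_contraction a b (right_ne_zero_of_mul hb)
  omega

/-- The anticommutator of differential and contraction on functionals of Koszul degree `h`. -/
theorem koszul_homotopy (hσ : ∀ a, 0 ≤ σ a) (hc₁ : c₁ ≠ 0) (hc₂ : c₂ ≠ 0)
    (hH : ∀ n k : ℤ, HasSum (fun m => H n m * κ (k - m)) (if k = n then 1 else 0))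
    (hq : Admissible σ (koszul κ c₁ c₂ s)) (hη : Admissible σ (contraction H c₁ c₂ s))
    (hO : Decays σ O) (w : List (Letter N)) :
    leibniz Letter.parity (koszul κ c₁ c₂ s)
        (leibniz Letter.parity (contraction H c₁ c₂ s) O) w +
      leibniz Letter.parity (contraction H c₁ c₂ s)
        (leibniz Letter.parity (koszul κ c₁ c₂ s) O) w =
      leibniz (fun _ => 0) (rowComp (koszul κ c₁ c₂ s) (contraction H c₁ c₂ s)) O w +
        ((w.map (koszulDegree s)).sum : ℂ) * O w := by
  classical
  rw [leibniz_anticomm hσ hq hη oddMatrix_koszul oddMatrix_contraction (fun _ _ => rfl) hO,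
    leibniz_add_matrix (hq.comp hη) (hη.comp hq) hO]
  congr 1
  have : rowComp (contraction H c₁ c₂ s) (koszul κ c₁ c₂ s) =
      fun b x : Letter N => if b = x then (koszulDegree s x : ℂ) else 0 := by
    funext b x
    exact rowComp_contraction_koszul hc₁ hc₂ hH b x
  rw [this, leibniz_diagonal]
  simp [Function.comp_def]

/-- Modulo exact functionals, the falling factorials of the idempotent derivation act on closed
functionals of Koszul degree `h` like those of the number `-h`. -/
theorem fallingPow_koszul (hσ : ∀ a, 0 ≤ σ a) (hc₁ : c₁ ≠ 0) (hc₂ : c₂ ≠ 0)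
    (hH : ∀ n k : ℤ, HasSum (fun m => H n m * κ (k - m)) (if k = n then 1 else 0))
    (hq : Admissible σ (koszul κ c₁ c₂ s)) (hη : Admissible σ (contraction H c₁ c₂ s))
    (hO : Decays σ O) (hsym : GradedSymmetric O)
    (hcl : leibniz Letter.parity (koszul κ c₁ c₂ s) O = 0) (h : ℕ)
    (hdeg : ∀ w, O w ≠ 0 → (w.map (koszulDegree s)).sum = h + 1) (i : ℕ) :
    (∀ w, fallingPow (leibniz (fun _ => 0)
        (rowComp (koszul κ c₁ c₂ s) (contraction H c₁ c₂ s))) i O w ≠ 0 →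
      (w.map (koszulDegree s)).sum = h + 1) ∧
    ∃ (c : ℂ) (E : Functional N), c ≠ 0 ∧ Decays σ E ∧ GradedSymmetric E ∧
      ∀ w, fallingPow (leibniz (fun _ => 0)
        (rowComp (koszul κ c₁ c₂ s) (contraction H c₁ c₂ s))) i O w =
        c * O w + leibniz Letter.parity (koszul κ c₁ c₂ s) E w := by
  induction i with
  | zero =>
    refine ⟨hdeg, 1, fun _ => 0, one_ne_zero, fun d => ⟨0, 1, one_pos, by simp⟩,
      fun _ _ _ _ => by simp, fun w => ?_⟩
    simp [leibniz_zero, fallingPow]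
  | succ i ih =>
    obtain ⟨hd, c, E, hc, hE, hEs, hF⟩ := ih
    set F := fallingPow (leibniz (fun _ => 0)
        (rowComp (koszul κ c₁ c₂ s) (contraction H c₁ c₂ s))) i O with hFdef
    have hF' : F = fun w => c * O w + leibniz Letter.parity (koszul κ c₁ c₂ s) E w := funext hF
    have hFd : Decays σ F := by
      rw [hF']; exact (hO.smul c).add hσ (hE.leibniz hσ hq)
    have hFs : GradedSymmetric F := by
      rw [hF']; exact (hsym.smul c).add (hEs.leibniz oddMatrix_koszul)
    have hFc : leibniz Letter.parity (koszul κ c₁ c₂ s) F = 0 := by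
      funext w
      rw [hF', leibniz_add hq (hO.smul c) (hE.leibniz hσ hq), leibniz_smul, hcl,
        leibniz_koszul_koszul hσ hq hE]
      simp
    have hhom := fun w => koszul_homotopy hσ hc₁ hc₂ hH hq hη hFd w
    have hη0 : ∀ w, leibniz Letter.parity (contraction H c₁ c₂ s)
        (leibniz Letter.parity (koszul κ c₁ c₂ s) F) w = 0 := by
      intro w
      rw [hFc]
      exact leibniz_zero w
    constructor
    · intro w hw
      by_contra hne
      refine hw ?_
      rw [fallingPow_succ, ← hFdef, by_contra fun h' => hne (hd w h'),
        leibniz_eq_zero_of_grading koszulDegree_rowComp fun v _ hv => by_contra fun h' =>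
          hne (by rw [← hd v h', hv, add_zero])]
      simp
    · refine ⟨-((h : ℂ) + 1 + i) * c, fun w => leibniz Letter.parity (contraction H c₁ c₂ s) F w -
        ((h : ℂ) + 1 + i) * E w, mul_ne_zero (neg_ne_zero.2 (by norm_cast; omega))
          hc, (hFd.leibniz hσ hη).sub hσ (hE.smul _),
        (hFs.leibniz oddMatrix_contraction).sub (hEs.smul _), fun w => ?_⟩
      have hw : ((w.map (koszulDegree s)).sum : ℂ) * F w = ((h : ℂ) + 1) * F w := by
        by_cases hz : F w = 0
        · simp [hz]
        · rw [hd w hz]; push_cast; ring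
      have h1 := hhom w
      rw [hη0, hw, add_zero] at h1
      rw [fallingPow_succ, ← hFdef, leibniz_sub hq (hFd.leibniz hσ hη) (hE.smul _), leibniz_smul,
        h1]
      linear_combination -((h : ℂ) + 1 + i) * hF w

theorem koszulDegree_le_length (w : List (Letter N)) :
    (w.map (koszulDegree s)).sum ≤ w.length := by
  induction w with
  | nil => simp
  | cons x w ih =>
    have : koszulDegree s x ≤ 1 := by
      cases x <;> simp only [koszulDegree] <;> (try split_ifs) <;> simp
    simp only [List.map_cons, List.sum_cons, List.length_cons]
    push_cast
    linarith

/-- The Koszul complex is exact in positive degree. The operator `H` is only a left inverse of `∇`,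
but the eigenvalues of the anticommutator of differential and contraction on words of length `d` and
positive Koszul degree are still positive integers. -/
theorem koszul_exact (hσ : ∀ a, 0 ≤ σ a) (hc₁ : c₁ ≠ 0) (hc₂ : c₂ ≠ 0)
    (hH : ∀ n k : ℤ, HasSum (fun m => H n m * κ (k - m)) (if k = n then 1 else 0))
    (hq : Admissible σ (koszul κ c₁ c₂ s)) (hη : Admissible σ (contraction H c₁ c₂ s))
    (hO : Decays σ O) (hsym : GradedSymmetric O)
    (hcl : leibniz Letter.parity (koszul κ c₁ c₂ s) O = 0)
    (hdeg : ∀ w, O w ≠ 0 → 1 ≤ (w.map (koszulDegree s)).sum) :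
    ∃ E : Functional N, Decays σ E ∧ GradedSymmetric E ∧
      (∀ w, E w ≠ 0 → 2 ≤ (w.map (koszulDegree s)).sum) ∧
      leibniz Letter.parity (koszul κ c₁ c₂ s) E = O := by
  have key : ∀ d h : ℕ, ∃ E : Functional N, Decays σ E ∧ GradedSymmetric E ∧
      ∀ w : List (Letter N), w.length = d →
        leibniz Letter.parity (koszul κ c₁ c₂ s) E w =
          component (koszulDegree s) ((h : ℤ) + 1) O w := by
    intro d h
    have hcl' : leibniz Letter.parity (koszul κ c₁ c₂ s)
        (component (koszulDegree s) ((h : ℤ) + 1) O) = 0 := by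
      rw [leibniz_component koszulDegree_koszul, hcl]
      funext w
      simp [component]
    -- The falling factorial of order `d + 1` vanishes on words of length `d`; modulo exact terms it
    -- is a non-zero multiple of the identity.
    obtain ⟨-, c, E, hc, hE, hEs, hF⟩ := fallingPow_koszul hσ hc₁ hc₂ hH hq hη
      (hO.component _ _) (hsym.component _ _) hcl' h (fun w hw => by
        by_contra h'
        exact hw (component_of_ne h')) (d + 1)
    refine ⟨fun w => -c⁻¹ * E w, hE.smul _, hEs.smul _, fun w hw => ?_⟩
    have h0 := hF w
    rw [fallingPow_eq_zero hσ (hq.comp hη)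
      (fun O hO => headMap_idempotent hσ hc₁ hc₂ hH hq hη hO) (hO.component _ _)
      (by omega)] at h0
    rw [leibniz_smul]
    field_simp
    linear_combination h0
  choose E hE hEs hEq using key
  have hsum : ∀ d : ℕ, Decays σ fun w =>
      ∑ h ∈ Finset.range d, component (koszulDegree s) ((h : ℤ) + 1 + 1) (E d h) w :=
    fun d => Decays.sum hσ _ fun h _ => (hE d h).component _ _
  refine ⟨fun w => ∑ h ∈ Finset.range w.length,
    component (koszulDegree s) ((h : ℤ) + 1 + 1) (E w.length h) w, fun d => ?_, ?_, ?_, ?_⟩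
  · obtain ⟨L, M, hM, hL⟩ := hsum d d
    exact ⟨L, M, hM, fun w hw => by beta_reduce; rw [hw]; exact hL w hw⟩
  · intro u v a b
    beta_reduce
    rw [show (u ++ b :: a :: v).length = (u ++ a :: b :: v).length by simp]
    exact GradedSymmetric.sum _ (fun h _ => (hEs _ h).component _ _) u v a b
  · intro w hw
    obtain ⟨h, -, hh⟩ := Finset.exists_ne_zero_of_sum_ne_zero hw
    have := by_contra fun h' => hh (component_of_ne h')
    omega
  · funext w
    rw [leibniz_congr_length (O' := fun v => ∑ h ∈ Finset.range w.length,
      component (koszulDegree s) ((h : ℤ) + 1 + 1) (E w.length h) v) w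
        fun v hv => by rw [hv],
      leibniz_sum hσ hq _ fun h _ => (hE _ h).component _ _]
    simp only [leibniz_component koszulDegree_koszul]
    have e : ∀ h : ℕ, component (koszulDegree s) ((h : ℤ) + 1)
        (leibniz Letter.parity (koszul κ c₁ c₂ s) (E w.length h)) w =
        component (koszulDegree s) ((h : ℤ) + 1) O w := by
      intro h
      by_cases hw : (w.map (koszulDegree s)).sum = (h : ℤ) + 1
      · rw [component_of_eq hw, hEq _ _ _ rfl]
      · rw [component_of_ne hw, component_of_ne hw]
    simp only [e]
    by_cases hw : O w = 0
    · simp [component, hw]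
    · have h1 := hdeg w hw
      have h2 := koszulDegree_le_length (s := s) w
      obtain ⟨h, hh⟩ : ∃ h : ℕ, (w.map (koszulDegree s)).sum = (h : ℤ) + 1 :=
        ⟨((w.map (koszulDegree s)).sum - 1).toNat, by omega⟩
      rw [Finset.sum_eq_single h, component_of_eq hh]
      · intro j _ hj
        exact component_of_ne (by omega)
      · intro hn
        rw [Finset.mem_range] at hn
        omega

end Koszul

/-! ### Koszul exactness for translation invariant functionals -/

section Translation

open Filter Topology

variable {N : ℕ} {O O' C d : Functional N} {σ : Letter N → ℝ}

/-- Translation by `t` lattice sites. -/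
def Letter.translate (t : ℤ) : Letter N ≃ Letter N where
  toFun
    | phi s n => phi s (n + t)
    | chi s n => chi s (n + t)
    | chiBar s n => chiBar s (n + t)
    | aux s n => aux s (n + t)
    | rho s i => rho s i
    | zeta s i => zeta s i
  invFun
    | phi s n => phi s (n - t)
    | chi s n => chi s (n - t)
    | chiBar s n => chiBar s (n - t)
    | aux s n => aux s (n - t)
    | rho s i => rho s i
    | zeta s i => zeta s i
  left_inv a := by cases a <;> simp
  right_inv a := by cases a <;> simp

theorem Letter.translate_one : ⇑(Letter.translate (N := N) 1) = Letter.shift := by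
  funext a; cases a <;> rfl

theorem Letter.parity_translate (t : ℤ) (a : Letter N) : (translate t a).parity = a.parity := by
  cases a <;> rfl

theorem Letter.translate_translate (t t' : ℤ) (a : Letter N) :
    translate t (translate t' a) = translate (t' + t) a := by
  cases a <;> simp [translate, add_assoc]

theorem map_translate_map_translate (t t' : ℤ) (w : List (Letter N)) :
    (w.map (Letter.translate t')).map (Letter.translate t) =
      w.map (Letter.translate (t' + t)) := by
  simp [Function.comp_def, Letter.translate_translate]

theorem map_translate_zero (w : List (Letter N)) : w.map (Letter.translate 0) = w := by
  have : ∀ a : Letter N, Letter.translate 0 a = a := fun a => by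
    cases a <;> simp [Letter.translate]
  rw [List.map_congr_left fun a _ => this a, List.map_id']

/-- The sites of the lattice fields in a word. -/
def sites (w : List (Letter N)) : List ℤ := w.filterMap Letter.site

theorem sites_map_translate (t : ℤ) (w : List (Letter N)) :
    sites (w.map (Letter.translate t)) = (sites w).map (· + t) := by
  unfold sites
  rw [List.filterMap_map, List.map_filterMap]
  congr 1
  funext a
  cases a <;> rfl

theorem mem_sites {w : List (Letter N)} {n : ℤ} : n ∈ sites w ↔ ∃ a ∈ w, a.site = some n := by
  simp [sites]

theorem sites_ne_nil_of_koszulDegree {s : Pol} {w : List (Letter N)}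
    (h : 2 ≤ (w.map (koszulDegree s)).sum) : sites w ≠ [] := by
  intro h0
  have h1 : ∀ a ∈ w, koszulDegree s a = 0 := by
    intro a ha
    have : ∀ n, a.site ≠ some n := fun n hn => by
      have := mem_sites.2 ⟨a, ha, hn⟩
      rw [h0] at this
      simp at this
    cases a <;> simp_all [Letter.site, koszulDegree]
  have : (w.map (koszulDegree s)).sum = 0 := by
    rw [List.map_congr_left h1]; simp
  omega

theorem IsLocalFunctional.apply_translate (h : IsLocalFunctional O) (t : ℤ)
    (w : List (Letter N)) : O (w.map (Letter.translate t)) = O w := by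
  have h1 : ∀ w, O (w.map (Letter.translate 1)) = O w := fun w => by
    rw [Letter.translate_one]; exact h.translation w
  induction t using Int.induction_on with
  | zero => rw [map_translate_zero]
  | succ n ih => rw [← ih, ← h1 (w.map (Letter.translate n)), map_translate_map_translate]
  | pred n ih =>
    rw [← ih, ← h1 (w.map (Letter.translate (-n - 1))), map_translate_map_translate,
      sub_add_cancel]

theorem sum_siteSize_zero (w : List (Letter N)) :
    (w.map (siteSize fun _ => (0 : ℝ))).sum = 0 := by
  have : siteSize (N := N) (fun _ => (0 : ℝ)) = fun _ => 0 := by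
    funext a
    cases a <;> rfl
  simp [this]

theorem siteSize_le_sum {g : ℤ → ℝ} (hg : ∀ n, 0 ≤ g n) {w : List (Letter N)} {n : ℤ}
    (hn : n ∈ sites w) : g n ≤ (w.map (siteSize g)).sum := by
  obtain ⟨a, ha, han⟩ := mem_sites.1 hn
  have : siteSize g a = g n := by simp [siteSize, han]
  rw [← this]
  refine List.single_le_sum ?_ _ (List.mem_map_of_mem ha)
  intro x hx
  obtain ⟨b, -, rfl⟩ := List.mem_map.1 hx
  exact siteSize_nonneg hg b

/-- A functional dominated by a local one, and supported on words where some site controls the size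
of all others, has the corresponding decay. -/
theorem IsLocalFunctional.decays (hC : IsLocalFunctional C) {g : ℤ → ℝ}
    (K : ℝ) (h : ∀ w, O w ≠ 0 → ‖O w‖ ≤ ‖C w‖ ∧
      ∃ m ∈ sites w, ∀ n ∈ sites w, g n ≤ |(m : ℝ) - n| + K) : Decays (siteSize g) O := by
  intro d
  obtain ⟨L, M, hM, hL⟩ := hC.locality d
  refine ⟨|L| * Real.exp (M * |K|), M / (d + 1), by positivity, fun w hw => ?_⟩
  by_cases h0 : O w = 0
  · simp only [h0, norm_zero]; positivity
  obtain ⟨hle, m, hm, hmn⟩ := h w h0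
  have hb : ∀ n ∈ sites w, ‖O w‖ ≤ |L| * Real.exp (M * |K|) * Real.exp (-M * g n) := by
    intro n hn
    refine (hle.trans (hL w hw m hm n hn)).trans ?_
    rw [mul_assoc, ← Real.exp_add]
    refine mul_le_mul (le_abs_self L) (Real.exp_le_exp.2 ?_) (Real.exp_nonneg _) (abs_nonneg _)
    have := mul_le_mul_of_nonneg_left ((hmn n hn).trans (add_le_add_right (le_abs_self K) _)) hM.le
    linarith
  set x := (w.map (siteSize g)).sum with hx
  have hd : (0 : ℝ) < d + 1 := by positivity
  rcases le_or_gt x 0 with hx0 | hx0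
  · have h1 : ‖O w‖ ≤ |L| * Real.exp (M * |K|) * 1 := by
      rw [mul_one]
      refine (hle.trans (hL w hw m hm m hm)).trans ?_
      simp only [sub_self, abs_zero, mul_zero, Real.exp_zero, mul_one]
      exact (le_abs_self L).trans (le_mul_of_one_le_right (abs_nonneg _)
        (Real.one_le_exp (by positivity)))
    refine h1.trans (mul_le_mul_of_nonneg_left (Real.one_le_exp ?_) (by positivity))
    rw [neg_mul, neg_nonneg]
    exact mul_nonpos_of_nonneg_of_nonpos (by positivity) hx0
  · obtain ⟨a, ha, hax⟩ : ∃ a ∈ w, x / (d + 1) < siteSize g a := by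
      by_contra! hcon
      have := List.sum_le_card_nsmul (w.map (siteSize g)) (x / (d + 1)) (by
        intro y hy
        obtain ⟨a, ha, rfl⟩ := List.mem_map.1 hy
        exact hcon a ha)
      rw [← hx, List.length_map, hw, nsmul_eq_mul, mul_div_assoc', le_div_iff₀ hd] at this
      linarith
    have hpos : 0 < siteSize g a := lt_trans (by positivity) hax
    obtain ⟨n, hn⟩ : ∃ n, a.site = some n := by
      cases ha' : a.site with
      | none => simp [siteSize, ha'] at hpos
      | some n => exact ⟨n, rfl⟩
    refine (hb n (mem_sites.2 ⟨a, ha, hn⟩)).trans ?_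
    refine mul_le_mul_of_nonneg_left (Real.exp_le_exp.2 ?_) (by positivity)
    have e : siteSize g a = g n := by simp [siteSize, hn]
    rw [e, div_lt_iff₀ hd] at hax
    rw [neg_mul, neg_mul, neg_le_neg_iff, div_mul_eq_mul_div, div_le_iff₀ hd, mul_assoc]
    exact mul_le_mul_of_nonneg_left hax.le hM.le

/-- Decay to the left and to the right. -/
theorem decays_abs (hl : Decays (siteSize fun n => max (-(n : ℝ)) 0) O)
    (hr : Decays (siteSize fun n => max (n : ℝ) 0) O) :
    Decays (siteSize fun n => |(n : ℝ)|) O := by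
  intro d
  obtain ⟨L, M, hL0, hM, hL⟩ := hl.exists_nonneg d
  obtain ⟨L', M', hL0', hM', hL'⟩ := hr.exists_nonneg d
  refine ⟨L + L', min M M' / 2, half_pos (lt_min hM hM'), fun w hw => ?_⟩
  have hsum : (w.map (siteSize fun n => |(n : ℝ)|)).sum =
      (w.map (siteSize fun n => max (-(n : ℝ)) 0)).sum +
      (w.map (siteSize fun n => max (n : ℝ) 0)).sum := by
    rw [← List.sum_map_add]
    congr 2
    funext a
    unfold siteSize
    cases a.site with
    | none => simp
    | some n =>
      simp only [Option.elim]
      rcases le_total (n : ℝ) 0 with h | h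
      · rw [abs_of_nonpos h, max_eq_left (by linarith), max_eq_right h, add_zero]
      · rw [abs_of_nonneg h, max_eq_right (by linarith), max_eq_left h, zero_add]
  have ha := hL w hw
  have hb := hL' w hw
  set a := (w.map (siteSize fun n => max (-(n : ℝ)) 0)).sum
  set b := (w.map (siteSize fun n => max (n : ℝ) 0)).sum
  have ha0 : 0 ≤ a := sum_size_nonneg (siteSize_nonneg fun n => le_max_right _ _) w
  have hb0 : 0 ≤ b := sum_size_nonneg (siteSize_nonneg fun n => le_max_right _ _) w
  rw [hsum]
  have h1 := min_le_left M M'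
  have h2 := min_le_right M M'
  have h3 : 0 ≤ min M M' := (lt_min hM hM').le
  rcases le_total a b with hab | hab
  · refine hb.trans (mul_le_mul (by linarith) (Real.exp_le_exp.2 ?_) (Real.exp_nonneg _)
      (by positivity))
    nlinarith [mul_le_mul_of_nonneg_right h2 hb0, mul_le_mul_of_nonneg_left hab h3]
  · refine ha.trans (mul_le_mul (by linarith) (Real.exp_le_exp.2 ?_) (Real.exp_nonneg _)
      (by positivity))
    nlinarith [mul_le_mul_of_nonneg_right h1 ha0, mul_le_mul_of_nonneg_left hab h3]

/-- The fraction of the sites of a word that are non-negative. It serves as a partition of unity into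
a right and a left half that, unlike the position of a chosen site, is symmetric in the variables. -/
noncomputable def rightFraction (w : List (Letter N)) : ℝ :=
  ((sites w).countP fun n => 0 ≤ n) / (sites w).length

theorem rightFraction_nonneg (w : List (Letter N)) : 0 ≤ rightFraction w := by
  unfold rightFraction; positivity

theorem rightFraction_le_one (w : List (Letter N)) : rightFraction w ≤ 1 :=
  div_le_one_of_le₀ (by exact_mod_cast List.countP_le_length) (by positivity)

theorem rightFraction_perm {u v : List (Letter N)} (h : u.Perm v) :
    rightFraction u = rightFraction v := by
  have := h.filterMap Letter.site
  unfold rightFraction sites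
  rw [this.length_eq, this.countP_eq]

theorem rightFraction_eq_zero {w : List (Letter N)} (h : ∀ n ∈ sites w, n < 0) :
    rightFraction w = 0 := by
  have : (sites w).countP (fun n => decide (0 ≤ n)) = 0 := by
    rw [List.countP_eq_zero]
    simpa using h
  rw [rightFraction, this]; simp

theorem rightFraction_eq_one {w : List (Letter N)} (h0 : sites w ≠ [])
    (h : ∀ n ∈ sites w, 0 ≤ n) : rightFraction w = 1 := by
  have : (sites w).countP (fun n => decide (0 ≤ n)) = (sites w).length := by
    rw [List.countP_eq_length]
    simpa using h
  rw [rightFraction, this]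
  exact div_self (by simpa using h0)

theorem rightFraction_translate_one {w : List (Letter N)} (h : -1 ∉ sites w) :
    rightFraction (w.map (Letter.translate 1)) = rightFraction w := by
  unfold rightFraction
  rw [sites_map_translate, List.countP_map, List.length_map]
  congr 2
  refine List.countP_congr fun n hn => ?_
  have : n ≠ -1 := fun h' => h (h' ▸ hn)
  simp only [Function.comp, decide_eq_true_eq]
  omega

/-- The translates of a functional that decays away from the origin are summable. -/
theorem Decays.translates (hd : Decays (siteSize fun n => |(n : ℝ)|) d)
    (hs : ∀ w, d w ≠ 0 → sites w ≠ []) :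
    FamilyDecays (siteSize fun _ => 0)
      (fun (t : ℤ) (w : List (Letter N)) => d (w.map (Letter.translate t))) := by
  intro l
  obtain ⟨L, M, hL0, hM, hL⟩ := hd.exists_nonneg l
  have hsum := summable_exp_neg_mul_abs hM
  refine ⟨L * ∑' k : ℤ, Real.exp (-M * |(k : ℝ)|), 1,
    mul_nonneg hL0 (tsum_nonneg fun _ => Real.exp_nonneg _), one_pos, fun w hw => ?_⟩
  rw [sum_siteSize_zero, mul_zero, Real.exp_zero, mul_one]
  by_cases h0 : sites w = []
  · have : ∀ t : ℤ, d (w.map (Letter.translate t)) = 0 := fun t => by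
      by_contra h
      exact hs _ h (by rw [sites_map_translate, h0]; rfl)
    simp only [this, norm_zero, tsum_zero]
    exact ⟨summable_zero, mul_nonneg hL0 (tsum_nonneg fun _ => Real.exp_nonneg _)⟩
  · obtain ⟨m, hm⟩ := List.exists_mem_of_ne_nil _ h0
    have hle : ∀ t : ℤ, ‖d (w.map (Letter.translate t))‖ ≤
        L * ((fun k : ℤ => Real.exp (-M * |(k : ℝ)|)) ∘ Equiv.addLeft m) t := by
      intro t
      refine (hL _ (by simpa using hw)).trans
        (mul_le_mul_of_nonneg_left (Real.exp_le_exp.2 ?_) hL0)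
      have h1 : m + t ∈ sites (w.map (Letter.translate t)) := by
        rw [sites_map_translate]; exact List.mem_map_of_mem hm
      have := siteSize_le_sum (g := fun n => |(n : ℝ)|) (fun n => abs_nonneg _) h1
      rw [neg_mul, neg_mul, neg_le_neg_iff]
      exact mul_le_mul_of_nonneg_left this hM.le
    have hs' := ((Equiv.addLeft m).summable_iff.2 hsum).mul_left L
    have hs'' := Summable.of_nonneg_of_le (fun _ => norm_nonneg _) hle hs'
    refine ⟨hs'', (hs''.tsum_le_tsum hle hs').trans_eq ?_⟩
    rw [tsum_mul_left, Function.comp_def,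
      (Equiv.addLeft m).tsum_eq fun k : ℤ => Real.exp (-M * |(k : ℝ)|)]

theorem isLocalFunctional_tsum_translate (hd : Decays (siteSize fun n => |(n : ℝ)|) d)
    (hsym : GradedSymmetric d) :
    IsLocalFunctional fun w => ∑' t : ℤ, d (w.map (Letter.translate t)) where
  symm := by
    refine GradedSymmetric.tsum (F := fun (t : ℤ) w => d (w.map (Letter.translate t)))
      fun t u v a b => ?_
    have := hsym (u.map (Letter.translate t)) (v.map (Letter.translate t))
      (Letter.translate t a) (Letter.translate t b)
    simpa [Letter.parity_translate] using this
  translation w := by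
    rw [← Letter.translate_one]
    simp only [map_translate_map_translate]
    exact (Equiv.addLeft (1 : ℤ)).tsum_eq fun t => d (w.map (Letter.translate t))
  locality l := by
    obtain ⟨L, M, hL0, hM, hL⟩ := hd.exists_nonneg l
    have hsum := summable_exp_neg_mul_abs (half_pos hM)
    refine ⟨L * ∑' k : ℤ, Real.exp (-(M / 2) * |(k : ℝ)|), M / 4, by positivity,
      fun w hw m hm n hn => ?_⟩
    have hle : ∀ t : ℤ, ‖d (w.map (Letter.translate t))‖ ≤
        L * Real.exp (-(M / 4) * |(m : ℝ) - n|) *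
          ((fun k : ℤ => Real.exp (-(M / 2) * |(k : ℝ)|)) ∘ Equiv.addLeft m) t := by
      intro t
      refine (hL _ (by simpa using hw)).trans ?_
      rw [mul_assoc]
      refine mul_le_mul_of_nonneg_left ?_ hL0
      simp only [Function.comp, Equiv.coe_addLeft]
      rw [← Real.exp_add]
      refine Real.exp_le_exp.2 ?_
      have hmem : ∀ k ∈ sites w, k + t ∈ sites (w.map (Letter.translate t)) := fun k hk => by
        rw [sites_map_translate]; exact List.mem_map_of_mem hk
      have h1 := siteSize_le_sum (g := fun n => |(n : ℝ)|) (fun n => abs_nonneg _) (hmem m hm)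
      have h2 := siteSize_le_sum (g := fun n => |(n : ℝ)|) (fun n => abs_nonneg _) (hmem n hn)
      set x := ((w.map (Letter.translate t)).map (siteSize fun n => |(n : ℝ)|)).sum
      have h3 : |(m : ℝ) - n| ≤ |((m + t : ℤ) : ℝ)| + |((n + t : ℤ) : ℝ)| := by
        have := abs_sub ((m + t : ℤ) : ℝ) ((n + t : ℤ) : ℝ)
        push_cast at this ⊢
        rwa [add_sub_add_right_eq_sub] at this
      have h4 := mul_le_mul_of_nonneg_left h1 hM.le
      have h5 := mul_le_mul_of_nonneg_left (h3.trans (add_le_add h1 h2)) hM.le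
      linarith
    have hs' := ((Equiv.addLeft m).summable_iff.2 hsum).mul_left
      (L * Real.exp (-(M / 4) * |(m : ℝ) - n|))
    refine (tsum_of_norm_bounded hs'.hasSum hle).trans_eq ?_
    rw [tsum_mul_left, Function.comp_def,
      (Equiv.addLeft m).tsum_eq fun k : ℤ => Real.exp (-(M / 2) * |(k : ℝ)|)]
    ring

theorem tendsto_of_telescoping {G : ℤ → ℂ} (h : Summable fun t => G (t + 1) - G t) {a : ℂ}
    (hp : Tendsto (fun n : ℕ => G n) atTop (𝓝 a))
    (hm : Tendsto (fun n : ℕ => G (-n)) atTop (𝓝 0)) :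
    ∑' t, (G (t + 1) - G t) = a := by
  have h1 : HasSum (fun n : ℕ => G (n + 1) - G n) (a - G 0) := by
    have hs := h.comp_injective (i := fun n : ℕ => (n : ℤ)) Nat.cast_injective
    refine (hs.hasSum_iff_tendsto_nat).2 ?_
    have : ∀ n : ℕ, ∑ i ∈ Finset.range n, (G ((i : ℤ) + 1) - G i) = G n - G 0 := fun n => by
      have := Finset.sum_range_sub (fun i : ℕ => G i) n
      push_cast at this
      exact this
    simp only [Function.comp, this]
    exact hp.sub_const _
  have h2 : HasSum (fun n : ℕ => G (-(n + 1 : ℤ) + 1) - G (-(n + 1 : ℤ))) (G 0 - 0) := by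
    have hs := h.comp_injective (i := fun n : ℕ => -((n : ℤ) + 1)) fun a b hab => by
      simpa using hab
    refine (hs.hasSum_iff_tendsto_nat).2 ?_
    have : ∀ n : ℕ, ∑ i ∈ Finset.range n, (G (-((i : ℤ) + 1) + 1) - G (-((i : ℤ) + 1))) =
        G 0 - G (-n) := fun n => by
      have := Finset.sum_range_sub' (fun i : ℕ => G (-(i : ℤ))) n
      push_cast at this
      simpa using this
    simp only [Function.comp, this]
    exact hm.const_sub _
  have := HasSum.of_nat_of_neg_add_one (f := fun t => G (t + 1) - G t) h1 h2
  rw [this.tsum_eq]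
  ring

variable {κ : ℤ → ℂ} {c₁ c₂ : ℂ} {s : Pol}

theorem koszul_translate (t : ℤ) (a b : Letter N) :
    koszul κ c₁ c₂ s (Letter.translate t a) (Letter.translate t b) = koszul κ c₁ c₂ s a b := by
  cases a <;> cases b <;> simp [Letter.translate, koszul]

theorem koszulDegree_translate (t : ℤ) (w : List (Letter N)) :
    ((w.map (Letter.translate t)).map (koszulDegree s)).sum = (w.map (koszulDegree s)).sum := by
  rw [List.map_map]
  congr 2
  funext a
  cases a <;> rfl

/-- The Koszul complex of local functionals is exact in degrees at least two. Translation invariance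
relates it to the complex of functionals decaying away from the origin, with a loss of one degree:
a closed local functional is cut at the origin into a left and a right half; the differential of a
half decays on both sides, hence is exact. After correction by a primitive, the right half is closed,
and its difference with its translate is exact with a primitive whose translates can be summed. -/
theorem exists_local_koszul_primitive {L M : ℝ} (hM : 0 < M)
    (hκ : ∀ l : ℤ, ‖κ l‖ ≤ L * Real.exp (-M * |(l : ℝ)|)) (hne : κ ≠ 0) (hc₁ : c₁ ≠ 0)
    (hc₂ : c₂ ≠ 0) (hC : IsLocalFunctional C)
    (hdeg : ∀ w, C w ≠ 0 → 2 ≤ (w.map (koszulDegree s)).sum)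
    (hcl : leibniz Letter.parity (koszul κ c₁ c₂ s) C = 0) :
    ∃ R : Functional N, IsLocalFunctional R ∧
      leibniz Letter.parity (koszul κ c₁ c₂ s) R = C := by
  obtain ⟨H, ⟨r, hr, hHb⟩, hH⟩ := exists_left_inverse hM hκ hne
  have hη := admissible_contraction (N := N) (c₁ := c₁) (c₂ := c₂) (s := s) hr hHb
  have habs : ∀ n : ℤ, (0 : ℝ) ≤ |(n : ℝ)| := fun n => abs_nonneg _
  have hσ := siteSize_nonneg (N := N) habs
  have hσ0 := siteSize_nonneg (N := N) (g := fun _ => 0) fun _ => le_rfl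
  have hq := admissible_koszul (N := N) (c₁ := c₁) (c₂ := c₂) (s := s) hM hκ habs fun m n => by
    have := abs_add_le (n : ℝ) (m - n)
    rw [add_sub_cancel, abs_sub_comm] at this
    exact this
  have hq0 := admissible_koszul (N := N) (c₁ := c₁) (c₂ := c₂) (s := s) hM hκ
    (g := fun _ => 0) (fun _ => le_rfl) fun m n => by simp
  have hql := admissible_koszul (N := N) (c₁ := c₁) (c₂ := c₂) (s := s) hM hκ
    (g := fun n => max (-(n : ℝ)) 0) (fun n => le_max_right _ _) fun m n => max_le (by
      have h1 := le_max_left (-(n : ℝ)) 0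
      have h2 := le_abs_self ((n : ℝ) - m)
      linarith) (add_nonneg (le_max_right _ _) (abs_nonneg _))
  have hqr := admissible_koszul (N := N) (c₁ := c₁) (c₂ := c₂) (s := s) hM hκ
    (g := fun n => max (n : ℝ) 0) (fun n => le_max_right _ _) fun m n => max_le (by
      have h1 := le_max_left (n : ℝ) 0
      have h2 := neg_abs_le ((n : ℝ) - m)
      linarith) (add_nonneg (le_max_right _ _) (abs_nonneg _))
  have hsites : ∀ w, C w ≠ 0 → sites w ≠ [] := fun w hw =>
    sites_ne_nil_of_koszulDegree (hdeg w hw)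
  have hC0 : Decays (siteSize fun _ => 0) C := hC.decays 0 fun w hw => by
    obtain ⟨m, hm⟩ := List.exists_mem_of_ne_nil _ (hsites w hw)
    exact ⟨le_rfl, m, hm, fun n _ => by positivity⟩
  -- `u` is the right half of the functional.
  set u : Functional N := fun w => (rightFraction w : ℂ) * C w with hu
  have hnorm : ∀ w, ‖u w‖ ≤ ‖C w‖ := fun w => by
    rw [hu, norm_mul, Complex.norm_real, Real.norm_of_nonneg (rightFraction_nonneg w)]
    exact mul_le_of_le_one_left (norm_nonneg _) (rightFraction_le_one w)
  have hu0 : Decays (siteSize fun _ => 0) u := hC0.mono (fun _ => 1) fun w => by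
    simpa using hnorm w
  have husym : GradedSymmetric u := GradedSymmetric.mul hC.symm fun v v' h => by
    rw [rightFraction_perm h]
  have hudeg : ∀ w, u w ≠ 0 → 2 ≤ (w.map (koszulDegree s)).sum := fun w hw =>
    hdeg w (right_ne_zero_of_mul hw)
  have hul : Decays (siteSize fun n => max (-(n : ℝ)) 0) u := hC.decays 0 fun w hw => by
    refine ⟨hnorm w, ?_⟩
    have : ∃ m ∈ sites w, 0 ≤ m := by
      by_contra! h
      exact left_ne_zero_of_mul hw (by rw [rightFraction_eq_zero h]; simp)
    obtain ⟨m, hm, hm0⟩ := this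
    refine ⟨m, hm, fun n _ => max_le ?_ (by positivity)⟩
    have h1 := le_abs_self ((m : ℝ) - n)
    have h2 : (0 : ℝ) ≤ m := by exact_mod_cast hm0
    linarith
  have hur : Decays (siteSize fun n => max (n : ℝ) 0) fun w => C w - u w :=
    hC.decays 0 fun w hw => by
      have e : C w - u w = ((1 - rightFraction w : ℝ) : ℂ) * C w := by
        rw [hu]; push_cast; ring
      rw [e] at hw ⊢
      refine ⟨?_, ?_⟩
      · rw [norm_mul, Complex.norm_real, Real.norm_of_nonneg
          (sub_nonneg.2 (rightFraction_le_one w))]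
        exact mul_le_of_le_one_left (norm_nonneg _)
          (by linarith [rightFraction_nonneg w])
      · have : ∃ m ∈ sites w, m < 0 := by
          by_contra! h
          refine left_ne_zero_of_mul hw ?_
          rw [rightFraction_eq_one (hsites w (right_ne_zero_of_mul hw)) h]
          simp
        obtain ⟨m, hm, hm0⟩ := this
        refine ⟨m, hm, fun n _ => max_le ?_ (by positivity)⟩
        have h1 := neg_abs_le ((m : ℝ) - n)
        have h2 : (m : ℝ) ≤ 0 := by exact_mod_cast hm0.le
        linarith
  -- The differential of `u` is minus that of the left half, so it decays on both sides.
  have hδr : Decays (siteSize fun n => max (n : ℝ) 0)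
      (leibniz Letter.parity (koszul κ c₁ c₂ s) u) := by
    have h1 := hur.leibniz (p := Letter.parity)
      (siteSize_nonneg fun n => le_max_right _ _) hqr
    refine h1.mono (fun _ => 1) fun w => ?_
    rw [leibniz_sub hq0 hC0 hu0, hcl]
    simp
  have hδ := decays_abs (hul.leibniz (p := Letter.parity)
    (siteSize_nonneg fun n => le_max_right _ _) hql) hδr
  obtain ⟨e, he, hesym, hedeg, heq⟩ := koszul_exact hσ hc₁ hc₂ hH hq hη hδ
    (husym.leibniz oddMatrix_koszul) (leibniz_koszul_koszul hσ0 hq0 hu0) fun w hw => by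
      by_contra hlt
      refine hw (leibniz_eq_zero_of_grading koszulDegree_koszul fun v _ hv => ?_)
      by_contra hv0
      have := hudeg v hv0
      omega
  have he0 : Decays (siteSize fun _ => 0) e := by
    intro l
    obtain ⟨L, M, hL0, hM, hL⟩ := he.exists_nonneg l
    refine ⟨L, 1, one_pos, fun w hw => (hL w hw).trans (mul_le_mul_of_nonneg_left ?_ hL0)⟩
    rw [sum_siteSize_zero, mul_zero, Real.exp_zero, Real.exp_le_one_iff, neg_mul, neg_nonpos]
    exact mul_nonneg hM.le (sum_size_nonneg hσ w)
  have hesites : ∀ w, e w ≠ 0 → sites w ≠ [] := fun w hw =>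
    sites_ne_nil_of_koszulDegree (hedeg w hw)
  -- The difference of the closed right half `G` with its translate decays away from the origin.
  set G : Functional N := fun w => u w - e w with hG
  have hGcl : leibniz Letter.parity (koszul κ c₁ c₂ s) G = 0 := by
    funext w
    rw [hG, leibniz_sub hq0 hu0 he0, heq]
    simp
  have hmapsym : ∀ {P : Functional N}, GradedSymmetric P →
      GradedSymmetric fun w => P (w.map (Letter.translate 1)) := by
    intro P hP x y a b
    have := hP (x.map (Letter.translate 1)) (y.map (Letter.translate 1))
      (Letter.translate 1 a) (Letter.translate 1 b)
    simpa [Letter.parity_translate] using this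
  have hG0 : Decays (siteSize fun _ => 0) G := hu0.sub hσ0 he0
  have hG1 : Decays (siteSize fun _ => 0) fun w => G (w.map (Letter.translate 1)) := by
    intro l
    obtain ⟨L, M, hM, hL⟩ := hG0 l
    refine ⟨L, M, hM, fun w hw => ?_⟩
    have := hL (w.map (Letter.translate 1)) (by simpa using hw)
    rwa [sum_siteSize_zero] at this ⊢
  have he1 : Decays (siteSize fun n => |(n : ℝ)|) fun w => e (w.map (Letter.translate 1)) := by
    intro l
    obtain ⟨L, M, hL0, hM, hL⟩ := he.exists_nonneg l
    refine ⟨L * Real.exp (M * l), M, hM, fun w hw => (hL _ (by simpa using hw)).trans ?_⟩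
    rw [mul_assoc, ← Real.exp_add]
    refine mul_le_mul_of_nonneg_left (Real.exp_le_exp.2 ?_) hL0
    have h1 : (w.map (siteSize fun n => |(n : ℝ)|)).sum ≤
        ((w.map (Letter.translate 1)).map (siteSize fun n => |(n : ℝ)|)).sum + l := by
      rw [← hw]
      clear hw
      induction w with
      | nil => simp
      | cons x w ih =>
        have hx : siteSize (fun n => |(n : ℝ)|) x ≤
            siteSize (fun n => |(n : ℝ)|) (Letter.translate 1 x) + 1 := by
          have h : ∀ n : ℤ, |(n : ℝ)| ≤ |((n + 1 : ℤ) : ℝ)| + 1 := fun n => by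
            have := abs_sub ((n + 1 : ℤ) : ℝ) 1
            simpa using this
          cases x with
          | rho => simp [siteSize, Letter.site, Letter.translate]
          | zeta => simp [siteSize, Letter.site, Letter.translate]
          | _ s n => exact h n
        simp only [List.map_cons, List.sum_cons, List.length_cons]
        push_cast
        linarith
    have := mul_le_mul_of_nonneg_left h1 hM.le
    linarith
  have hu1 : Decays (siteSize fun n => |(n : ℝ)|)
      fun w => u (w.map (Letter.translate 1)) - u w := hC.decays 1 fun w hw => by
    have e1 : u (w.map (Letter.translate 1)) - u w =
        ((rightFraction (w.map (Letter.translate 1)) - rightFraction w : ℝ) : ℂ) * C w := by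
      rw [hu]
      simp only [hC.apply_translate]
      push_cast
      ring
    rw [e1] at hw ⊢
    constructor
    · rw [norm_mul, Complex.norm_real, Real.norm_eq_abs]
      refine mul_le_of_le_one_left (norm_nonneg _) (abs_le.2 ⟨?_, ?_⟩) <;>
      linarith [rightFraction_nonneg w, rightFraction_le_one w,
        rightFraction_nonneg (w.map (Letter.translate 1)),
        rightFraction_le_one (w.map (Letter.translate 1))]
    · refine ⟨-1, by_contra fun h => left_ne_zero_of_mul hw ?_, fun n _ => ?_⟩
      · rw [rightFraction_translate_one h]; simp
      · have := abs_sub ((n : ℝ) + 1) 1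
        rw [add_sub_cancel_right, abs_one, ← abs_neg ((n : ℝ) + 1)] at this
        refine this.trans_eq ?_
        congr 2
        push_cast
        ring
  have hfd : Decays (siteSize fun n => |(n : ℝ)|)
      fun w => G (w.map (Letter.translate 1)) - G w := by
    have := (hu1.sub hσ he1).add hσ he
    refine this.mono (fun _ => 1) fun w => le_of_eq ?_
    rw [one_mul, hG]
    congr 1
    ring
  have hGsym : GradedSymmetric G := husym.sub hesym
  have hGdeg : ∀ w, G w ≠ 0 → 2 ≤ (w.map (koszulDegree s)).sum := fun w hw => by
    by_contra hlt
    have h1 : u w = 0 := by_contra fun h => hlt (hudeg w h)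
    have h2 : e w = 0 := by_contra fun h => hlt (hedeg w h)
    exact hw (by rw [hG]; beta_reduce; rw [h1, h2, sub_zero])
  obtain ⟨d, hd, hdsym, hddeg, hdeq⟩ := koszul_exact hσ hc₁ hc₂ hH hq hη hfd
    ((hmapsym hGsym).sub hGsym) (by
      funext w
      rw [leibniz_sub hq0 hG1 hG0, leibniz_map _ (Letter.parity_translate 1) (koszul_translate 1),
        hGcl]
      simp) fun w hw => by
      by_contra hlt
      have h1 : G w = 0 := by_contra fun h => hlt (by linarith [hGdeg w h])
      have h2 : G (w.map (Letter.translate 1)) = 0 := by_contra fun h => hlt (by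
        have := hGdeg _ h
        rw [koszulDegree_translate] at this
        linarith)
      exact hw (by rw [h1, h2, sub_zero])
  refine ⟨_, isLocalFunctional_tsum_translate hd hdsym, ?_⟩
  funext w
  have hsum := leibniz_tsum (p := Letter.parity) hq0
    (hd.translates fun w hw => sites_ne_nil_of_koszulDegree (hddeg w hw)) w
  have hterm : ∀ t : ℤ, leibniz Letter.parity (koszul κ c₁ c₂ s)
      (fun v => d (v.map (Letter.translate t))) w =
      G (w.map (Letter.translate (t + 1))) - G (w.map (Letter.translate t)) := fun t => by
    rw [leibniz_map _ (Letter.parity_translate t) (koszul_translate t), hdeq]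
    beta_reduce
    rw [map_translate_map_translate]
  simp only [hterm] at hsum
  rw [← hsum.tsum_eq]
  have he2 : Tendsto (fun t : ℤ => e (w.map (Letter.translate t))) cofinite (𝓝 0) := by
    obtain ⟨L, M, hL0, hM, hL⟩ := he.translates hesites w.length
    exact ((hL w rfl).1.of_norm).tendsto_cofinite_zero
  have hbd : ∃ K : ℤ, ∀ n ∈ sites w, |n| ≤ K :=
    ⟨((sites w).map fun n => |n|).sum, fun n hn => by
      refine List.single_le_sum ?_ _ (List.mem_map_of_mem hn)
      intro x hx
      obtain ⟨y, -, rfl⟩ := List.mem_map.1 hx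
      exact abs_nonneg y⟩
  obtain ⟨K, hK⟩ := hbd
  -- On a fixed word `G ∘ translate t` tends to `C` for `t → ∞` and to `0` for `t → -∞`.
  refine tendsto_of_telescoping (G := fun t => G (w.map (Letter.translate t))) hsum.summable ?_ ?_
  · rw [← sub_zero (C w)]
    refine Tendsto.sub ?_ (he2.comp
      (Nat.cast_injective (R := ℤ)).tendsto_cofinite |>.mono_left (by rw [Nat.cofinite_eq_atTop]))
    refine tendsto_const_nhds.congr' ?_
    filter_upwards [eventually_ge_atTop K.toNat] with n hn
    by_cases h0 : C w = 0
    · simp [hu, hC.apply_translate, h0]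
    · rw [hu]
      simp only [hC.apply_translate]
      rw [rightFraction_eq_one]
      · simp
      · rw [sites_map_translate]
        simpa using hsites w h0
      · rw [sites_map_translate]
        intro k hk
        obtain ⟨m, hm, rfl⟩ := List.mem_map.1 hk
        have := (abs_le.1 (hK m hm)).1
        omega
  · rw [← sub_zero (0 : ℂ)]
    refine Tendsto.sub ?_ (he2.comp (Function.Injective.tendsto_cofinite
      (f := fun n : ℕ => -(n : ℤ)) fun a b h => by simpa using h)
      |>.mono_left (by rw [Nat.cofinite_eq_atTop]))
    refine tendsto_const_nhds.congr' ?_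
    filter_upwards [eventually_ge_atTop (K.toNat + 1)] with n hn
    rw [hu]
    simp only
    rw [rightFraction_eq_zero]
    · simp
    · rw [sites_map_translate]
      intro k hk
      obtain ⟨m, hm, rfl⟩ := List.mem_map.1 hk
      have := (abs_le.1 (hK m hm)).2
      omega

end Translation

/-! ### The supercharges and their contracting homotopies -/

section Supercharges

variable {N : ℕ} {O : Functional N} {nabla : ℤ → ℂ} {s t : Pol}

/-- The opposite type. -/
def Pol.other : Pol → Pol
  | plus => minus
  | minus => plus

/-- The sign `±1` of a type. -/
def Pol.sign : Pol → ℂ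
  | plus => 1
  | minus => -1

theorem Pol.sign_mul_sign (s : Pol) : s.sign * s.sign = 1 := by
  cases s <;> simp [Pol.sign]

theorem Pol.eq_or_eq_other (s t : Pol) : t = s ∨ t = s.other := by
  cases s <;> cases t <;> simp [Pol.other]

theorem Pol.other_ne (s : Pol) : s.other ≠ s := by
  cases s <;> simp [Pol.other]

theorem Pol.other_other (s : Pol) : s.other.other = s := by
  cases s <;> rfl

/-- The type of a variable. -/
def Letter.pol : Letter N → Pol
  | phi s _ => s
  | chi s _ => s
  | chiBar s _ => s
  | aux s _ => s
  | rho s _ => s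
  | zeta s _ => s

open Classical in
/-- The grading that counts the variables of type `s`. -/
noncomputable def typeCount (s : Pol) (a : Letter N) : ℤ := if a.pol = s then 1 else 0

theorem typeCount_nonneg (s : Pol) (a : Letter N) : 0 ≤ typeCount s a := by
  unfold typeCount
  split_ifs <;> simp

theorem sum_typeCount_nonneg (s : Pol) (w : List (Letter N)) :
    0 ≤ (w.map (typeCount s)).sum :=
  List.sum_nonneg (by simpa using fun a _ => typeCount_nonneg s a)

open Classical in
/-- The contracting homotopy of `Q'_s` on the variables of type `s`: `χ̄_s ↦ ± φ_s`, `F_s ↦ χ_s`,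
`ζ_s ↦ ± ρ_s`. It involves a single lattice site. -/
noncomputable def homotopy (s : Pol) : Letter N → Letter N → ℂ
  | .chiBar t n, .phi t' m => if t = s ∧ t' = s ∧ n = m then s.sign else 0
  | .aux t n, .chi t' m => if t = s ∧ t' = s ∧ n = m then 1 else 0
  | .zeta t i, .rho t' j => if t = s ∧ t' = s ∧ i = j then s.sign else 0
  | _, _ => 0

/-- A homotopy replaces a variable by a multiple of a single variable at the same site. This is what
makes it preserve locality. -/
theorem homotopy_row (s : Pol) (x : Letter N) : ∃ b : Letter N, b.site = x.site ∧
    (∀ a, a ≠ b → homotopy s a x = 0) ∧ ‖homotopy s b x‖ ≤ 1 := by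
  have hsign : ‖s.sign‖ ≤ 1 := by cases s <;> simp [Pol.sign]
  cases x with
  | phi t m =>
    refine ⟨.chiBar t m, rfl, fun a ha => ?_, ?_⟩
    · cases a <;> simp [homotopy] at ha ⊢
      rintro rfl rfl h
      exact absurd h (ha rfl)
    · simp only [homotopy]; split_ifs <;> simp [hsign]
  | chi t m =>
    refine ⟨.aux t m, rfl, fun a ha => ?_, ?_⟩
    · cases a <;> simp [homotopy] at ha ⊢
      rintro rfl rfl h
      exact absurd h (ha rfl)
    · simp only [homotopy]; split_ifs <;> simp
  | rho t m =>
    refine ⟨.zeta t m, rfl, fun a ha => ?_, ?_⟩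
    · cases a <;> simp [homotopy] at ha ⊢
      rintro rfl rfl h
      exact absurd h (ha rfl)
    · simp only [homotopy]; split_ifs <;> simp [hsign]
  | chiBar t m => exact ⟨.chiBar t m, rfl, fun a _ => by cases a <;> rfl, by simp [homotopy]⟩
  | aux t m => exact ⟨.aux t m, rfl, fun a _ => by cases a <;> rfl, by simp [homotopy]⟩
  | zeta t m => exact ⟨.zeta t m, rfl, fun a _ => by cases a <;> rfl, by simp [homotopy]⟩

theorem tsum_homotopy_phi (m : ℤ) (g : Letter N → ℂ) :
    ∑' a, homotopy s a (.phi t m) * g a =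
      open Classical in if t = s then s.sign * g (.chiBar s m) else 0 := by
  split_ifs with h
  · subst h
    rw [tsum_eq_single (.chiBar t m)]
    · simp [homotopy]
    · intro a ha
      cases a <;> simp_all [homotopy]
  · refine (tsum_congr fun a => ?_).trans tsum_zero
    cases a <;> simp [homotopy, h]

theorem tsum_homotopy_chi (m : ℤ) (g : Letter N → ℂ) :
    ∑' a, homotopy s a (.chi t m) * g a =
      open Classical in if t = s then g (.aux s m) else 0 := by
  split_ifs with h
  · subst h
    rw [tsum_eq_single (.aux t m)]
    · simp [homotopy]
    · intro a ha
      cases a <;> simp_all [homotopy]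
  · refine (tsum_congr fun a => ?_).trans tsum_zero
    cases a <;> simp [homotopy, h]

theorem tsum_homotopy_rho (m : Fin N) (g : Letter N → ℂ) :
    ∑' a, homotopy s a (.rho t m) * g a =
      open Classical in if t = s then s.sign * g (.zeta s m) else 0 := by
  split_ifs with h
  · subst h
    rw [tsum_eq_single (.zeta t m)]
    · simp [homotopy]
    · intro a ha
      cases a <;> simp_all [homotopy]
  · refine (tsum_congr fun a => ?_).trans tsum_zero
    cases a <;> simp [homotopy, h]

theorem tsum_homotopy_chiBar (t : Pol) (m : ℤ) (g : Letter N → ℂ) :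
    ∑' a, homotopy s a (.chiBar t m) * g a = 0 :=
  (tsum_congr fun a => by cases a <;> simp [homotopy]).trans tsum_zero

theorem tsum_homotopy_aux (t : Pol) (m : ℤ) (g : Letter N → ℂ) :
    ∑' a, homotopy s a (.aux t m) * g a = 0 :=
  (tsum_congr fun a => by cases a <;> simp [homotopy]).trans tsum_zero

theorem tsum_homotopy_zeta (t : Pol) (m : Fin N) (g : Letter N → ℂ) :
    ∑' a, homotopy s a (.zeta t m) * g a = 0 :=
  (tsum_congr fun a => by cases a <;> simp [homotopy]).trans tsum_zero

open Classical in
/-- The supercharges in a form uniform in the two types. -/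
noncomputable def chargeMatrix (nabla : ℤ → ℂ) (s : Pol) : Letter N → Letter N → ℂ
  | .phi t n, .chiBar t' m => if t = s ∧ t' = s ∧ n = m then s.sign else 0
  | .chi t n, .aux t' m => if t = s ∧ t' = s ∧ n = m then 1 else 0
  | .chi t n, .phi t' m => if t ≠ s ∧ t' ≠ s then t.sign * Complex.I * nabla (n - m) else 0
  | .aux t n, .chiBar t' m => if t ≠ s ∧ t' ≠ s then -Complex.I * nabla (n - m) else 0
  | .rho t i, .zeta t' j => if t = s ∧ t' = s ∧ i = j then s.sign else 0
  | _, _ => 0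

theorem superchargeCoeff_eq (nabla : ℤ → ℂ) (s : Pol) (a x : Letter N) :
    superchargeCoeff nabla s a x = chargeMatrix nabla s a x := by
  cases s <;> rcases a with ⟨_ | _, _⟩ | ⟨_ | _, _⟩ | ⟨_ | _, _⟩ | ⟨_ | _, _⟩ | ⟨_ | _, _⟩ |
    ⟨_ | _, _⟩ <;> rcases x with ⟨_ | _, _⟩ | ⟨_ | _, _⟩ | ⟨_ | _, _⟩ | ⟨_ | _, _⟩ |
    ⟨_ | _, _⟩ | ⟨_ | _, _⟩ <;> simp [superchargeCoeff, chargeMatrix, Pol.sign, eq_comm]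

theorem supercharge_eq (nabla : ℤ → ℂ) (s : Pol) (O : Functional N) :
    supercharge nabla s O = leibniz Letter.parity (chargeMatrix nabla s) O := by
  rw [supercharge_eq_leibniz]
  congr 1
  funext a x
  exact superchargeCoeff_eq nabla s a x

theorem tsum_charge_phi (m : ℤ) (g : Letter N → ℂ) :
    ∑' a, chargeMatrix nabla s a (.phi t m) * g a = open Classical in if t = s then 0 else
      ∑' n, t.sign * Complex.I * nabla (n - m) * g (.chi t n) := by
  split_ifs with h
  · refine (tsum_congr fun a => ?_).trans tsum_zero
    cases a <;> simp [chargeMatrix, h]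
  · rw [tsum_species (Letter.chi_injective t)]
    · simp [chargeMatrix, h]
    · intro a ha
      cases a <;> simp [chargeMatrix] at ha ⊢
      rename_i t' n
      cases s <;> cases t <;> cases t' <;> simp_all

theorem tsum_charge_chiBar_self (m : ℤ) (g : Letter N → ℂ) :
    ∑' a, chargeMatrix nabla s a (.chiBar s m) * g a = s.sign * g (.phi s m) := by
  rw [tsum_eq_single (.phi s m)]
  · simp [chargeMatrix]
  · intro a ha
    cases a <;> simp_all [chargeMatrix]

theorem tsum_charge_chiBar_of_ne (h : t ≠ s) (m : ℤ) (g : Letter N → ℂ) :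
    ∑' a, chargeMatrix nabla s a (.chiBar t m) * g a =
      ∑' n, -Complex.I * nabla (n - m) * g (.aux t n) := by
  rw [tsum_species (Letter.aux_injective t)]
  · simp [chargeMatrix, h]
  · intro a ha
    cases a <;> simp [chargeMatrix] at ha ⊢
    · simp [h]
    · rename_i t' n
      cases s <;> cases t <;> cases t' <;> simp_all

theorem tsum_charge_aux (m : ℤ) (g : Letter N → ℂ) :
    ∑' a, chargeMatrix nabla s a (.aux t m) * g a =
      open Classical in if t = s then g (.chi s m) else 0 := by
  split_ifs with h
  · subst h
    rw [tsum_eq_single (.chi t m)]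
    · simp [chargeMatrix]
    · intro a ha
      cases a <;> simp_all [chargeMatrix]
  · refine (tsum_congr fun a => ?_).trans tsum_zero
    cases a <;> simp [chargeMatrix, h]

theorem tsum_charge_zeta (i : Fin N) (g : Letter N → ℂ) :
    ∑' a, chargeMatrix nabla s a (.zeta t i) * g a =
      open Classical in if t = s then s.sign * g (.rho s i) else 0 := by
  split_ifs with h
  · subst h
    rw [tsum_eq_single (.rho t i)]
    · simp [chargeMatrix]
    · intro a ha
      cases a <;> simp_all [chargeMatrix]
  · refine (tsum_congr fun a => ?_).trans tsum_zero
    cases a <;> simp [chargeMatrix, h]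

theorem tsum_charge_chi (m : ℤ) (g : Letter N → ℂ) :
    ∑' a, chargeMatrix nabla s a (.chi t m) * g a = 0 :=
  (tsum_congr fun a => by cases a <;> simp [chargeMatrix]).trans tsum_zero

theorem tsum_charge_rho (i : Fin N) (g : Letter N → ℂ) :
    ∑' a, chargeMatrix nabla s a (.rho t i) * g a = 0 :=
  (tsum_congr fun a => by cases a <;> simp [chargeMatrix]).trans tsum_zero

theorem oddMatrix_charge : OddMatrix (chargeMatrix (N := N) nabla s) := by
  intro a b h
  cases a <;> cases b <;> simp_all [chargeMatrix, Letter.parity, Letter.fermionNumber]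

theorem oddMatrix_homotopy : OddMatrix (homotopy (N := N) s) := by
  intro a b h
  cases a <;> cases b <;> simp_all [homotopy, Letter.parity, Letter.fermionNumber]

theorem fermionNumber_homotopy (a x : Letter N) (h : homotopy s a x ≠ 0) :
    a.fermionNumber = x.fermionNumber + -1 := by
  cases a <;> cases x <;> simp_all [homotopy, Letter.fermionNumber]

theorem typeCount_charge (a x : Letter N) (h : chargeMatrix nabla s a x ≠ 0) :
    typeCount t a = typeCount t x + 0 := by
  have e : a.pol = x.pol := by
    cases s <;> rcases a with ⟨_ | _, _⟩ | ⟨_ | _, _⟩ | ⟨_ | _, _⟩ | ⟨_ | _, _⟩ | ⟨_ | _, _⟩ |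
      ⟨_ | _, _⟩ <;> cases x <;> simp_all [chargeMatrix, Letter.pol] <;> rename_i t' _ <;>
      cases t' <;> simp_all
  rw [typeCount, typeCount, e, add_zero]

theorem typeCount_homotopy (a x : Letter N) (h : homotopy s a x ≠ 0) :
    typeCount t a = typeCount t x + 0 := by
  have e : a.pol = x.pol := by
    cases a <;> cases x <;> simp_all [homotopy, Letter.pol]
  rw [typeCount, typeCount, e, add_zero]

theorem typeCount_koszul {κ : ℤ → ℂ} {c₁ c₂ : ℂ} (a x : Letter N)
    (h : koszul κ c₁ c₂ s a x ≠ 0) : typeCount t a = typeCount t x + 0 := by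
  have e : a.pol = x.pol := by
    cases a <;> cases x <;> simp_all [koszul, Letter.pol]
  rw [typeCount, typeCount, e, add_zero]

theorem fermionNumber_koszul {κ : ℤ → ℂ} {c₁ c₂ : ℂ} (a x : Letter N)
    (h : koszul κ c₁ c₂ s a x ≠ 0) : a.fermionNumber = x.fermionNumber + 1 := by
  cases a <;> cases x <;> simp_all [koszul, Letter.fermionNumber]

/-- On the variables of the opposite type a supercharge is a Koszul differential. -/
theorem charge_other_eq_koszul {x : Letter N} (hx : x.pol = s) (a : Letter N) :
    chargeMatrix nabla s.other a x = koszul nabla (s.sign * Complex.I) (-Complex.I) s a x := by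
  subst hx
  rcases a with ⟨_ | _, _⟩ | ⟨_ | _, _⟩ | ⟨_ | _, _⟩ | ⟨_ | _, _⟩ | ⟨_ | _, _⟩ |
      ⟨_ | _, _⟩ <;> rcases x with ⟨_ | _, _⟩ | ⟨_ | _, _⟩ | ⟨_ | _, _⟩ | ⟨_ | _, _⟩ |
    ⟨_ | _, _⟩ | ⟨_ | _, _⟩ <;> simp [chargeMatrix, koszul, Pol.other, Letter.pol]

theorem homotopy_translate (k : ℤ) (a x : Letter N) :
    homotopy s (Letter.translate k a) (Letter.translate k x) = homotopy s a x := by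
  cases a <;> cases x <;> simp [Letter.translate, homotopy] <;> grind

theorem admissible_homotopy : Admissible (siteSize fun _ => 0) (homotopy (N := N) s) := by
  refine admissible_of_rows fun M hM => ⟨1, 1, zero_le_one, one_pos, fun x => Or.inr (Or.inl ?_)⟩
  obtain ⟨b, -, hb, h1⟩ := homotopy_row s x
  have e : ∀ a : Letter N, siteSize (fun _ => (0 : ℝ)) a = 0 := fun a => by
    cases a <;> rfl
  exact ⟨b, hb, by simpa [e] using h1⟩

theorem admissible_charge (h : IsDifferenceOperator nabla) :
    Admissible (siteSize fun _ => 0) (chargeMatrix (N := N) nabla s) := by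
  obtain ⟨L, M₀, hM₀, hκ⟩ := h.locality
  refine admissible_of_rows fun M hM => ?_
  obtain ⟨C, M', hC0, hM', hC⟩ := summable_convolution_row hM₀ hκ (g := fun _ => 0)
    (fun _ => le_rfl) (fun _ _ => by positivity) hM
  have e : ∀ a : Letter N, siteSize (fun _ => (0 : ℝ)) a = 0 := fun a => by
    cases a <;> rfl
  have hn : ∀ r : Pol, ‖r.sign‖ = 1 := fun r => by cases r <;> simp [Pol.sign]
  refine ⟨C + 1, M', by positivity, hM', fun x => ?_⟩
  simp only [e, mul_zero, Real.exp_zero, mul_one] at hC ⊢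
  cases x with
  | chi t m => exact Or.inl fun a => by cases a <;> rfl
  | rho t m => exact Or.inl fun a => by cases a <;> rfl
  | phi t m =>
    by_cases ht : t = s
    · exact Or.inl fun a => by cases a <;> simp [chargeMatrix, ht]
    · refine Or.inr (Or.inr ⟨.chi t, Letter.chi_injective t, fun a ha => ?_, ?_⟩)
      · cases a <;> simp [chargeMatrix] at ha ⊢
        rename_i t' n
        cases s <;> cases t <;> cases t' <;> simp_all
      · simp only [chargeMatrix, ht, ne_eq, not_false_eq_true, and_self, if_true, norm_mul, hn,
          Complex.norm_I, one_mul]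
        exact ⟨(hC m).1, (hC m).2.trans (by linarith)⟩
  | chiBar t m =>
    by_cases ht : t = s
    · subst ht
      refine Or.inr (Or.inl ⟨.phi t m, fun a ha => ?_, ?_⟩)
      · cases a <;> simp_all [chargeMatrix]
      · simp [chargeMatrix, hn, hC0]
    · refine Or.inr (Or.inr ⟨.aux t, Letter.aux_injective t, fun a ha => ?_, ?_⟩)
      · cases a <;> simp [chargeMatrix, ht] at ha ⊢
        rename_i t' n
        cases s <;> cases t <;> cases t' <;> simp_all
      · simp only [chargeMatrix, ht, ne_eq, not_false_eq_true, and_self, if_true, norm_mul, norm_neg,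
          Complex.norm_I, one_mul]
        exact ⟨(hC m).1, (hC m).2.trans (by linarith)⟩
  | aux t m =>
    refine Or.inr (Or.inl ⟨.chi t m, fun a ha => ?_, ?_⟩)
    · cases a <;> simp_all [chargeMatrix]
    · simp only [chargeMatrix]; split_ifs <;> simp <;> linarith
  | zeta t m =>
    refine Or.inr (Or.inl ⟨.rho t m, fun a ha => ?_, ?_⟩)
    · cases a <;> simp_all [chargeMatrix]
    · simp only [chargeMatrix]; split_ifs <;> simp [hn] <;> linarith

/-! ### Anticommutators of the supercharges and the homotopies -/

/-- A homotopy and the supercharge of its type generate the even derivation that counts the variables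
of this type. -/
theorem anticomm_charge_homotopy_self [DecidableEq (Letter N)] (b x : Letter N) :
    rowComp (chargeMatrix nabla s) (homotopy s) b x +
      rowComp (homotopy s) (chargeMatrix nabla s) b x =
      if b = x then (typeCount s x : ℂ) else 0 := by
  unfold rowComp
  have hs := s.sign_mul_sign
  cases x with
  | phi t m =>
    rw [tsum_charge_phi, tsum_homotopy_phi]
    by_cases ht : t = s
    · subst ht
      cases b <;> simp [chargeMatrix, typeCount, Letter.pol, hs]; grind
    · cases b <;> simp [typeCount, homotopy, Letter.pol, ht]
  | chi t m =>
    rw [tsum_charge_chi, tsum_homotopy_chi]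
    by_cases ht : t = s
    · subst ht
      cases b <;> simp [chargeMatrix, typeCount, Letter.pol]; grind
    · cases b <;> simp [typeCount, Letter.pol, ht]
  | rho t m =>
    rw [tsum_charge_rho, tsum_homotopy_rho]
    by_cases ht : t = s
    · subst ht
      cases b <;> simp [chargeMatrix, typeCount, Letter.pol, hs]; grind
    · cases b <;> simp [typeCount, Letter.pol, ht]
  | chiBar t m =>
    rw [tsum_homotopy_chiBar]
    by_cases ht : t = s
    · subst ht
      rw [tsum_charge_chiBar_self]
      cases b <;> simp [homotopy, typeCount, Letter.pol, hs]; grind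
    · rw [tsum_charge_chiBar_of_ne ht]
      cases b <;> simp [homotopy, typeCount, Letter.pol, ht]
  | aux t m =>
    rw [tsum_homotopy_aux, tsum_charge_aux]
    by_cases ht : t = s
    · subst ht
      cases b <;> simp [homotopy, typeCount, Letter.pol]; grind
    · cases b <;> simp [typeCount, Letter.pol, ht]
  | zeta t m =>
    rw [tsum_homotopy_zeta, tsum_charge_zeta]
    by_cases ht : t = s
    · subst ht
      cases b <;> simp [homotopy, typeCount, Letter.pol, hs]; grind
    · cases b <;> simp [typeCount, Letter.pol, ht]

theorem anticomm_charge_homotopy_other (b x : Letter N) :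
    rowComp (chargeMatrix nabla s) (homotopy s.other) b x +
      rowComp (homotopy s.other) (chargeMatrix nabla s) b x = 0 := by
  unfold rowComp
  have ho := s.other_ne
  cases x with
  | phi t m =>
    rw [tsum_charge_phi, tsum_homotopy_phi]
    rcases s.eq_or_eq_other t with rfl | rfl
    · simp [ho.symm]
    · cases b <;> simp [chargeMatrix, homotopy, ho]
      rename_i t n
      by_cases ht : t = s.other
      · subst ht
        simp [ho]
        ring
      · simp only [ht, false_and, if_false]
        simp [(s.eq_or_eq_other t).resolve_right ht]
  | chi t m =>
    rw [tsum_charge_chi, tsum_homotopy_chi]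
    cases b <;> simp [chargeMatrix, ho]
  | rho t m =>
    rw [tsum_charge_rho, tsum_homotopy_rho]
    cases b <;> simp [chargeMatrix, ho]
  | chiBar t m =>
    rw [tsum_homotopy_chiBar]
    rcases s.eq_or_eq_other t with rfl | rfl
    · rw [tsum_charge_chiBar_self]
      cases b <;> simp [homotopy, ho.symm]
    · rw [tsum_charge_chiBar_of_ne ho]
      cases b <;> simp [homotopy]
  | aux t m =>
    rw [tsum_homotopy_aux, tsum_charge_aux]
    cases b <;> simp [homotopy, ho.symm]
  | zeta t m =>
    rw [tsum_homotopy_zeta, tsum_charge_zeta]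
    cases b <;> simp [homotopy, ho.symm]

theorem anticomm_charge_charge (b x : Letter N) :
    rowComp (chargeMatrix nabla s) (chargeMatrix nabla s.other) b x +
      rowComp (chargeMatrix nabla s.other) (chargeMatrix nabla s) b x = 0 := by
  unfold rowComp
  have ho := s.other_ne
  have key : ∀ r r' : Pol, r ≠ r' → ∀ m : ℤ,
      r.sign * chargeMatrix nabla r' b (.phi r m) +
        ∑' n, -Complex.I * nabla (n - m) * chargeMatrix nabla r b (.aux r n) = 0 := by
    intro r r' hr m
    have hs := r.sign_mul_sign
    cases b <;> simp [chargeMatrix]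
    rename_i t n
    by_cases ht : t = r
    · subst ht
      simp [hr]
      linear_combination Complex.I * nabla (n - m) * hs
    · have : t = r' := by cases r <;> cases r' <;> cases t <;> simp_all
      simp only [ht, false_and, if_false]
      simp [this]
  cases x with
  | phi t m =>
    rw [tsum_charge_phi, tsum_charge_phi]
    cases b <;> simp [chargeMatrix]
  | chi t m => rw [tsum_charge_chi, tsum_charge_chi, add_zero]
  | rho t m => rw [tsum_charge_rho, tsum_charge_rho, add_zero]
  | chiBar t m =>
    rcases s.eq_or_eq_other t with rfl | rfl
    · rw [tsum_charge_chiBar_self, tsum_charge_chiBar_of_ne ho.symm]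
      exact key _ _ ho.symm m
    · rw [tsum_charge_chiBar_self, tsum_charge_chiBar_of_ne ho, add_comm]
      exact key _ _ ho m
  | aux t m =>
    rw [tsum_charge_aux, tsum_charge_aux]
    cases b <;> simp [chargeMatrix]
  | zeta t m =>
    rw [tsum_charge_zeta, tsum_charge_zeta]
    cases b <;> simp [chargeMatrix]

end Supercharges

/-! ### Local functionals: closure properties -/

section LocalFunctionals

variable {N : ℕ} {p : Letter N → ℕ} {A : Letter N → Letter N → ℂ} {O O' : Functional N}
  {nabla : ℤ → ℂ} {s t : Pol}

theorem Letter.finite_site_eq_none : Finite {a : Letter N // a.site = none} := by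
  refine Set.Finite.subset (s := ⋃ q : Bool × Bool, Set.range fun i : Fin N =>
    (if q.1 then Letter.rho else Letter.zeta) (if q.2 then Pol.plus else Pol.minus) i)
    (Set.finite_iUnion fun q => Set.finite_range _) fun a ha => ?_
  rw [Set.mem_iUnion]
  cases a with
  | rho t i => cases t with
    | plus => exact ⟨(true, true), i, rfl⟩
    | minus => exact ⟨(true, false), i, rfl⟩
  | zeta t i => cases t with
    | plus => exact ⟨(false, true), i, rfl⟩
    | minus => exact ⟨(false, false), i, rfl⟩
  | _ => exact absurd (show Letter.site _ = none from ha) (by simp [Letter.site])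

/-- Local functionals are bounded in each degree. Locality says nothing about words without lattice
fields, but there are only finitely many of these in each degree. -/
theorem IsLocalFunctional.bounded (h : IsLocalFunctional O) :
    Decays (siteSize fun _ => 0) O := by
  intro d
  obtain ⟨L, M, hM, hL⟩ := h.locality d
  have := Letter.finite_site_eq_none (N := N)
  obtain ⟨B, hB⟩ := (((List.finite_length_eq {a : Letter N // a.site = none} d).image
    (List.map Subtype.val)).image fun w => ‖O w‖).bddAbove
  refine ⟨max L B, 1, one_pos, fun w hw => ?_⟩
  rw [sum_siteSize_zero, mul_zero, Real.exp_zero, mul_one]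
  by_cases hs : ∃ n, n ∈ w.filterMap Letter.site
  · obtain ⟨n, hn⟩ := hs
    exact (by simpa using hL w hw n hn n hn : ‖O w‖ ≤ L).trans (le_max_left _ _)
  · refine le_trans (hB ⟨w, ⟨w.pmap Subtype.mk fun a ha => ?_, ?_, ?_⟩, rfl⟩) (le_max_right _ _)
    · by_contra hne
      obtain ⟨n, hn⟩ := Option.ne_none_iff_exists'.1 hne
      exact hs ⟨n, List.mem_filterMap.2 ⟨a, ha, hn⟩⟩
    · simpa using hw
    · simp [List.map_pmap]

theorem IsLocalFunctional.mul (h : IsLocalFunctional O) {g : List (Letter N) → ℂ}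
    (hperm : ∀ u v : List (Letter N), u.Perm v → g u = g v)
    (hshift : ∀ w, g (w.map Letter.shift) = g w) (hg : ∀ w, ‖g w‖ ≤ 1) :
    IsLocalFunctional fun w => g w * O w where
  symm := GradedSymmetric.mul h.symm hperm
  translation w := by rw [hshift, h.translation]
  locality d := by
    obtain ⟨L, M, hM, hL⟩ := h.locality d
    refine ⟨L, M, hM, fun w hw m hm n hn => le_trans ?_ (hL w hw m hm n hn)⟩
    rw [norm_mul]
    exact mul_le_of_le_one_left (norm_nonneg _) (hg w)

theorem IsLocalFunctional.add (h : IsLocalFunctional O) (h' : IsLocalFunctional O') :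
    IsLocalFunctional fun w => O w + O' w where
  symm := GradedSymmetric.add h.symm h'.symm
  translation w := by rw [h.translation, h'.translation]
  locality d := by
    obtain ⟨L, M, hM, hL⟩ := h.locality d
    obtain ⟨L', M', hM', hL'⟩ := h'.locality d
    refine ⟨|L| + |L'|, min M M', lt_min hM hM', fun w hw m hm n hn =>
      (norm_add_le _ _).trans ?_⟩
    rw [add_mul]
    refine add_le_add ((hL w hw m hm n hn).trans ?_) ((hL' w hw m hm n hn).trans ?_)
    · gcongr
      · exact le_abs_self _
      · exact min_le_left _ _
    · gcongr
      · exact le_abs_self _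
      · exact min_le_right _ _

theorem IsLocalFunctional.neg (h : IsLocalFunctional O) : IsLocalFunctional fun w => -O w := by
  simpa using h.mul (g := fun _ => -1) (fun _ _ _ => rfl) (fun _ => rfl) (by simp)

theorem IsLocalFunctional.sub (h : IsLocalFunctional O) (h' : IsLocalFunctional O') :
    IsLocalFunctional fun w => O w - O' w := by
  simpa [sub_eq_add_neg] using h.add h'.neg

theorem filterMap_site_set {w : List (Letter N)} (i : Fin w.length) {b : Letter N}
    (hb : b.site = (w.get i).site) :
    (w.set i b).filterMap Letter.site = w.filterMap Letter.site := by
  have e : ∀ v : List (Letter N), v.filterMap Letter.site = (v.map Letter.site).filterMap id :=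
    fun v => by rw [List.filterMap_map]; rfl
  rw [e, e, List.map_set, hb,
    show (w.get i).site = (w.map Letter.site)[i.1]'(by simp) by simp, List.set_getElem_self]

theorem IsLocalFunctional.homotopy (h : IsLocalFunctional O) (s : Pol) :
    IsLocalFunctional (leibniz Letter.parity (homotopy s) O) where
  symm := GradedSymmetric.leibniz oddMatrix_homotopy h.symm
  translation w := by
    rw [← Letter.translate_one,
      ← leibniz_map _ (Letter.parity_translate 1) (homotopy_translate 1)]
    congr 1
    funext v
    exact h.apply_translate 1 v
  locality d := by
    obtain ⟨L, M, hM, hL⟩ := h.locality d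
    refine ⟨d * L, M, hM, fun w hw m hm n hn => (norm_sum_le _ _).trans ?_⟩
    have hle : ∀ i ∈ (Finset.univ : Finset (Fin w.length)),
        ‖(-1 : ℂ) ^ ((w.take i).map Letter.parity).sum *
          ∑' a, _root_.homotopy s a (w.get i) * O (w.set i a)‖ ≤
        L * Real.exp (-M * |(m : ℝ) - n|) := by
      intro i _
      obtain ⟨b, hbs, hb, hb1⟩ := homotopy_row s (w.get i)
      rw [tsum_eq_single b fun a ha => by rw [hb a ha, zero_mul], norm_mul, norm_mul, norm_pow,
        norm_neg, norm_one, one_pow, one_mul]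
      refine (mul_le_of_le_one_left (norm_nonneg _) hb1).trans
        (hL _ (by simpa using hw) m ?_ n ?_) <;> rwa [filterMap_site_set i hbs]
    refine (Finset.sum_le_card_nsmul _ _ _ hle).trans_eq ?_
    rw [Finset.card_univ, Fintype.card_fin, hw, nsmul_eq_mul, mul_assoc]

/-- A derivation commutes, up to the shift of the grading, with multiplication by a function of the
degree and a grading. -/
theorem leibniz_mul {G : Type*} [AddCommMonoid G] {γ : Letter N → G} {c : G}
    (hA : ∀ a x, A a x ≠ 0 → γ a = γ x + c) (g : ℕ → G → ℂ) (w : List (Letter N)) :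
    leibniz p A (fun v => g v.length (v.map γ).sum * O v) w =
      g w.length ((w.map γ).sum + c) * leibniz p A O w := by
  rw [← leibniz_smul]
  exact leibniz_congr hA w fun v hv hv' => by rw [hv, hv']

theorem leibniz_length {D : Set ℕ} (h : ∀ w, O w ≠ 0 → w.length ∈ D) (w : List (Letter N))
    (hw : leibniz p A O w ≠ 0) : w.length ∈ D := by
  by_contra hD
  refine hw ((leibniz_congr_length (O' := fun _ => 0) w fun v hv => ?_).trans (leibniz_zero w))
  by_contra hv'
  exact hD (hv ▸ h v hv')

/-- Graded symmetric coefficients with at most one anticommuting variable are symmetric. -/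
theorem GradedSymmetric.eq_of_perm (h : GradedSymmetric O) {u v : List (Letter N)}
    (huv : u.Perm v) (hu : (u.map Letter.parity).sum ≤ 1) : O u = O v := by
  suffices ∀ l, O (l ++ u) = O (l ++ v) from this []
  induction huv with
  | nil => exact fun _ => rfl
  | cons x _ ih =>
    intro l
    have := ih (by simp only [List.map_cons, List.sum_cons] at hu; omega) (l ++ [x])
    simpa using this
  | swap a b w =>
    intro l
    simp only [List.map_cons, List.sum_cons] at hu
    have e : a.parity * b.parity = 0 := by
      rcases Nat.eq_zero_or_pos a.parity with h0 | h0
      · simp [h0]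
      · rw [show b.parity = 0 by omega, mul_zero]
    rw [h l w a b, e, pow_zero, one_mul]
  | trans h1 _ ih1 ih2 =>
    intro l
    rw [ih1 hu l, ih2 ((h1.map Letter.parity).sum_eq ▸ hu) l]

/-! ### Extended CLR terms -/

/-- A derivation evaluated at a word to which only the variables `f`, commuting, contribute. -/
theorem leibniz_ofFn_append {k : ℕ} {f : Fin k → Letter N} (hp : ∀ j, p (f j) = 0)
    {u : List (Letter N)} (hu : ∀ x ∈ u, ∀ a, A a x = 0) :
    leibniz p A O (List.ofFn f ++ u) =
      ∑ j, ∑' a, A a (f j) * O (List.ofFn (Function.update f j a) ++ u) := by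
  induction k generalizing O with
  | zero => simpa using leibniz_zero_of_row hu
  | succ k ih =>
    rw [List.ofFn_succ, List.cons_append, leibniz_cons, hp, pow_zero, one_mul,
      ih fun j => hp j.succ, Fin.sum_univ_succ]
    congr 1
    · refine tsum_congr fun a => ?_
      simp [List.ofFn_succ]
    · refine Finset.sum_congr rfl fun j _ => tsum_congr fun a => ?_
      have e : (fun i : Fin k => Function.update f j.succ a i.succ) =
          Function.update (fun i => f i.succ) j a := by
        funext i
        simp [Function.update_apply]
      rw [List.ofFn_succ (f := Function.update f j.succ a), e,
        Function.update_of_ne (Fin.succ_ne_zero j).symm, List.cons_append]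

/-- A tuple with its `j`-th entry replaced, cyclically rotated so that this entry comes first. -/
theorem ofFn_update_perm {α : Type*} {k : ℕ} (f : Fin (k + 1) → α) (j : Fin (k + 1)) (a : α) :
    (List.ofFn (Function.update f j a)).Perm
      (a :: List.ofFn fun l : Fin k => f (j + l.succ)) := by
  have h := Equiv.Perm.ofFn_comp_perm (Equiv.addLeft j) (Function.update f j a)
  refine h.symm.trans ?_
  rw [List.ofFn_succ]
  have e : ∀ l : Fin k, j + l.succ ≠ j := fun l hl => by simp at hl
  simp [e]

/-- Among the variables of type `s`, the Koszul degree of each is at least its fermion number, with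
equality exactly for `χ`, `φ` and `ρ`. -/
theorem koszulDegree_sub_fermionNumber {w : List (Letter N)}
    (hw : (w.map (typeCount s.other)).sum = 0) :
    (w.map Letter.fermionNumber).sum ≤ (w.map (koszulDegree s)).sum ∧
    ((w.map Letter.fermionNumber).sum = (w.map (koszulDegree s)).sum →
      ∃ (m n : List ℤ) (r : List (Fin N)), (m.length : ℤ) = (w.map (koszulDegree s)).sum ∧
        w.Perm (m.map (Letter.chi s) ++ (n.map (Letter.phi s) ++ r.map (Letter.rho s)))) := by
  induction w with
  | nil => exact ⟨le_rfl, fun _ => ⟨[], [], [], rfl, List.Perm.refl _⟩⟩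
  | cons x w ih =>
    simp only [List.map_cons, List.sum_cons] at hw ⊢
    have h0 := sum_typeCount_nonneg s.other w
    have hx : typeCount s.other x = 0 ∧ x.pol = s := by
      have h1 := typeCount_nonneg s.other x
      have h2 : typeCount s.other x = 0 := by omega
      refine ⟨h2, (s.eq_or_eq_other x.pol).resolve_right fun h => ?_⟩
      simp [typeCount, h] at h2
    obtain ⟨ih1, ih2⟩ := ih (by omega)
    obtain ⟨-, rfl⟩ := hx
    cases x with
    | phi t n₀ =>
      simp only [koszulDegree, Letter.fermionNumber, zero_add, Letter.pol] at *
      refine ⟨ih1, fun h => ?_⟩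
      obtain ⟨m, n, r, hm, hp⟩ := ih2 h
      refine ⟨m, n₀ :: n, r, hm, (hp.cons _).trans ?_⟩
      exact List.perm_middle.symm
    | rho t i =>
      simp only [koszulDegree, Letter.fermionNumber, zero_add, Letter.pol] at *
      refine ⟨ih1, fun h => ?_⟩
      obtain ⟨m, n, r, hm, hp⟩ := ih2 h
      refine ⟨m, n, i :: r, hm, (hp.cons _).trans ?_⟩
      rw [← List.append_assoc, ← List.append_assoc]
      exact List.perm_middle.symm
    | chi t m₀ =>
      simp only [koszulDegree, Letter.fermionNumber, Letter.pol, if_true] at *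
      refine ⟨by omega, fun h => ?_⟩
      obtain ⟨m, n, r, hm, hp⟩ := ih2 (by omega)
      exact ⟨m₀ :: m, n, r, by simp [hm, add_comm], hp.cons _⟩
    | aux t n₀ =>
      simp only [koszulDegree, Letter.fermionNumber, Letter.pol, if_true] at *
      exact ⟨by omega, fun h => by omega⟩
    | chiBar t n₀ =>
      simp only [koszulDegree, Letter.fermionNumber, Letter.pol] at *
      exact ⟨by omega, fun h => by omega⟩
    | zeta t n₀ =>
      simp only [koszulDegree, Letter.fermionNumber, Letter.pol] at *
      exact ⟨by omega, fun h => by omega⟩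

/-- On functionals of the variables of one type, the supercharge of the opposite type is the Koszul
differential. -/
theorem leibniz_charge_other (h : ∀ w, O w ≠ 0 → (w.map (typeCount s.other)).sum = 0) :
    leibniz Letter.parity (chargeMatrix nabla s.other) O =
      leibniz Letter.parity (koszul nabla (s.sign * Complex.I) (-Complex.I) s) O := by
  funext w
  by_cases hw : (w.map (typeCount s.other)).sum = 0
  · refine leibniz_congr_row fun x hx a => charge_other_eq_koszul ?_ a
    refine (s.eq_or_eq_other x.pol).resolve_right fun hxs => ?_
    have hle : ∀ y ∈ w.map (typeCount s.other), 0 ≤ y := by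
      simpa using fun a _ => typeCount_nonneg s.other a
    have := List.single_le_sum hle _ (List.mem_map_of_mem hx)
    rw [hw] at this
    simp [typeCount, hxs] at this
  · have hz : ∀ v : List (Letter N), v.length = w.length →
        (v.map (typeCount s.other)).sum = (w.map (typeCount s.other)).sum + 0 → O v = 0 :=
      fun v _ hv => by_contra fun hne => hw (by rw [← add_zero (List.sum _), ← hv, h v hne])
    rw [leibniz_eq_zero_of_grading typeCount_charge hz,
      leibniz_eq_zero_of_grading typeCount_koszul hz]

/-- Closed functionals of Koszul degree one are extended CLR terms: the cyclic Leibniz rule is the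
coefficient of `φ_{n₀} ⋯ φ_{n_k} ρ ⋯ ρ` in the closedness condition, the rotations in it being the
positions at which `χ` is replaced by `∇φ`. -/
theorem isExtendedCLRTerm_of_closed (hP : IsLocalFunctional O)
    (hpure : ∀ w, O w ≠ 0 → (w.map (typeCount s.other)).sum = 0) (hF : HasFermionNumber O 1)
    (hdeg : ∀ w, O w ≠ 0 → (w.map (koszulDegree s)).sum = 1)
    (hcl : leibniz Letter.parity (chargeMatrix nabla s.other) O = 0) :
    IsExtendedCLRTerm nabla s O where
  isLocal := hP
  support w hw := by
    obtain ⟨m, n, r, hm, hp⟩ := (koszulDegree_sub_fermionNumber (hpure w hw)).2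
      ((hF w hw).trans (hdeg w hw).symm)
    rw [hdeg w hw] at hm
    obtain ⟨m₀, rfl⟩ := List.length_eq_one_iff.1 (by exact_mod_cast hm : m.length = 1)
    exact ⟨m₀, n, r, hp⟩
  cyclic k n r := by
    have h := congrFun hcl (List.ofFn (fun j => Letter.phi s (n j)) ++ r.map (Letter.rho s))
    rw [leibniz_ofFn_append (fun _ => rfl) fun x hx a => ?_] at h
    · simp only [tsum_charge_phi, s.other_ne.symm, if_false, Pi.zero_apply] at h
      have hc : s.sign * Complex.I ≠ 0 :=
        mul_ne_zero (fun h0 => by simpa [h0] using s.sign_mul_sign) Complex.I_ne_zero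
      refine (mul_eq_zero.1 ?_).resolve_left hc
      rw [Finset.mul_sum, ← h]
      refine Finset.sum_congr rfl fun j _ => ?_
      rw [← tsum_mul_left]
      refine tsum_congr fun m => ?_
      rw [← mul_assoc]
      congr 1
      symm
      refine GradedSymmetric.eq_of_perm hP.symm
        ((ofFn_update_perm (fun j => Letter.phi s (n j)) j (Letter.chi s m)).append_right _) ?_
      rw [((ofFn_update_perm (fun j => Letter.phi s (n j)) j _).append_right _ |>.map _).sum_eq]
      simp [Letter.parity, Letter.fermionNumber, List.map_ofFn, Function.comp_def]
    · obtain ⟨i, -, rfl⟩ := List.mem_map.1 hx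
      cases a <;> rfl

end LocalFunctionals

/-! ### The cohomology of the supercharges -/

section Cohomology

variable {N : ℕ} {O : Functional N} {nabla : ℤ → ℂ} {s t : Pol}

/-- The grading that counts the variables of each of the two types. -/
noncomputable def typeCounts (a : Letter N) : Pol → ℤ := fun s => typeCount s a

theorem sum_typeCounts (w : List (Letter N)) (s : Pol) :
    (w.map typeCounts).sum s = (w.map (typeCount s)).sum := by
  induction w with
  | nil => rfl
  | cons x w ih => simp [ih, typeCounts]

theorem typeCounts_charge (a x : Letter N) (h : chargeMatrix nabla s a x ≠ 0) :
    typeCounts a = typeCounts x + 0 :=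
  funext fun t => typeCount_charge (t := t) a x h

theorem typeCounts_homotopy (a x : Letter N) (h : homotopy s a x ≠ 0) :
    typeCounts a = typeCounts x + 0 :=
  funext fun t => typeCount_homotopy (t := t) a x h

theorem sum_typeCount_add (s : Pol) (w : List (Letter N)) :
    (w.map (typeCount s)).sum + (w.map (typeCount s.other)).sum = w.length := by
  induction w with
  | nil => rfl
  | cons x w ih =>
    have h : typeCount s x + typeCount s.other x = 1 := by
      rcases s.eq_or_eq_other x.pol with h | h
      · simp [typeCount, h, s.other_ne.symm]
      · simp [typeCount, h, s.other_ne]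
    simp only [List.map_cons, List.sum_cons, List.length_cons]
    push_cast
    omega

theorem shift_grading {G : Type*} [AddMonoid G] {γ : Letter N → G}
    (h : ∀ a, γ (Letter.shift a) = γ a) (w : List (Letter N)) :
    ((w.map Letter.shift).map γ).sum = (w.map γ).sum := by
  rw [List.map_map]
  congr 2
  funext a
  exact h a

/-- Multiplication by a bounded function of the degree and a translation invariant grading. -/
theorem IsLocalFunctional.mul_grading (h : IsLocalFunctional O) {G : Type*} [AddCommMonoid G]
    {γ : Letter N → G} (hγ : ∀ a, γ (Letter.shift a) = γ a) {g : ℕ → G → ℂ}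
    (hg : ∀ n q, ‖g n q‖ ≤ 1) :
    IsLocalFunctional fun w => g w.length (w.map γ).sum * O w :=
  h.mul (fun u v huv => by rw [huv.length_eq, (huv.map γ).sum_eq])
    (fun w => by rw [List.length_map, shift_grading hγ]) fun w => hg _ _

theorem IsLocalFunctional.component (h : IsLocalFunctional O) {G : Type*} [AddCommMonoid G]
    {γ : Letter N → G} (hγ : ∀ a, γ (Letter.shift a) = γ a) (q : G) :
    IsLocalFunctional (component γ q O) := by
  classical
  have := h.mul_grading hγ (g := fun _ q' => if q' = q then 1 else 0) fun n q' => by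
    split_ifs <;> simp
  have e : _root_.component γ q O =
      fun w => (fun (_ : ℕ) (k : G) => if k = q then (1 : ℂ) else 0) w.length (w.map γ).sum *
        O w := by
    funext w
    simp [_root_.component]
  rw [e]
  exact this

/-- A functional of the variables of one type with `N_F = 1` that is annihilated by the supercharge
of the opposite type is an extended CLR term up to the image of this supercharge. -/
theorem exists_extendedCLRTerm (hn : IsDifferenceOperator nabla) (hP : IsLocalFunctional O)
    (hpure : ∀ w, O w ≠ 0 → (w.map (typeCount s.other)).sum = 0) (hF : HasFermionNumber O 1)
    (hcl : leibniz Letter.parity (chargeMatrix nabla s.other) O = 0) {D : Set ℕ}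
    (hD : ∀ w, O w ≠ 0 → w.length ∈ D) :
    ∃ P R : Functional N, IsExtendedCLRTerm nabla s P ∧ IsLocalFunctional R ∧
      HasFermionNumber R 2 ∧ (∀ w, P w ≠ 0 → w.length ∈ D) ∧ (∀ w, R w ≠ 0 → w.length ∈ D) ∧
      O = fun w => P w + leibniz Letter.parity (chargeMatrix nabla s.other) R w := by
  classical
  obtain ⟨L, M, hM, hκ⟩ := hn.locality
  have hσ : ∀ a : Letter N, 0 ≤ siteSize (fun _ => 0) a := siteSize_nonneg fun _ => le_rfl
  have hc : s.sign * Complex.I ≠ 0 :=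
    mul_ne_zero (fun h0 => by simpa [h0] using s.sign_mul_sign) Complex.I_ne_zero
  have hshift : ∀ a : Letter N, koszulDegree s a.shift = koszulDegree s a := fun a => by
    cases a <;> rfl
  set q : Functional N → Functional N :=
    leibniz Letter.parity (koszul nabla (s.sign * Complex.I) (-Complex.I) s) with hq
  set P := component (koszulDegree s) 1 O with hPdef
  have hPO : ∀ w, P w ≠ 0 → P w = O w ∧ O w ≠ 0 ∧ (w.map (koszulDegree s)).sum = 1 := by
    intro w hw
    by_cases h : (w.map (koszulDegree s)).sum = 1
    · have e : P w = O w := component_of_eq h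
      exact ⟨e, e ▸ hw, h⟩
    · exact absurd (component_of_ne h) hw
  have hPl : IsLocalFunctional P := hP.component hshift 1
  have hqO : q O = 0 := by rw [hq, ← leibniz_charge_other hpure, hcl]
  have hqP : q P = 0 := by
    rw [hPdef, ← zero_add (1 : ℤ), hq, leibniz_component koszulDegree_koszul, ← hq, hqO]
    funext w
    simp [component]
  have hPpure : ∀ w, P w ≠ 0 → (w.map (typeCount s.other)).sum = 0 := fun w hw =>
    hpure w (hPO w hw).2.1
  set C : Functional N := fun w => O w - P w with hCdef
  have hCO : ∀ w, C w ≠ 0 → O w ≠ 0 ∧ (w.map (koszulDegree s)).sum ≠ 1 := by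
    intro w hw
    have h : (w.map (koszulDegree s)).sum ≠ 1 := fun h =>
      hw (by rw [hCdef, hPdef]; simp only [component_of_eq h, sub_self])
    refine ⟨fun h0 => hw ?_, h⟩
    rw [hCdef, hPdef]
    simp only [component_of_ne h, h0, sub_self]
  have hqC : q C = 0 := by
    funext w
    rw [hCdef, hq, leibniz_sub (admissible_koszul hM hκ (fun _ => le_rfl)
      fun _ _ => by positivity) hP.bounded hPl.bounded, ← hq, hqO, hqP]
    simp
  obtain ⟨R, hR, hqR⟩ := exists_local_koszul_primitive hM hκ hn.ne_zero hc
    (neg_ne_zero.2 Complex.I_ne_zero) (hP.sub hPl) (fun w hw => by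
      have h1 := (koszulDegree_sub_fermionNumber (hpure w (hCO w hw).1)).1
      have h2 := hF w (hCO w hw).1
      have h3 := (hCO w hw).2
      omega) hqC
  -- The primitive is cut down to the words that can contribute to `C`. The differential is
  -- homogeneous for these gradings, so this does not change its image.
  set γ : Letter N → ℤ × ℤ := fun a => (typeCount s.other a, a.fermionNumber) with hγ
  have hγ1 : ∀ w : List (Letter N), (w.map γ).sum =
      ((w.map (typeCount s.other)).sum, (w.map Letter.fermionNumber).sum) := by
    intro w
    induction w with
    | nil => rfl
    | cons x w ih => rw [List.map_cons, List.sum_cons, ih]; rfl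
  set g : ℕ → ℤ × ℤ → ℂ := fun n k => if n ∈ D ∧ k = (0, 2) then 1 else 0 with hg
  set R' : Functional N := fun w => g w.length (w.map γ).sum * R w with hR'
  have hR'0 : ∀ w, R' w ≠ 0 → w.length ∈ D ∧ (w.map (typeCount s.other)).sum = 0 ∧
      (w.map Letter.fermionNumber).sum = 2 := by
    intro w hw
    have h1 : g w.length (w.map γ).sum ≠ 0 := left_ne_zero_of_mul hw
    rw [hγ1] at h1
    simpa [hg] using h1
  have hqR' : q R' = C := by
    funext w
    rw [hR', hq, leibniz_mul (c := ((0, 1) : ℤ × ℤ)) (fun a x hax => by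
      rw [hγ]; exact Prod.ext (typeCount_koszul a x hax) (fermionNumber_koszul a x hax)) g, hqR,
      hγ1]
    by_cases hw : C w = 0
    · rw [show (fun w => O w - P w) w = 0 from hw, mul_zero, hw]
    · have hO := (hCO w hw).1
      have : g w.length (((w.map (typeCount s.other)).sum,
          (w.map Letter.fermionNumber).sum) + (0, 1)) = 1 := by
        simp [hg, hD w hO, hpure w hO, hF w hO]
      rw [this, one_mul]
  refine ⟨P, R', isExtendedCLRTerm_of_closed hPl hPpure (fun w hw => hF w (hPO w hw).2.1)
    (fun w hw => (hPO w hw).2.2) (by rw [leibniz_charge_other hPpure, ← hq, hqP]),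
    hR.mul_grading (fun a => by cases a <;> rfl) fun n k => ?_, fun w hw => (hR'0 w hw).2.2,
    fun w hw => hD w (hPO w hw).2.1, fun w hw => (hR'0 w hw).1, ?_⟩
  · simp only [hg]
    split_ifs <;> simp
  · rw [leibniz_charge_other fun w hw => (hR'0 w hw).2.1, ← hq, hqR']
    funext w
    simp [hCdef]

theorem charge_homotopy_self (hn : IsDifferenceOperator nabla)
    (hO : Decays (siteSize fun _ => 0) O) (w : List (Letter N)) :
    leibniz Letter.parity (chargeMatrix nabla s) (leibniz Letter.parity (homotopy s) O) w +
      leibniz Letter.parity (homotopy s) (leibniz Letter.parity (chargeMatrix nabla s) O) w =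
      (w.map (typeCount s)).sum * O w := by
  classical
  rw [leibniz_anticomm (siteSize_nonneg fun _ => le_rfl) (admissible_charge hn)
    admissible_homotopy oddMatrix_charge oddMatrix_homotopy anticomm_charge_homotopy_self hO,
    leibniz_diagonal fun a => (typeCount s a : ℂ)]
  congr 1
  induction w with
  | nil => simp
  | cons x w ih => simp [ih]

theorem charge_homotopy_other (hn : IsDifferenceOperator nabla)
    (hO : Decays (siteSize fun _ => 0) O) (w : List (Letter N)) :
    leibniz Letter.parity (chargeMatrix nabla s) (leibniz Letter.parity (homotopy s.other) O) w +
      leibniz Letter.parity (homotopy s.other) (leibniz Letter.parity (chargeMatrix nabla s) O) w =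
      0 := by
  rw [leibniz_anticomm (siteSize_nonneg fun _ => le_rfl) (admissible_charge hn)
    admissible_homotopy oddMatrix_charge oddMatrix_homotopy anticomm_charge_homotopy_other hO,
    leibniz_zero_matrix]

theorem charge_charge_other (hn : IsDifferenceOperator nabla)
    (hO : Decays (siteSize fun _ => 0) O) (w : List (Letter N)) :
    leibniz Letter.parity (chargeMatrix nabla s)
        (leibniz Letter.parity (chargeMatrix nabla s.other) O) w +
      leibniz Letter.parity (chargeMatrix nabla s.other)
        (leibniz Letter.parity (chargeMatrix nabla s) O) w = 0 := by
  rw [leibniz_anticomm (siteSize_nonneg fun _ => le_rfl) (admissible_charge hn)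
    (admissible_charge hn) oddMatrix_charge oddMatrix_charge anticomm_charge_charge hO,
    leibniz_zero_matrix]

theorem HasFermionNumber.homotopy {q : ℤ} (h : HasFermionNumber O q) :
    HasFermionNumber (leibniz Letter.parity (homotopy s) O) (q + 1) := by
  intro w hw
  by_contra hq
  refine hw (leibniz_eq_zero_of_grading fermionNumber_homotopy fun v _ hv => ?_)
  by_contra hv0
  have := h v hv0
  omega

/-- The part of an invariant functional in the variables of type `s` only is `Q_s P` for an extended
CLR term `P`, up to the image of the product of the supercharges: the homotopy `K_s` gives a
primitive that is closed under the other supercharge. -/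
theorem exists_pure_part (hn : IsDifferenceOperator nabla) (hS : IsLocalFunctional O)
    (hF : HasFermionNumber O 0)
    (hcl : ∀ t, leibniz Letter.parity (chargeMatrix nabla t) O = 0) {D : Set ℕ}
    (hD : ∀ w, O w ≠ 0 → w.length ∈ D) (s : Pol) :
    ∃ P R : Functional N, IsExtendedCLRTerm nabla s P ∧ IsLocalFunctional R ∧
      HasFermionNumber R 2 ∧ (∀ w, P w ≠ 0 → w.length ∈ D) ∧ (∀ w, R w ≠ 0 → w.length ∈ D) ∧
      ∀ w : List (Letter N),
        (open Classical in if (w.map (typeCount s.other)).sum = 0 ∧ (w.map (typeCount s)).sum ≠ 0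
          then O w else 0) =
        leibniz Letter.parity (chargeMatrix nabla s) P w +
        leibniz Letter.parity (chargeMatrix nabla s)
          (leibniz Letter.parity (chargeMatrix nabla s.other) R) w := by
  classical
  -- The inverse of a vanishing count is `0`, which discards the empty word.
  set g : ℕ → (Pol → ℤ) → ℂ := fun _ k => if k s.other = 0 then ((k s : ℤ) : ℂ)⁻¹ else 0 with hg
  set O' : Functional N := fun w => g w.length (w.map typeCounts).sum * O w with hO'
  have hO'l : IsLocalFunctional O' := hS.mul_grading (fun a => by cases a <;> rfl) fun n k => by
    simp only [hg]
    split_ifs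
    · rw [norm_inv, Complex.norm_intCast]
      rcases eq_or_ne (k s) 0 with h0 | h0
      · simp [h0]
      · exact inv_le_one_of_one_le₀ (by exact_mod_cast Int.one_le_abs h0)
    · simp
  have hcl' : ∀ t, leibniz Letter.parity (chargeMatrix nabla t) O' = 0 := fun t => by
    funext w
    rw [hO', leibniz_mul typeCounts_charge g, hcl]
    simp
  set P := leibniz Letter.parity (homotopy s) O' with hP
  have hPpure : ∀ w, P w ≠ 0 → (w.map (typeCount s.other)).sum = 0 := by
    intro w hw
    by_contra hq
    refine hw (leibniz_eq_zero_of_grading typeCounts_homotopy fun v _ hv => ?_)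
    have : (v.map typeCounts).sum s.other ≠ 0 := by
      rw [hv, add_zero, sum_typeCounts]; exact hq
    simp [hO', hg, this]
  have hO'F : HasFermionNumber O' 0 := fun w hw => hF w (right_ne_zero_of_mul hw)
  obtain ⟨Pc, R, hPc, hR, hRF, hPD, hRD, e⟩ := exists_extendedCLRTerm hn (hO'l.homotopy s) hPpure
    hO'F.homotopy (by
      funext w
      have := charge_homotopy_other (s := s.other) hn hO'l.bounded w
      rw [hcl', s.other_other] at this
      simpa [leibniz_zero, Pi.zero_def] using this)
    (leibniz_length fun w hw => hD w (right_ne_zero_of_mul hw))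
  refine ⟨Pc, R, hPc, hR, hRF, hPD, hRD, fun w => ?_⟩
  rw [← leibniz_add (admissible_charge hn) hPc.isLocal.bounded
    (hR.bounded.leibniz (siteSize_nonneg fun _ => le_rfl) (admissible_charge hn)), ← e]
  have h := charge_homotopy_self (s := s) hn hO'l.bounded w
  rw [hcl'] at h
  simp only [Pi.zero_def, leibniz_zero, add_zero] at h
  rw [h, hO']
  simp only [hg, sum_typeCounts]
  by_cases h1 : (w.map (typeCount s.other)).sum = 0
  · by_cases h2 : (w.map (typeCount s)).sum = 0
    · simp [h2]
    · have : ((w.map (typeCount s)).sum : ℂ) ≠ 0 := by exact_mod_cast h2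
      simp only [h1, h2, ne_eq, not_false_eq_true, and_self, if_true]
      field_simp
  · simp [h1]

/-- The part of an invariant functional that involves variables of both types is in the image of
the product of the supercharges: a multiple of `K_{s'} K_s` applied to it is a primitive, where `s'`
is the type opposite to `s`. -/
theorem exists_mixed_part (hn : IsDifferenceOperator nabla) (hS : IsLocalFunctional O)
    (hF : HasFermionNumber O 0)
    (hcl : ∀ t, leibniz Letter.parity (chargeMatrix nabla t) O = 0) {D : Set ℕ}
    (hD : ∀ w, O w ≠ 0 → w.length ∈ D) (s : Pol) :
    ∃ T : Functional N, IsLocalFunctional T ∧ HasFermionNumber T 2 ∧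
      (∀ w, T w ≠ 0 → w.length ∈ D) ∧ ∀ w : List (Letter N),
        (open Classical in if (w.map (typeCount s.other)).sum ≠ 0 ∧ (w.map (typeCount s)).sum ≠ 0
          then O w else 0) =
        leibniz Letter.parity (chargeMatrix nabla s)
          (leibniz Letter.parity (chargeMatrix nabla s.other) T) w := by
  classical
  -- The inverse of a vanishing count is `0`, which discards words with variables of one type only.
  set g : ℕ → (Pol → ℤ) → ℂ := fun _ k => ((k s * k s.other : ℤ) : ℂ)⁻¹ with hg
  set O' : Functional N := fun w => g w.length (w.map typeCounts).sum * O w with hO'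
  have hO'l : IsLocalFunctional O' := hS.mul_grading (fun a => by cases a <;> rfl) fun n k => by
    simp only [hg]
    rw [norm_inv, Complex.norm_intCast]
    rcases eq_or_ne (k s * k s.other) 0 with h0 | h0
    · simp [h0]
    · exact inv_le_one_of_one_le₀ (by exact_mod_cast Int.one_le_abs h0)
  have hcl' : ∀ t, leibniz Letter.parity (chargeMatrix nabla t) O' = 0 := fun t => by
    funext w
    rw [hO', leibniz_mul typeCounts_charge g, hcl]
    simp
  have hO'F : HasFermionNumber O' 0 := fun w hw => hF w (right_ne_zero_of_mul hw)
  have h1l := hO'l.homotopy s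
  refine ⟨_, h1l.homotopy s.other, hO'F.homotopy.homotopy,
    leibniz_length (leibniz_length fun w hw => hD w (right_ne_zero_of_mul hw)), fun w => ?_⟩
  have e1 : leibniz Letter.parity (chargeMatrix nabla s.other)
      (leibniz Letter.parity (homotopy s) O') = 0 := by
    funext v
    have := charge_homotopy_other (s := s.other) hn hO'l.bounded v
    rw [hcl', s.other_other] at this
    simpa [leibniz_zero, Pi.zero_def] using this
  have e2 : leibniz Letter.parity (chargeMatrix nabla s.other) (leibniz Letter.parity
      (homotopy s.other) (leibniz Letter.parity (homotopy s) O')) = fun v =>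
      (((v.map typeCounts).sum s.other : ℤ) : ℂ) * leibniz Letter.parity (homotopy s) O' v := by
    funext v
    have := charge_homotopy_self (s := s.other) hn h1l.bounded v
    rw [e1] at this
    simpa [leibniz_zero, Pi.zero_def, sum_typeCounts] using this
  rw [e2, leibniz_mul typeCounts_charge fun _ k => ((k s.other : ℤ) : ℂ)]
  have h := charge_homotopy_self (s := s) hn hO'l.bounded w
  rw [hcl'] at h
  simp only [Pi.zero_def, leibniz_zero, add_zero] at h
  rw [h, hO', add_zero]
  simp only [hg, sum_typeCounts]
  by_cases h1 : (w.map (typeCount s.other)).sum = 0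
  · simp [h1]
  by_cases h2 : (w.map (typeCount s)).sum = 0
  · simp [h2]
  have h1' : ((w.map (typeCount s.other)).sum : ℂ) ≠ 0 := by exact_mod_cast h1
  have h2' : ((w.map (typeCount s)).sum : ℂ) ≠ 0 := by exact_mod_cast h2
  simp only [h1, h2, ne_eq, not_false_eq_true, and_self, if_true]
  rw [Int.cast_mul]
  field_simp

end Cohomology

theorem proposition3 (N : ℕ) (nabla : ℤ → ℂ) (hnabla : IsDifferenceOperator nabla)
    (S : Functional N) (hS : IsLocalFunctional S) (hNF : HasFermionNumber S 0)
    (hconst : S [] = 0)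
    (hplus : supercharge nabla Pol.plus S = 0) (hminus : supercharge nabla Pol.minus S = 0) :
    ∃ T Pplus Pminus : Functional N,
      IsLocalFunctional T ∧ HasFermionNumber T 2 ∧
      IsExtendedCLRTerm nabla Pol.plus Pplus ∧
      IsExtendedCLRTerm nabla Pol.minus Pminus ∧
      S = supercharge nabla Pol.plus (supercharge nabla Pol.minus T) +
          supercharge nabla Pol.plus Pplus + supercharge nabla Pol.minus Pminus ∧
      ∀ D : ℕ, DegreeLE S D → DegreeLE T D ∧ DegreeLE Pplus D ∧ DegreeLE Pminus D := by
  classical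
  simp only [supercharge_eq] at hplus hminus ⊢
  have hcl : ∀ t, leibniz Letter.parity (chargeMatrix nabla t) S = 0 := fun t => by
    cases t <;> assumption
  set D : Set ℕ := {d | ∃ v, S v ≠ 0 ∧ v.length = d} with hDdef
  have hD : ∀ w, S w ≠ 0 → w.length ∈ D := fun w hw => ⟨w, hw, rfl⟩
  obtain ⟨T, hT, hTF, hTD, eT⟩ := exists_mixed_part hnabla hS hNF hcl hD .plus
  obtain ⟨P, R, hP, hR, hRF, hPD, hRD, e⟩ := exists_pure_part hnabla hS hNF hcl hD .plus
  obtain ⟨P', R', hP', hR', hRF', hPD', hRD', e'⟩ := exists_pure_part hnabla hS hNF hcl hD .minus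
  have hlen : ∀ {O : Functional N}, (∀ w, O w ≠ 0 → w.length ∈ D) →
      ∀ d, DegreeLE S d → DegreeLE O d := by
    intro O hO d hd w hw
    by_contra h0
    obtain ⟨v, hv, hvl⟩ := hO w h0
    exact hv (hd v (hvl ▸ hw))
  have hne : ∀ w, T w + R w - R' w ≠ 0 → T w ≠ 0 ∨ R w ≠ 0 ∨ R' w ≠ 0 := by
    intro w hw
    by_contra! h
    simp [h] at hw
  -- The sign of `R'` comes from exchanging the two supercharges in `Q_- Q_+ R'`.
  refine ⟨fun w => T w + R w - R' w, P, P', (hT.add hR).sub hR', fun w hw => ?_, hP, hP', ?_,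
    fun d hd => ⟨hlen (fun w hw => ?_) d hd, hlen hPD d hd, hlen hPD' d hd⟩⟩
  · rcases hne w hw with h | h | h
    exacts [hTF w h, hRF w h, hRF' w h]
  · have hσ : ∀ a : Letter N, 0 ≤ siteSize (fun _ => 0) a := siteSize_nonneg fun _ => le_rfl
    have ha : ∀ t, Admissible (siteSize fun _ => 0) (chargeMatrix (N := N) nabla t) :=
      fun t => admissible_charge hnabla
    have hQ : ∀ {O : Functional N}, IsLocalFunctional O → Decays (siteSize fun _ => 0)
        (leibniz Letter.parity (chargeMatrix nabla .minus) O) :=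
      fun hO => hO.bounded.leibniz hσ (ha _)
    have e1 : leibniz Letter.parity (chargeMatrix nabla .minus) (fun w => T w + R w - R' w) =
        fun w => leibniz Letter.parity (chargeMatrix nabla .minus) T w +
          leibniz Letter.parity (chargeMatrix nabla .minus) R w -
          leibniz Letter.parity (chargeMatrix nabla .minus) R' w := by
      funext w
      rw [leibniz_sub (ha _) (hT.add hR).bounded hR'.bounded,
        leibniz_add (ha _) hT.bounded hR.bounded]
    funext w
    simp only [Pi.add_apply]
    rw [e1, leibniz_sub (ha _) ((hQ hT).add hσ (hQ hR)) (hQ hR'), leibniz_add (ha _) (hQ hT) (hQ hR)]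
    have hanti : leibniz Letter.parity (chargeMatrix nabla .plus)
          (leibniz Letter.parity (chargeMatrix nabla .minus) R') w +
        leibniz Letter.parity (chargeMatrix nabla .minus)
          (leibniz Letter.parity (chargeMatrix nabla .plus) R') w = 0 :=
      charge_charge_other (s := .plus) hnabla hR'.bounded w
    have h1 : (if (w.map (typeCount .minus)).sum ≠ 0 ∧ (w.map (typeCount .plus)).sum ≠ 0
        then S w else 0) =
        leibniz Letter.parity (chargeMatrix nabla .plus)
          (leibniz Letter.parity (chargeMatrix nabla .minus) T) w := eT w
    have h2 : (if (w.map (typeCount .minus)).sum = 0 ∧ (w.map (typeCount .plus)).sum ≠ 0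
        then S w else 0) =
        leibniz Letter.parity (chargeMatrix nabla .plus) P w +
          leibniz Letter.parity (chargeMatrix nabla .plus)
            (leibniz Letter.parity (chargeMatrix nabla .minus) R) w := e w
    have h3 : (if (w.map (typeCount .plus)).sum = 0 ∧ (w.map (typeCount .minus)).sum ≠ 0
        then S w else 0) =
        leibniz Letter.parity (chargeMatrix nabla .minus) P' w +
          leibniz Letter.parity (chargeMatrix nabla .minus)
            (leibniz Letter.parity (chargeMatrix nabla .plus) R') w := e' w
    have hsum : S w = (if (w.map (typeCount .minus)).sum ≠ 0 ∧ (w.map (typeCount .plus)).sum ≠ 0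
          then S w else 0) +
        (if (w.map (typeCount .minus)).sum = 0 ∧ (w.map (typeCount .plus)).sum ≠ 0
          then S w else 0) +
        (if (w.map (typeCount .plus)).sum = 0 ∧ (w.map (typeCount .minus)).sum ≠ 0
          then S w else 0) := by
      by_cases hp : (w.map (typeCount .plus)).sum = 0
      · by_cases hm : (w.map (typeCount .minus)).sum = 0
        · have hl := sum_typeCount_add .plus w
          have hw : w = [] := List.length_eq_zero_iff.1 (by
            simp only [Pol.other, hp, hm] at hl; omega)
          simp [hw, hconst]
        · simp [hp, hm]
      · by_cases hm : (w.map (typeCount .minus)).sum = 0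
        · simp [hp, hm]
        · simp [hp, hm]
    rw [hsum]
    linear_combination h1 + h2 + h3 + hanti
  · rcases hne w hw with h | h | h
    exacts [hTD w h, hRD w h, hRD' w h]
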